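/- **Setting.** Let $\mathcal X,\mathcal Y$ be complex Banach spaces, $0<\alpha<1$, $\beta>-1$, $T>0$. *Transfer operator.* $K$ is holomorphic in the sector $|\arg z|<\pi$ with values in the bounded linear operators $\mathcal X\to\mathcal Y$, $\|K(z)\|\le M|z|^{-\alpha}$ there with a constant $M>0$, and $K$ extends continuously to the closed upper half-plane without $0$ and (with possibly different values on the negative axis) to the closed lower half-plane without $0$. $K$ is the Laplace transform, in some right half-plane, of the kernel $k$. Put $$u(t)=\int_0^t k(t-s)f(s)\,ds ,\qquad G(x)=\frac{K(xe^{-i\pi})-K(xe^{i\pi})}{2\pi i}\quad(x>0).$$ *Runge–Kutta method.* Coefficients $\mathbf A,\mathbf b,\mathbf c$ with $\mathbf A\mathbb 1=\mathbf c$, $0\le c_i\le 1$; $\mathbf A$ is invertible; the method is A-stable, i.e. for $\Re z\le 0$ the matrix $I-z\mathbf A$ is invertible and $|R(z)|\le1$, where $R(z)=1+z\mathbf b^\top(I-z\mathbf A)^{-1}\mathbb 1$; it is stiffly accurate ($\mathbf b=\mathbf A^\top\mathbf e_s$); it has classical order $p\ge1$ and stage order $q\le p$ (i.e. $\sum_j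 a_{ij}c_j^{\ell-1}=c_i^\ell/\ell$ for all $i$ and $1\le\ell\le q$). *Mesh and scheme.* For $0=t_0<t_1<\dots<t_N=T$ let $\tau_n=t_n-t_{n-1}$, let $\tau_{\max},\tau_{\min}$ be the largest and smallest step, and let $c_\Delta=\frac12\max_{2\le i\le N}\left(\frac{\tau_i}{\tau_{i-1}}+\frac{\tau_{i-1}}{\tau_i}\right)$ ($c_\Delta=1$ if $N=1$). The Runge–Kutta gCQ approximation is $$u_n=\int_0^\infty G(x)y_n(x)\,dx,\qquad y_n(x)=\sum_{j=1}^n\Big(\prod_{l=j+1}^nR(-\tau_lx)\Big)\tau_j\mathbf b^\top(I+\tau_jx\mathbf A)^{-1}\big(f(t_{j-1}+c_i\tau_j)\big)_i .$$ *Data.* Let $m=\lceil p-\beta-1\rceil$, $\nu=\lceil p-\alpha-\beta-1\rceil$, $\mu=\min\{p,q+1+\alpha\}$. Suppose that on $[0,T]$ $$f(t)=\sum_{\ell=0}^m\frac{f^{(\ell+\beta)}(0)}{\Gamma(\ell+\beta+1)}t^{\ell+\beta}+\frac1{\Gamma(m+\beta+1)}\int_0^t(t-s)^{m+\beta}f^{(m+\beta+1)}(s)\,ds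 ,$$ where $f^{(\mu')}$ is the Riemann–Liouville derivative (fractional integral of order $-\mu'$ if $-1<\mu'<0$), the values at $0$ are limits at $0^+$, $f^{(m+\beta+1)}$ is continuous on $[0,T]$, sums over an empty range are $0$, and at $t=0$ a power of $t$ with negative exponent is read as $0$. **Theorem.** There is a constant $C>0$, depending only on the Runge–Kutta method and on $p,q,\alpha,\beta,T$, such that for all $\mathcal X,\mathcal Y,K,k,M$ as above, all meshes of $[0,T]$ and all $1\le n\le N$ the following holds for all such $f$. (i) (General mesh.) If $f^{(\ell+\beta)}(0)=0$ for all $0\le\ell\le\nu$, then $$\|u(t_n)-u_n\|\le CM\max\{1,|\log\tau_{\min}|\}\,\tau_{\max}^{\mu}\Big(\sum_{\ell=\max\{0,\nu+1\}}^{m}\|f^{(\ell+\beta)}(0)\|+\|f^{(m+\beta+1)}\|_{C^0([0,t_n],\mathcal X)}\Big).$$ In particular, for every $f\in C^p([0,T];\mathcal X)$ with $f^{(\ell)}(0)=0$ for $0\le\ell\le p-1$, $$\|u(t_n)-u_n\|\le CM\max\{1,|\log\tau_{\min}|\}\,\tau_{\max}^{\mu}\,\|f^{(p)}\|_{C^0([0,t_n],\mathcal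 X)} .$$ (ii) (Quasi-uniform mesh.) Let $\kappa=\min\{\nu,\lceil q-\beta\rceil\}$. If $f^{(\ell+\beta)}(0)=0$ for all $0\le\ell\le\kappa$, then $$\|u(t_n)-u_n\|\le CM\,c_\Delta^{\max\{0,p-q-\alpha\}}\max\{1,|\log\tau_{\min}|\}\,\tau_{\max}^{\mu}\Big(\sum_{\ell=\max\{0,\kappa+1\}}^{m}\|f^{(\ell+\beta)}(0)\|+\|f^{(m+\beta+1)}\|_{C^0([0,t_n],\mathcal X)}\Big).$$ -/

import Mathlib

open Set Filter Topology Asymptotics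
open scoped ContDiff

noncomputable section

namespace RKgCQ

/-! ### Runge-Kutta methods -/

/-- The coefficients (Butcher tableau) of a Runge-Kutta method with `s + 1` stages. -/
structure RKMethod (s : ℕ) where
  A : Matrix (Fin (s + 1)) (Fin (s + 1)) ℝ
  b : Fin (s + 1) → ℝ
  c : Fin (s + 1) → ℝ

namespace RKMethod

variable {s : ℕ} (rk : RKMethod s)

/-- The matrix `I - z A`, for complex `z`. -/
def stageMatrix (z : ℂ) : Matrix (Fin (s + 1)) (Fin (s + 1)) ℂ :=
  1 - z • rk.A.map (fun a : ℝ => (a : ℂ))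

/-- The row vector `bᵀ (I - z A)⁻¹`. -/
def weightRow (z : ℂ) : Fin (s + 1) → ℂ :=
  Matrix.vecMul (fun i => (rk.b i : ℂ)) (rk.stageMatrix z)⁻¹

/-- The stability function `R(z) = 1 + z bᵀ (I - z A)⁻¹ 𝟙`. -/
def stability (z : ℂ) : ℂ :=
  1 + z * ∑ i, rk.weightRow z i

/-- A-stability: for `Re z ≤ 0` the stage equations of the test problem are uniquely solvable
(so that `R(z)` is defined) and `|R(z)| ≤ 1`. -/
def IsAStable : Prop :=
  ∀ z : ℂ, z.re ≤ 0 → IsUnit (rk.stageMatrix z) ∧ ‖rk.stability z‖ ≤ 1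

/-- Stiff accuracy: `b = Aᵀ e_s`, i.e. `b` is the last row of `A`. -/
def IsStifflyAccurate : Prop :=
  ∀ j, rk.b j = rk.A (Fin.last s) j

/-- Classical order (at least) `p`: for every smooth initial value problem `y' = F(t, y)`, the
local error after one step of length `h` is `O(h ^ (p + 1))` as `h → 0+`. Here `Y h i` are the
internal stages; the stages meant are those that tend to the initial value as `h → 0+`. -/
def HasOrder (p : ℕ) : Prop :=
  ∀ (d : ℕ) (F : ℝ → (Fin d → ℝ) → (Fin d → ℝ)),
    ContDiff ℝ ∞ (fun w : ℝ × (Fin d → ℝ) => F w.1 w.2) →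
    ∀ (t₀ : ℝ) (y : ℝ → (Fin d → ℝ)),
      (∀ᶠ t in 𝓝 t₀, HasDerivAt y (F t (y t)) t) →
      ∀ Y : ℝ → Fin (s + 1) → (Fin d → ℝ),
        (∀ᶠ h in 𝓝[>] (0 : ℝ), ∀ i,
          Y h i = y t₀ + h • ∑ j, rk.A i j • F (t₀ + rk.c j * h) (Y h j)) →
        (∀ i, Tendsto (fun h => Y h i) (𝓝[>] (0 : ℝ)) (𝓝 (y t₀))) →
        (fun h : ℝ => y (t₀ + h) - (y t₀ + h • ∑ i, rk.b i • F (t₀ + rk.c i * h) (Y h i)))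
          =O[𝓝[>] (0 : ℝ)] (fun h : ℝ => h ^ (p + 1))

/-- Stage order (at least) `q`: `∑ⱼ aᵢⱼ cⱼ^(ℓ-1) = cᵢ^ℓ / ℓ` for `1 ≤ ℓ ≤ q` and every stage. -/
def HasStageOrder (q : ℕ) : Prop :=
  ∀ ℓ : ℕ, 1 ≤ ℓ → ℓ ≤ q → ∀ i, ∑ j, rk.A i j * rk.c j ^ (ℓ - 1) = rk.c i ^ ℓ / (ℓ : ℝ)

/-- The Runge-Kutta methods considered: A-stable and stiffly accurate, of classical order `p ≥ 1`
and stage order `q ≤ p`, with invertible coefficient matrix, under the usual conventions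
`A 𝟙 = c` and `0 ≤ cᵢ ≤ 1`. -/
structure IsAdmissible (p q : ℕ) : Prop where
  row_sum : ∀ i, ∑ j, rk.A i j = rk.c i
  c_mem : ∀ i, rk.c i ∈ Icc (0 : ℝ) 1
  invertible : IsUnit rk.A
  aStable : rk.IsAStable
  stifflyAccurate : rk.IsStifflyAccurate
  one_le_order : 1 ≤ p
  order : rk.HasOrder p
  stageOrder_le : q ≤ p
  stageOrder : rk.HasStageOrder q

end RKMethod

/-! ### Transfer operators and kernels -/

section Transfer

variable {X Y : Type*} [NormedAddCommGroup X] [NormedSpace ℂ X]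
  [NormedAddCommGroup Y] [NormedSpace ℂ Y]

/-- Sectorial transfer operators: `K` is holomorphic in `|arg z| < π`, satisfies
`‖K(z)‖ ≤ M |z|^(-α)` there, and extends continuously to the negative real axis from above and
from below (with possibly different boundary values). -/
structure IsSectorial (K : ℂ → X →L[ℂ] Y) (M α : ℝ) : Prop where
  holomorphic : DifferentiableOn ℂ K Complex.slitPlane
  bound : ∀ z ∈ Complex.slitPlane, ‖K z‖ ≤ M * ‖z‖ ^ (-α)
  continuous_upper : ∃ K₁ : ℂ → X →L[ℂ] Y,
    ContinuousOn K₁ {z | 0 ≤ z.im ∧ z ≠ 0} ∧ EqOn K₁ K {z | 0 < z.im}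
  continuous_lower : ∃ K₂ : ℂ → X →L[ℂ] Y,
    ContinuousOn K₂ {z | z.im ≤ 0 ∧ z ≠ 0} ∧ EqOn K₂ K {z | z.im < 0}

/-- `K(x e^{iπ})`: the boundary value of `K` at `-x` on the upper edge of the cut. -/
def upperTrace (K : ℂ → X →L[ℂ] Y) (x : ℝ) : X →L[ℂ] Y :=
  limUnder (𝓝[{z : ℂ | 0 < z.im}] (-(x : ℂ))) K

/-- `K(x e^{-iπ})`: the boundary value of `K` at `-x` on the lower edge of the cut. -/
def lowerTrace (K : ℂ → X →L[ℂ] Y) (x : ℝ) : X →L[ℂ] Y :=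
  limUnder (𝓝[{z : ℂ | z.im < 0}] (-(x : ℂ))) K

/-- `G(x) = (K(x e^{-iπ}) - K(x e^{iπ})) / (2πi)`. -/
def jump (K : ℂ → X →L[ℂ] Y) (x : ℝ) : X →L[ℂ] Y :=
  (2 * (Real.pi : ℂ) * Complex.I)⁻¹ • (lowerTrace K x - upperTrace K x)

/-- `K` is the Laplace transform of the kernel `k`, in some right half-plane. -/
def IsLaplaceTransform (k : ℝ → X →L[ℂ] Y) (K : ℂ → X →L[ℂ] Y) : Prop :=
  ∃ σ : ℝ, 0 ≤ σ ∧ ∀ z : ℂ, σ < z.re →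
    MeasureTheory.IntegrableOn (fun t : ℝ => Complex.exp (-z * t) • k t) (Ioi 0) ∧
    ∫ t in Ioi (0 : ℝ), Complex.exp (-z * t) • k t = K z

/-- The convolution `u(t) = ∫₀ᵗ k(t - r) f(r) dr`. -/
def convolution (k : ℝ → X →L[ℂ] Y) (f : ℝ → X) (t : ℝ) : Y :=
  ∫ r in (0 : ℝ)..t, k (t - r) (f r)

end Transfer

/-! ### Time meshes -/

/-- `0 = t₀ < t₁ < ⋯ < t_N = T`. -/
structure IsMesh (T : ℝ) (N : ℕ) (t : ℕ → ℝ) : Prop where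
  zero : t 0 = 0
  lt_succ : ∀ n < N, t n < t (n + 1)
  last : t N = T

/-- The step size `τₙ = tₙ - tₙ₋₁`, for `n ≥ 1`. -/
def step (t : ℕ → ℝ) (n : ℕ) : ℝ := t n - t (n - 1)

/-- The largest of the step sizes `τ₁, …, τ_N`. -/
def maxStep (N : ℕ) (t : ℕ → ℝ) : ℝ := ⨆ j : Fin N, step t (j + 1)

/-- The smallest of the step sizes `τ₁, …, τ_N`. -/
def minStep (N : ℕ) (t : ℕ → ℝ) : ℝ := ⨅ j : Fin N, step t (j + 1)

/-- `c_Δ = ½ max_{2 ≤ i ≤ N} (τᵢ / τᵢ₋₁ + τᵢ₋₁ / τᵢ)`. Every term is at least `1`, so that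
`max 1` only serves to make `c_Δ = 1` for a mesh with a single step. -/
def quasiUniformity (N : ℕ) (t : ℕ → ℝ) : ℝ :=
  max 1 (⨆ i : Fin (N - 1),
    (step t (i + 2) / step t (i + 1) + step t (i + 1) / step t (i + 2)) / 2)

/-! ### The Runge-Kutta based generalized convolution quadrature -/

section Scheme

variable {X Y : Type*} [NormedAddCommGroup X] [NormedSpace ℂ X]
  [NormedAddCommGroup Y] [NormedSpace ℂ Y]

/-- The Runge-Kutta approximation `yₙ(x)` of the solution of `y' = -x y + f`, `y(0) = 0`:
`yₙ(x) = ∑_{j=1}^n (∏_{l=j+1}^n R(-τ_l x)) τⱼ bᵀ (I + τⱼ x A)⁻¹ fⱼ`,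
`fⱼ = (f(tⱼ₋₁ + cᵢ τⱼ))ᵢ`. -/
def odeApprox {s : ℕ} (rk : RKMethod s) (t : ℕ → ℝ) (f : ℝ → X) (n : ℕ) (x : ℝ) : X :=
  ∑ j ∈ Finset.Icc 1 n,
    ((∏ l ∈ Finset.Icc (j + 1) n, rk.stability (-((step t l * x : ℝ) : ℂ))) * (step t j : ℂ)) •
      ∑ i, rk.weightRow (-((step t j * x : ℝ) : ℂ)) i • f (t (j - 1) + rk.c i * step t j)

/-- The gCQ approximation `uₙ = ∫₀^∞ G(x) yₙ(x) dx`. -/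
def gCQ {s : ℕ} (rk : RKMethod s) (K : ℂ → X →L[ℂ] Y) (t : ℕ → ℝ) (f : ℝ → X) (n : ℕ) : Y :=
  ∫ x in Ioi (0 : ℝ), jump K x (odeApprox rk t f n x)

end Scheme

/-! ### Fractional derivatives and expansions -/

section Fractional

variable {X : Type*} [NormedAddCommGroup X] [NormedSpace ℂ X]

/-- The Riemann-Liouville integral of order `a ≥ 0`:
`∫₀ᵗ (t - r)^(a - 1) / Γ(a) f(r) dr`, and `f` itself for `a = 0`. -/
def rlIntegral (a : ℝ) (f : ℝ → X) (t : ℝ) : X :=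
  if a = 0 then f t else ∫ r in (0 : ℝ)..t, ((t - r) ^ (a - 1) / Real.Gamma a) • f r

/-- The Riemann-Liouville derivative `f^(μ)` of order `μ`: the derivative of integer order
`ν = ⌈μ⌉` of the Riemann-Liouville integral of order `ν - μ`. For `-1 < μ < 0` (where `ν = 0`)
this is the Riemann-Liouville integral of order `-μ`. -/
def rlDeriv (μ : ℝ) (f : ℝ → X) : ℝ → X :=
  iteratedDeriv ⌈μ⌉₊ (rlIntegral ((⌈μ⌉₊ : ℝ) - μ) f)

/-- `f` admits on `[0, T]` the fractional power expansion
`f(t) = ∑_{ℓ=0}^m f^(ℓ+β)(0) / Γ(ℓ+β+1) t^(ℓ+β) + 1 / Γ(m+β+1) (t^(m+β) * f^(m+β+1))(t)`,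
where `a ℓ = f^(ℓ+β)(0)`, understood as the limit at `0+`, and `g = f^(m+β+1) ∈ C⁰([0, T])`.
The sum is empty if `m < 0`. At `t = 0` a power with negative exponent is read as `0`. -/
structure HasFractionalExpansion (T β : ℝ) (m : ℤ) (f : ℝ → X) (a : ℕ → X) (g : ℝ → X) :
    Prop where
  coeff : ∀ ℓ : ℕ, (ℓ : ℤ) ≤ m → Tendsto (rlDeriv (ℓ + β) f) (𝓝[>] 0) (𝓝 (a ℓ))
  deriv_eq : ∀ t ∈ Ioo 0 T, g t = rlDeriv (m + β + 1) f t
  deriv_continuous : ContinuousOn g (Icc 0 T)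
  expansion : ∀ t ∈ Icc 0 T,
    f t = ∑ ℓ ∈ Finset.range (m + 1).toNat,
        (t ^ (ℓ + β) / Real.Gamma (ℓ + β + 1)) • a ℓ
      + (1 / Real.Gamma (m + β + 1)) • ∫ r in (0 : ℝ)..t, (t - r) ^ (m + β) • g r

/-- The norm of `C⁰([0, t])`. -/
def supNorm (g : ℝ → X) (t : ℝ) : ℝ := ⨆ r : Icc (0 : ℝ) t, ‖g r‖

/-- `∑_{ℓ=j+1}^m ‖a ℓ‖`, where only `ℓ ≥ 0` are meant. -/
def tailSum (j m : ℤ) (a : ℕ → X) : ℝ :=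
  ∑ ℓ ∈ Finset.filter (fun ℓ : ℕ => j < (ℓ : ℤ)) (Finset.range (m + 1).toNat), ‖a ℓ‖

end Fractional

end RKgCQ

end

/-! The method is compared with the exact solution one test equation at a time.

Reduction to scalar problems. Cauchy's formula on the plane cut along the negative axis gives K(z) =
∫ G(x)/(x+z) dx for Re z > 0, and uniqueness of Laplace transforms turns this into k(t) = ∫ exp(-xt)
G(x) dx for almost every t > 0. Hence u(t_n) is the integral of G(x) y(x, t_n), where y solves y' =
-x y + f, y(0) = 0. Since the norm of G(x) is at most (M/π) x^(-α), it suffices to bound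
`errorNorm`, the x^(-α)-weighted L¹ norm in x of the Runge-Kutta error for this equation
(`norm_convolution_sub_gCQ_le`).

One step. Stiff accuracy makes both R and the weights functions of the last row of (I - zA)⁻¹, which
is O(1/(1+|z|)) on the negative axis. The order conditions annihilate the last entries of A^k times
a stage defect, so the ℓ-th Taylor term of the local defect carries min(1, τx)^(p+1-ℓ)/(1+τx), and
it vanishes for ℓ ≤ q. A-stability and the maximum principle give |R(-z)| ≤ 1/(1+cz), so that
products of stability factors decay like 1/(1 + c x (t_n - t_j)).

General meshes. For the source (t-r)₊^(p-1)/(p-1)! the solution is an iterated integral of the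
exponential. The defects with ℓ = p sum, by a telescoping potential, to τ^p/(1 + c x (t_n - r)). If
q + 2 ≤ p the lower ones contribute τ^q min(1, τx)²/x². Integration against x^(-α) yields τ^min(p,
q+1+α) (t_n - r)^(α-1), which is integrable in r. Every fractional remainder integral, and every
power t^δ with δ ≥ p - α, is a superposition of such truncated monomials, so its error follows by
Tonelli and beta integrals.

Quasi-uniform meshes. The powers with q + 1 ≤ δ < p - α are treated directly. The ℓ-th derivative of
the solution is bounded by t^(δ+1-ℓ) and by t^(δ-ℓ)/x. The first step is estimated crudely. On the
later ones τ_j is at most a multiple of t_(j-1), and the error becomes a Riemann sum for the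
integral of s^(-α) (t_n - s)^(α-1).

No logarithm arises in these estimates; the factor max{1, |log τ_min|} of the statement is only used
through being at least 1. -/

namespace RKgCQ

/-! ### Algebra of the method: resolvent, order conditions and stage defects. -/

namespace RKMethod

variable {s : ℕ} (rk : RKMethod s)

/-- The last row of `(I - z A)⁻¹`. -/
noncomputable def lastRow (z : ℂ) (i : Fin (s + 1)) : ℂ := (rk.stageMatrix z)⁻¹ (Fin.last s) i

variable {rk}

/-- A commutes with its resolvent, and bᵀ is the last row of A. Weights thus become the last row of
(I - zA)⁻¹ followed by A, the form in which exact solution values and source values can be combined.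
-/
theorem weightRow_eq (hs : rk.IsStifflyAccurate) {z : ℂ} (hz : IsUnit (rk.stageMatrix z))
    (i : Fin (s + 1)) :
    rk.weightRow z i = ∑ j, rk.lastRow z j * (rk.A j i : ℂ) := by
  set A' := rk.A.map (fun a : ℝ => (a : ℂ)) with hA'
  set S := rk.stageMatrix z with hS
  have hdet : IsUnit S.det := (Matrix.isUnit_iff_isUnit_det _).1 hz
  have hcomm : A' * S = S * A' := by
    simp [hS, stageMatrix, mul_sub, sub_mul, ← hA']
  have h : A' * S⁻¹ = S⁻¹ * A' := by
    calc A' * S⁻¹ = S⁻¹ * (S * A') * S⁻¹ := by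
          rw [← mul_assoc S⁻¹, Matrix.nonsing_inv_mul _ hdet, one_mul]
      _ = S⁻¹ * A' := by
          rw [← hcomm, mul_assoc, mul_assoc, Matrix.mul_nonsing_inv _ hdet, mul_one]
  have h1 : rk.weightRow z i = (A' * S⁻¹) (Fin.last s) i := by
    simp only [weightRow, Matrix.vecMul, dotProduct, Matrix.mul_apply, hA', Matrix.map_apply]
    exact Finset.sum_congr rfl fun j _ => by rw [hs j]
  rw [h1, h, Matrix.mul_apply]
  rfl

/-- The last row of the identity (I - zA)⁻¹ = I + z (I - zA)⁻¹ A. Each application trades a factor A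
for a factor z, as long as the last entry of the vector vanishes. -/
theorem sum_lastRow_mul {z : ℂ} (hz : IsUnit (rk.stageMatrix z)) (u : Fin (s + 1) → ℂ) :
    ∑ i, rk.lastRow z i * u i
      = u (Fin.last s) + z * ∑ i, rk.lastRow z i * ∑ j, (rk.A i j : ℂ) * u j := by
  have hdet : IsUnit (rk.stageMatrix z).det := (Matrix.isUnit_iff_isUnit_det _).1 hz
  have h := congrArg (fun M => Matrix.mulVec M u (Fin.last s)) (Matrix.nonsing_inv_mul _ hdet)
  simp only [Matrix.one_mulVec, ← Matrix.mulVec_mulVec] at h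
  have h2 : (rk.stageMatrix z).mulVec u
      = fun i => u i - z * ∑ j, (rk.A i j : ℂ) * u j := by
    ext i
    rw [stageMatrix, Matrix.sub_mulVec, Matrix.smul_mulVec, Matrix.one_mulVec]
    simp [Matrix.mulVec, dotProduct]
  rw [h2] at h
  rw [← h]
  simp only [Matrix.mulVec, dotProduct, lastRow, mul_sub, Finset.sum_sub_distrib, Finset.mul_sum]
  have : ∀ i j, z * ((rk.stageMatrix z)⁻¹ (Fin.last s) i * ((rk.A i j : ℂ) * u j)) =
     (rk.stageMatrix z)⁻¹ (Fin.last s) i * (z * ((rk.A i j : ℂ) * u j)) := fun i j => by ring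
  simp [this]

theorem stability_eq (hs : rk.IsStifflyAccurate) {z : ℂ} (hz : IsUnit (rk.stageMatrix z)) :
    rk.stability z = ∑ i, rk.lastRow z i := by
  have h := sum_lastRow_mul hz (fun _ => 1)
  simp only [mul_one] at h
  rw [h, stability]
  congr 2
  simp only [weightRow_eq hs hz, Finset.mul_sum]
  exact Finset.sum_comm

theorem IsAdmissible.isUnit {p q : ℕ} (h : rk.IsAdmissible p q) {z : ℝ} (hz : 0 ≤ z) :
    IsUnit (rk.stageMatrix (-(z : ℂ))) :=
  (h.aStable _ (by simpa using hz)).1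

/-- With σ = 1/(1+z) one has I + zA = (1+z)(σ I + (1-σ) A). The pencil in σ is invertible on the
whole compact interval [0,1]: A-stability covers σ > 0, and invertibility of A covers the endpoint σ
= 0, which stands for z = ∞. Its inverse is therefore bounded, and the factor 1/(1+z) is explicit.
-/
theorem IsAdmissible.exists_lastRow_bound {p q : ℕ} (h : rk.IsAdmissible p q) :
    ∃ C : ℝ, 0 < C ∧ ∀ z : ℝ, 0 ≤ z → ∀ i, ‖rk.lastRow (-(z : ℂ)) i‖ ≤ C / (1 + z) := by
  set A' := rk.A.map (fun a : ℝ => (a : ℂ)) with hA'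
  let N : ℝ → Matrix (Fin (s + 1)) (Fin (s + 1)) ℂ := fun σ => (σ : ℂ) • 1 + ((1 - σ : ℝ) : ℂ) • A'
  have hN : ∀ σ : ℝ, σ ≠ 0 → N σ = (σ : ℂ) • rk.stageMatrix (-((σ⁻¹ - 1 : ℝ) : ℂ)) := by
    intro σ hσ
    have hσ' : (σ : ℂ) ≠ 0 := by exact_mod_cast hσ
    simp only [N, stageMatrix, ← hA', neg_smul, sub_neg_eq_add, smul_add, smul_smul]
    congr 2
    push_cast
    field_simp
  have hunit : ∀ σ ∈ Icc (0 : ℝ) 1, IsUnit (N σ).det := by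
    rintro σ ⟨h0, h1⟩
    rcases h0.eq_or_lt with rfl | h0
    · have : N 0 = A' := by simp [N]
      rw [this, ← Matrix.isUnit_iff_isUnit_det]
      exact h.invertible.map (Complex.ofRealHom.mapMatrix (m := Fin (s + 1)))
    · rw [hN σ h0.ne', Matrix.det_smul]
      refine IsUnit.mul ?_ ((Matrix.isUnit_iff_isUnit_det _).1 (h.isUnit ?_))
      · exact (isUnit_iff_ne_zero.2 (by exact_mod_cast h0.ne')).pow _
      · rw [sub_nonneg]; exact (one_le_inv₀ h0).2 h1
  have hNc : Continuous N := by
    refine Continuous.add ?_ ?_ <;> fun_prop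
  have hcont : ∀ i, ContinuousOn (fun σ => (N σ)⁻¹ (Fin.last s) i) (Icc 0 1) := by
    intro i
    have : ∀ σ, (N σ)⁻¹ (Fin.last s) i = (N σ).det⁻¹ * (N σ).adjugate (Fin.last s) i := by
      intro σ
      rw [Matrix.inv_def, Matrix.smul_apply, Ring.inverse_eq_inv', smul_eq_mul]
    simp only [this]
    refine ContinuousOn.mul (ContinuousOn.inv₀ hNc.matrix_det.continuousOn
      fun σ hσ => (hunit σ hσ).ne_zero) ?_
    exact (hNc.matrix_adjugate.matrix_elem _ _).continuousOn
  have hb : ∀ i, ∃ C, ∀ σ ∈ Icc (0 : ℝ) 1, ‖(N σ)⁻¹ (Fin.last s) i‖ ≤ C := fun i =>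
    isCompact_Icc.exists_bound_of_continuousOn (hcont i)
  choose C hC using hb
  refine ⟨1 + ∑ i, |C i|, by positivity, fun z hz i => ?_⟩
  have hz1 : 0 < 1 + z := by linarith
  have hσ : (1 + z)⁻¹ ∈ Icc (0 : ℝ) 1 := ⟨by positivity, inv_le_one_of_one_le₀ (by linarith)⟩
  have h1 := hC i _ hσ
  have hz1c : ((1 + z : ℝ) : ℂ) ≠ 0 := by exact_mod_cast hz1.ne'
  have h2 : (N (1 + z)⁻¹)⁻¹ = ((1 + z : ℝ) : ℂ) • (rk.stageMatrix (-(z : ℂ)))⁻¹ := by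
    rw [hN _ (by positivity), inv_inv, add_sub_cancel_left]
    have hu := (Matrix.isUnit_iff_isUnit_det _).1 (h.isUnit hz)
    apply Matrix.inv_eq_left_inv
    rw [smul_mul_smul_comm, Matrix.nonsing_inv_mul _ hu]
    rw [← Complex.ofReal_mul, mul_inv_cancel₀ hz1.ne']
    simp
  rw [h2, Matrix.smul_apply, norm_smul, Complex.norm_real, Real.norm_of_nonneg hz1.le] at h1
  rw [le_div_iff₀ hz1, mul_comm]
  refine h1.trans ((le_abs_self _).trans ?_)
  have := Finset.single_le_sum (f := fun i => |C i|) (fun i _ => abs_nonneg _) (Finset.mem_univ i)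
  linarith

/-- The order conditions of the trees that occur in linear problems with constant coefficients. -/
theorem HasOrder.sum_b_mul_pow {p : ℕ} (h : rk.HasOrder p) (k ℓ : ℕ) (hk : k + ℓ + 1 ≤ p) :
    ∑ i, rk.b i * ((rk.A ^ k).mulVec fun j => rk.c j ^ ℓ) i
      = (ℓ.factorial : ℝ) / ((k + ℓ + 1).factorial : ℝ) := by
  -- The test system is a chain of integrators: y₀' = t^ℓ and y_(j+1)' = y_j. Its solution consists
  -- of monomials and its stages are explicit, with one more power of A at each link.
  let F : ℝ → (Fin (k + 1) → ℝ) → (Fin (k + 1) → ℝ) := fun t y i =>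
    Fin.cases (t ^ ℓ) (fun j => y j.castSucc) i
  let y : ℝ → (Fin (k + 1) → ℝ) := fun t i =>
    (ℓ.factorial : ℝ) / ((i + ℓ + 1).factorial : ℝ) * t ^ ((i : ℕ) + ℓ + 1)
  let Y : ℝ → Fin (s + 1) → (Fin (k + 1) → ℝ) := fun h j i =>
    h ^ ((i : ℕ) + ℓ + 1) * ((rk.A ^ ((i : ℕ) + 1)).mulVec fun j => rk.c j ^ ℓ) j
  have hy0 : y 0 = 0 := by ext i; simp [y]
  have hF : ContDiff ℝ ∞ (fun w : ℝ × (Fin (k + 1) → ℝ) => F w.1 w.2) := by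
    rw [contDiff_pi]
    intro i
    refine Fin.cases ?_ (fun j => ?_) i
    · simp only [F, Fin.cases_zero]; fun_prop
    · simp only [F, Fin.cases_succ]; fun_prop
  have hy : ∀ t, HasDerivAt y (F t (y t)) t := by
    intro t
    rw [hasDerivAt_pi]
    intro i
    have h1 : ∀ n : ℕ, HasDerivAt (fun t : ℝ =>
        (ℓ.factorial : ℝ) / ((n + ℓ + 1).factorial : ℝ) * t ^ (n + ℓ + 1))
        ((ℓ.factorial : ℝ) / ((n + ℓ).factorial : ℝ) * t ^ (n + ℓ)) t := by
      intro n
      have := (hasDerivAt_pow (n + ℓ + 1) t).const_mul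
        ((ℓ.factorial : ℝ) / ((n + ℓ + 1).factorial : ℝ))
      refine this.congr_deriv ?_
      rw [Nat.factorial_succ]
      have : ((n + ℓ).factorial : ℝ) ≠ 0 := by positivity
      push_cast
      field_simp
    refine Fin.cases ?_ (fun j => ?_) i
    · refine (h1 0).congr_deriv ?_
      simp only [F, Fin.cases_zero]
      have : (ℓ.factorial : ℝ) ≠ 0 := by positivity
      simp [div_self this]
    · refine (h1 (j + 1)).congr_deriv ?_
      simp only [y, F, Fin.cases_succ, Fin.val_castSucc]
      rw [show (j : ℕ) + 1 + ℓ = j + ℓ + 1 by ring]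
  have hFY : ∀ (h : ℝ) (m : Fin (s + 1)) (i : Fin (k + 1)), F (0 + rk.c m * h) (Y h m) i
      = h ^ ((i : ℕ) + ℓ) * ((rk.A ^ (i : ℕ)).mulVec fun j => rk.c j ^ ℓ) m := by
    intro h m i
    refine Fin.cases ?_ (fun j => ?_) i
    · simp [F]; ring
    · simp only [F, Y, Fin.cases_succ, Fin.val_succ, Fin.val_castSucc]
      rw [show (j : ℕ) + 1 + ℓ = j + ℓ + 1 by ring]
  have hO := h (k + 1) F hF 0 y (Eventually.of_forall hy) Y (Eventually.of_forall ?_) ?_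
  · have hO' := (isBigO_pi.1 hO) (Fin.last k)
    set D := (ℓ.factorial : ℝ) / ((k + ℓ + 1).factorial : ℝ)
      - ∑ i, rk.b i * ((rk.A ^ k).mulVec fun j => rk.c j ^ ℓ) i with hD
    have heq : (fun h : ℝ => (y (0 + h) - (y 0 + h • ∑ i, rk.b i • F (0 + rk.c i * h) (Y h i)))
        (Fin.last k)) = fun h => h ^ (k + ℓ + 1) * D := by
      ext h
      simp only [hy0, Pi.sub_apply, Pi.add_apply, Pi.smul_apply, Finset.sum_apply, hFY]
      simp only [y, hD, Fin.val_last, zero_add, smul_eq_mul, Pi.zero_apply, mul_sub, Finset.mul_sum]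
      congr 1
      · ring
      · exact Finset.sum_congr rfl fun i _ => by ring
    -- The local error of the last component is exactly D h^(k+ℓ+1); being O(h^(p+1)) with k + ℓ + 1
    -- ≤ p, it forces D = 0.
    rw [heq] at hO'
    have hD0 : D = 0 := by
      have h2 : (fun h : ℝ => h ^ (p + 1)) =o[𝓝[>] (0 : ℝ)] fun h : ℝ => h ^ (k + ℓ + 1) :=
        (isLittleO_pow_pow (𝕜 := ℝ) (by omega : k + ℓ + 1 < p + 1)).mono nhdsWithin_le_nhds
      have h3 := hO'.trans_isLittleO h2
      have h4 : (fun h : ℝ => h ^ (k + ℓ + 1) * D) =Θ[𝓝[>] (0 : ℝ)]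
          fun h : ℝ => h ^ (k + ℓ + 1) * D := isTheta_rfl
      by_contra hne
      have h5 : (fun h : ℝ => h ^ (k + ℓ + 1)) =O[𝓝[>] (0 : ℝ)]
          fun h : ℝ => h ^ (k + ℓ + 1) * D := by
        refine IsBigO.of_bound (|D|⁻¹) (Eventually.of_forall fun h => ?_)
        rw [norm_mul, Real.norm_eq_abs D, mul_left_comm, inv_mul_cancel₀ (abs_ne_zero.2 hne),
          mul_one]
      have h6 := (h5.trans_isLittleO h3)
      have h7 := isLittleO_irrefl (f'' := fun h : ℝ => h ^ (k + ℓ + 1)) (l := 𝓝[>] (0 : ℝ)) ?_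
      · exact h7 h6
      · refine Eventually.frequently ?_
        filter_upwards [self_mem_nhdsWithin] with h hh
        exact pow_ne_zero _ (ne_of_gt hh)
    linarith [hD0 ▸ hD]
  · intro h i
    ext n
    simp only [hy0, Pi.add_apply, Pi.smul_apply, Finset.sum_apply, hFY, smul_eq_mul, Pi.zero_apply]
    simp only [Y]
    rw [pow_succ' rk.A, ← Matrix.mulVec_mulVec, zero_add, Matrix.mulVec, dotProduct,
      Finset.mul_sum, Finset.mul_sum]
    exact Finset.sum_congr rfl fun m _ => by ring
  · intro i
    rw [hy0, tendsto_pi_nhds]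
    intro n
    have : Continuous fun h : ℝ => Y h i n := by simp only [Y]; fun_prop
    have h1 := this.tendsto 0
    simp only [Y] at h1
    rw [zero_pow (by omega), zero_mul] at h1
    exact h1.mono_left nhdsWithin_le_nhds

/-- The stage defects `c^ℓ / ℓ! - A c^(ℓ-1) / (ℓ-1)!` of the monomials. -/
noncomputable def stageDefect (rk : RKMethod s) (ℓ : ℕ) (i : Fin (s + 1)) : ℝ :=
  rk.c i ^ ℓ / (ℓ.factorial : ℝ)
    - ∑ j, rk.A i j * (rk.c j ^ (ℓ - 1) / ((ℓ - 1).factorial : ℝ))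

theorem HasStageOrder.stageDefect_eq_zero {q : ℕ} (h : rk.HasStageOrder q) {ℓ : ℕ} (h1 : 1 ≤ ℓ)
    (hq : ℓ ≤ q) (i : Fin (s + 1)) : rk.stageDefect ℓ i = 0 := by
  obtain ⟨n, rfl⟩ := Nat.exists_eq_add_of_le' h1
  have := h (n + 1) h1 hq i
  simp only [stageDefect, Nat.add_sub_cancel] at this ⊢
  simp only [← mul_div_assoc, ← Finset.sum_div]
  rw [this, Nat.factorial_succ]
  have : (n.factorial : ℝ) ≠ 0 := by positivity
  push_cast
  field_simp
  simp

/-- The last row sum of A equals the sum of the weights by stiff accuracy, and consistency makes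
that sum 1. -/
theorem IsAdmissible.c_last {p q : ℕ} (h : rk.IsAdmissible p q) : rk.c (Fin.last s) = 1 := by
  have := h.order.sum_b_mul_pow 0 0 (by simpa using h.one_le_order)
  simp only [pow_zero, Matrix.one_mulVec, mul_one] at this
  rw [← h.row_sum, ← Finset.sum_congr rfl fun j _ => h.stifflyAccurate j, this]
  simp

/-- The last entry of A^(k+1) v is bᵀ A^k v, so the two parts of the defect are values of two order
conditions, and these cancel. For k = 0 the first part is evaluated by c_s = 1 instead. -/
theorem IsAdmissible.pow_mulVec_stageDefect {p q : ℕ} (h : rk.IsAdmissible p q) {ℓ : ℕ}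
    (hℓ : 1 ≤ ℓ) (k : ℕ) (hk : k + ℓ ≤ p) :
    (rk.A ^ k).mulVec (rk.stageDefect ℓ) (Fin.last s) = 0 := by
  obtain ⟨n, rfl⟩ := Nat.exists_eq_add_of_le' hℓ
  have hlast : ∀ u : Fin (s + 1) → ℝ, rk.A.mulVec u (Fin.last s) = ∑ i, rk.b i * u i := by
    intro u
    simp only [Matrix.mulVec, dotProduct]
    exact Finset.sum_congr rfl fun j _ => by rw [h.stifflyAccurate j]
  have hv : rk.stageDefect (n + 1) = ((n + 1).factorial : ℝ)⁻¹ • (fun j => rk.c j ^ (n + 1))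
      - (n.factorial : ℝ)⁻¹ • rk.A.mulVec (fun j => rk.c j ^ n) := by
    ext i
    simp only [stageDefect, Nat.add_sub_cancel, Pi.sub_apply, Pi.smul_apply, smul_eq_mul,
      Matrix.mulVec, dotProduct, Finset.mul_sum]
    congr 1
    · ring
    · exact Finset.sum_congr rfl fun j _ => by ring
  have hn : (n.factorial : ℝ) ≠ 0 := by positivity
  cases k with
  | zero =>
    rw [pow_zero, Matrix.one_mulVec, hv]
    have h1 := h.order.sum_b_mul_pow 0 n (by omega)
    simp only [pow_zero, Matrix.one_mulVec] at h1
    simp only [Pi.sub_apply, Pi.smul_apply, smul_eq_mul, hlast, h1, h.c_last, zero_add]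
    rw [Nat.factorial_succ]
    push_cast
    field_simp
    simp
  | succ k =>
    rw [pow_succ', ← Matrix.mulVec_mulVec, hlast, hv, Matrix.mulVec_sub, Matrix.mulVec_smul,
      Matrix.mulVec_smul, Matrix.mulVec_mulVec, ← pow_succ]
    have h1 := h.order.sum_b_mul_pow k (n + 1) (by omega)
    have h2 := h.order.sum_b_mul_pow (k + 1) n (by omega)
    simp only [Pi.sub_apply, Pi.smul_apply, smul_eq_mul, mul_sub, Finset.sum_sub_distrib]
    simp only [mul_left_comm (rk.b _), ← Finset.mul_sum]
    rw [h1, h2, show k + (n + 1) + 1 = k + 1 + n + 1 by ring]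
    have hn1 : ((n + 1).factorial : ℝ) ≠ 0 := by positivity
    field_simp
    simp

/-- For z ≤ 1 the resolvent identity is iterated p + 1 - ℓ times, which is possible because the last
entries of A^k times the defect vanish for k ≤ p - ℓ; each round gains a factor z. For z ≥ 1 the
decay of the last row alone suffices. -/
theorem IsAdmissible.exists_sum_lastRow_stageDefect_bound {p q : ℕ} (h : rk.IsAdmissible p q) :
    ∃ C : ℝ, 0 < C ∧ ∀ z : ℝ, 0 ≤ z → ∀ ℓ, 1 ≤ ℓ → ℓ ≤ p →
      ‖∑ i, rk.lastRow (-(z : ℂ)) i * (rk.stageDefect ℓ i : ℂ)‖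
        ≤ C * (min 1 z ^ (p + 1 - ℓ) / (1 + z)) := by
  obtain ⟨C, hC0, hC⟩ := h.exists_lastRow_bound
  have key : ∀ z : ℝ, 0 ≤ z → ∀ (v : Fin (s + 1) → ℝ) (K : ℕ),
      (∀ k < K, (rk.A ^ k).mulVec v (Fin.last s) = 0) →
      ∑ i, rk.lastRow (-(z : ℂ)) i * (v i : ℂ) = (-(z : ℂ)) ^ K *
        ∑ i, rk.lastRow (-(z : ℂ)) i * (((rk.A ^ K).mulVec v i : ℝ) : ℂ) := by
    intro z hz v K
    induction K with
    | zero => simp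
    | succ K ih =>
      intro hK
      rw [ih fun k hk => hK k (by omega), sum_lastRow_mul (h.isUnit hz), hK K (by omega),
        pow_succ' rk.A, ← Matrix.mulVec_mulVec]
      simp only [Matrix.mulVec, dotProduct, Complex.ofReal_sum, Complex.ofReal_mul]
      push_cast
      ring
  have hbound : ∀ z : ℝ, 0 ≤ z → ∀ v : Fin (s + 1) → ℝ,
      ‖∑ i, rk.lastRow (-(z : ℂ)) i * (v i : ℂ)‖ ≤ C / (1 + z) * ∑ i, |v i| := by
    intro z hz v
    rw [Finset.mul_sum]
    refine (norm_sum_le _ _).trans (Finset.sum_le_sum fun i _ => ?_)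
    rw [norm_mul, Complex.norm_real, Real.norm_eq_abs]
    exact mul_le_mul_of_nonneg_right (hC z hz i) (abs_nonneg _)
  set B : ℕ → ℝ := fun ℓ => ∑ i, |rk.stageDefect ℓ i|
    + ∑ i, |(rk.A ^ (p + 1 - ℓ)).mulVec (rk.stageDefect ℓ) i| with hB
  have hB0 : ∀ ℓ, 0 ≤ B ℓ := fun ℓ => by positivity
  refine ⟨C * (1 + ∑ ℓ ∈ Finset.range (p + 1), B ℓ), by
    have := Finset.sum_nonneg fun ℓ (_ : ℓ ∈ Finset.range (p + 1)) => hB0 ℓ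
    positivity, fun z hz ℓ h1 hp => ?_⟩
  have hBℓ : B ℓ ≤ 1 + ∑ ℓ ∈ Finset.range (p + 1), B ℓ := by
    have := Finset.single_le_sum (fun i _ => hB0 i) (Finset.mem_range.2 (Nat.lt_succ_of_le hp))
    linarith
  have hz1 : 0 < 1 + z := by linarith
  suffices H : ‖∑ i, rk.lastRow (-(z : ℂ)) i * (rk.stageDefect ℓ i : ℂ)‖
        ≤ C / (1 + z) * (min 1 z ^ (p + 1 - ℓ) * B ℓ) by
    refine H.trans ?_
    have hm : 0 ≤ min 1 z := le_min zero_le_one hz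
    calc _ = C * B ℓ * (min 1 z ^ (p + 1 - ℓ) / (1 + z)) := by ring
      _ ≤ _ := by gcongr
  rcases le_total z 1 with hz' | hz'
  · rw [min_eq_right hz', key z hz _ (p + 1 - ℓ)
      fun k hk => h.pow_mulVec_stageDefect h1 k (by omega), norm_mul, norm_pow, norm_neg,
      Complex.norm_real, Real.norm_of_nonneg hz]
    rw [mul_left_comm]
    refine mul_le_mul_of_nonneg_left ((hbound z hz _).trans ?_) (by positivity)
    refine mul_le_mul_of_nonneg_left ?_ (by positivity)
    exact le_add_of_nonneg_left (by positivity)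
  · rw [min_eq_left hz', one_pow, one_mul]
    refine (hbound z hz _).trans (mul_le_mul_of_nonneg_left ?_ (by positivity))
    exact le_add_of_nonneg_right (by positivity)

end RKMethod
end RKgCQ

/-! ### Regularity and decay of the stability function. -/

namespace RKgCQ

theorem differentiable_matrix_det {n : Type*} [Fintype n] [DecidableEq n]
    {M : ℂ → Matrix n n ℂ} (h : ∀ i j, Differentiable ℂ fun z => M z i j) :
    Differentiable ℂ fun z => (M z).det := by
  simp only [Matrix.det_apply]
  refine Differentiable.fun_sum fun σ _ => ?_
  refine Differentiable.const_smul ?_ _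
  exact Differentiable.fun_finsetProd fun i _ => h _ _

theorem differentiable_matrix_adjugate {n : Type*} [Fintype n] [DecidableEq n]
    {M : ℂ → Matrix n n ℂ} (h : ∀ i j, Differentiable ℂ fun z => M z i j) (i j : n) :
    Differentiable ℂ fun z => (M z).adjugate i j := by
  simp only [Matrix.adjugate_apply]
  refine differentiable_matrix_det fun a b => ?_
  by_cases hab : a = j
  · subst hab; simp
  · simpa [Matrix.updateRow_ne hab] using h a b

namespace RKMethod

variable {s : ℕ} {rk : RKMethod s}

theorem differentiable_stageMatrix (i j : Fin (s + 1)) :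
    Differentiable ℂ fun z => rk.stageMatrix z i j := by
  simp only [stageMatrix, Matrix.sub_apply, Matrix.smul_apply, smul_eq_mul]
  fun_prop

theorem stageMatrix_inv_apply (z : ℂ) (i j : Fin (s + 1)) : (rk.stageMatrix z)⁻¹ i j
    = (rk.stageMatrix z).det⁻¹ * (rk.stageMatrix z).adjugate i j := by
  rw [Matrix.inv_def, Matrix.smul_apply, Ring.inverse_eq_inv', smul_eq_mul]

theorem differentiableAt_stageMatrix_inv {z : ℂ} (hz : IsUnit (rk.stageMatrix z))
    (i j : Fin (s + 1)) : DifferentiableAt ℂ (fun z => (rk.stageMatrix z)⁻¹ i j) z := by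
  simp only [stageMatrix_inv_apply]
  refine DifferentiableAt.mul (DifferentiableAt.inv ?_ ?_) ?_
  · exact differentiable_matrix_det differentiable_stageMatrix z
  · exact ((Matrix.isUnit_iff_isUnit_det _).1 hz).ne_zero
  · exact differentiable_matrix_adjugate differentiable_stageMatrix i j z

theorem differentiableAt_stability {z : ℂ} (hz : IsUnit (rk.stageMatrix z)) :
    DifferentiableAt ℂ rk.stability z := by
  unfold stability
  refine (differentiableAt_const _).add (differentiableAt_id.mul ?_)
  refine DifferentiableAt.fun_sum fun i _ => ?_
  simp only [weightRow, Matrix.vecMul, dotProduct]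
  refine DifferentiableAt.fun_sum fun j _ => ?_
  exact (differentiableAt_const _).mul (differentiableAt_stageMatrix_inv hz j i)

theorem measurable_stageMatrix_inv (i j : Fin (s + 1)) :
    Measurable fun z => (rk.stageMatrix z)⁻¹ i j := by
  simp only [stageMatrix_inv_apply]
  refine Measurable.mul (Measurable.inv ?_) ?_
  · exact (differentiable_matrix_det differentiable_stageMatrix).continuous.measurable
  · exact (differentiable_matrix_adjugate differentiable_stageMatrix i j).continuous.measurable

theorem measurable_weightRow (i : Fin (s + 1)) : Measurable fun z => rk.weightRow z i := by
  simp only [weightRow, Matrix.vecMul, dotProduct]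
  refine Finset.measurable_sum _ fun j _ => ?_
  exact measurable_const.mul (measurable_stageMatrix_inv j i)

theorem measurable_stability : Measurable rk.stability := by
  unfold stability
  exact measurable_const.add
    (measurable_id.mul (Finset.measurable_sum _ fun j _ => measurable_weightRow j))

/-- The stability function decays on the negative axis at least as fast as `1 / (1 + c z)`. -/
theorem IsAdmissible.exists_stability_bound {p q : ℕ} (h : rk.IsAdmissible p q) :
    ∃ c : ℝ, 0 < c ∧ c ≤ 1 ∧ ∀ z : ℝ, 0 ≤ z → ‖rk.stability (-(z : ℂ))‖ ≤ 1 / (1 + c * z) := by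
  obtain ⟨C, hC0, hC⟩ := h.exists_lastRow_bound
  have hbound : ∀ z : ℝ, 0 ≤ z → ∀ v : Fin (s + 1) → ℝ,
      ‖∑ i, rk.lastRow (-(z : ℂ)) i * (v i : ℂ)‖ ≤ C / (1 + z) * ∑ i, |v i| := by
    intro z hz v
    rw [Finset.mul_sum]
    refine (norm_sum_le _ _).trans (Finset.sum_le_sum fun i _ => ?_)
    rw [norm_mul, Complex.norm_real, Real.norm_eq_abs]
    exact mul_le_mul_of_nonneg_right (hC z hz i) (abs_nonneg _)
  set D := C * (s + 1) with hD
  have hD0 : 0 < D := by positivity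
  have hdecay : ∀ z : ℝ, 0 ≤ z → ‖rk.stability (-(z : ℂ))‖ ≤ D / (1 + z) := by
    intro z hz
    have := hbound z hz fun _ => 1
    simp only [Complex.ofReal_one, mul_one, abs_one, Finset.sum_const, Finset.card_univ,
      Fintype.card_fin, nsmul_eq_mul] at this
    rw [stability_eq h.stifflyAccurate (h.isUnit hz), hD]
    refine this.trans (le_of_eq ?_)
    push_cast
    ring
  -- Modulus 1 at an interior point of the left half-plane would make R constant there by the
  -- maximum principle, against the decay D/(1+z), which is below 1 already at z = D.
  have hlt : ∀ z : ℝ, 0 < z → ‖rk.stability (-(z : ℂ))‖ < 1 := by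
    intro z hz
    refine lt_of_le_of_ne (h.aStable _ (by simpa using hz.le)).2 fun heq => ?_
    have hmax := Complex.eqOn_of_isPreconnected_of_isMaxOn_norm (f := rk.stability)
      (U := {w : ℂ | w.re < 0}) (c := -(z : ℂ)) (convex_halfSpace_re_lt 0).isPreconnected
      (isOpen_lt Complex.continuous_re continuous_const)
      (fun w hw => (differentiableAt_stability (h.aStable w (le_of_lt hw)).1).differentiableWithinAt)
      (by simpa using hz)
      (fun w hw => by
        simp only [mem_ofPred_eq, Function.comp_apply, heq]
        exact (h.aStable w (le_of_lt hw)).2)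
    have h1 := hmax (x := -((D : ℝ) : ℂ)) (by simpa using hD0)
    have h2 := hdecay D hD0.le
    rw [h1, Function.const_apply, heq, le_div_iff₀ (by positivity)] at h2
    linarith
  -- Two rounds of the resolvent identity, with A𝟙 = c and c_s = 1, expand R(-z) = 1 - z + O(z²) at
  -- the origin.
  obtain ⟨B, hB0, hB⟩ : ∃ B : ℝ, 0 < B ∧ ∀ z : ℝ, 0 ≤ z →
      ‖rk.stability (-(z : ℂ)) - (1 - z)‖ ≤ B * z ^ 2 := by
    refine ⟨1 + C * ∑ i, |rk.A.mulVec rk.c i|, by positivity, fun z hz => ?_⟩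
    have h1 := sum_lastRow_mul (h.isUnit hz) fun _ => 1
    have h2 := sum_lastRow_mul (h.isUnit hz) fun i => (rk.c i : ℂ)
    have h3 : ∀ i, ∑ j, (rk.A i j : ℂ) * 1 = rk.c i := fun i => by
      rw [← h.row_sum i]; push_cast; simp
    have h4 : ∀ i, ∑ j, (rk.A i j : ℂ) * (rk.c j : ℂ) = (rk.A.mulVec rk.c i : ℝ) := fun i => by
      simp [Matrix.mulVec, dotProduct]
    simp only [h3] at h1
    simp only [h4, h.c_last] at h2
    simp only [mul_one] at h1
    rw [stability_eq h.stifflyAccurate (h.isUnit hz), h1, h2]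
    have h5 : (1 : ℂ) + -(z : ℂ) * (((1 : ℝ) : ℂ) + -(z : ℂ) *
        ∑ i, rk.lastRow (-(z : ℂ)) i * ((rk.A.mulVec rk.c i : ℝ) : ℂ)) - (1 - z)
        = (z : ℂ) ^ 2 * ∑ i, rk.lastRow (-(z : ℂ)) i * ((rk.A.mulVec rk.c i : ℝ) : ℂ) := by
      push_cast; ring
    rw [h5, norm_mul, norm_pow, Complex.norm_real, Real.norm_of_nonneg hz, mul_comm]
    refine mul_le_mul_of_nonneg_right ((hbound z hz _).trans ?_) (by positivity)
    have : C / (1 + z) ≤ C := div_le_self hC0.le (by linarith)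
    have := mul_le_mul_of_nonneg_right this
      (Finset.sum_nonneg fun i (_ : i ∈ Finset.univ) => abs_nonneg (rk.A.mulVec rk.c i))
    linarith
  -- Below z₀ the quadratic remainder is at most z/2, hence |R(-z)| ≤ 1 - z/2.
  set z₀ : ℝ := min 1 (1 / (2 * B)) with hz₀
  have hz₀0 : 0 < z₀ := by positivity
  have hz₀1 : z₀ ≤ 1 := min_le_left _ _
  have hz₀B : B * z₀ ≤ 1 / 2 := by
    calc B * z₀ ≤ B * (1 / (2 * B)) := by gcongr; exact min_le_right _ _
      _ = 1 / 2 := by field_simp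
  -- Away from the origin |R| stays below some ρ < 1: compactness up to 2D + 1, and beyond that the
  -- decay gives 1/2.
  obtain ⟨ρ, hρ1, hρ⟩ : ∃ ρ : ℝ, ρ < 1 ∧ ∀ z : ℝ, z₀ ≤ z → ‖rk.stability (-(z : ℂ))‖ ≤ ρ := by
    have hcont : ContinuousOn (fun z : ℝ => ‖rk.stability (-(z : ℂ))‖) (Icc z₀ (2 * D + 1)) := by
      intro z hz
      have h1 := (differentiableAt_stability (h.isUnit (hz₀0.le.trans hz.1))).continuousAt
      have h2 : ContinuousAt (fun z : ℝ => -(z : ℂ)) z := by fun_prop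
      exact (ContinuousAt.comp (f := fun z : ℝ => -(z : ℂ)) h1 h2).norm.continuousWithinAt
    obtain ⟨w, hw, hwmax⟩ := isCompact_Icc.exists_isMaxOn
      (nonempty_Icc.2 (hz₀1.trans (by linarith))) hcont
    refine ⟨max (‖rk.stability (-(w : ℂ))‖) (1 / 2), max_lt (hlt w (hz₀0.trans_le hw.1))
      (by norm_num), fun z hz => ?_⟩
    rcases le_total z (2 * D + 1) with hz' | hz'
    · exact le_max_of_le_left (hwmax ⟨hz, hz'⟩)
    · refine le_max_of_le_right ((hdecay z (hz₀0.le.trans hz)).trans ?_)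
      rw [div_le_div_iff₀ (by linarith) (by norm_num)]
      linarith
  -- The value 1/2 serves near the origin, where (1 - z/2)(1 + z/2) ≤ 1. The value (1-ρ)/D serves
  -- away from it, where |R| (1 + cz) ≤ ρ + cD ≤ 1.
  refine ⟨min (1 / 2) ((1 - ρ) / D), lt_min (by norm_num) (div_pos (by linarith) hD0),
    (min_le_left _ _).trans (by norm_num), fun z hz => ?_⟩
  set c := min (1 / 2) ((1 - ρ) / D) with hc
  have hc0 : 0 < c := lt_min (by norm_num) (div_pos (by linarith) hD0)
  rw [le_div_iff₀ (by positivity)]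
  rcases le_total z z₀ with hz' | hz'
  · have hz1 : z ≤ 1 := hz'.trans hz₀1
    have h1 : ‖rk.stability (-(z : ℂ))‖ ≤ 1 - z / 2 := by
      have h2 : ‖(1 : ℂ) - z‖ = 1 - z := by
        rw [← Complex.ofReal_one, ← Complex.ofReal_sub, Complex.norm_real,
          Real.norm_of_nonneg (by linarith)]
      calc ‖rk.stability (-(z : ℂ))‖
          = ‖(rk.stability (-(z : ℂ)) - (1 - z)) + (1 - z)‖ := by rw [sub_add_cancel]
        _ ≤ B * z ^ 2 + (1 - z) := (norm_add_le _ _).trans (by rw [h2]; gcongr; exact hB z hz)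
        _ ≤ 1 - z / 2 := by nlinarith [mul_le_mul_of_nonneg_left hz' hB0.le]
    have hc2 : c ≤ 1 / 2 := min_le_left _ _
    calc _ ≤ (1 - z / 2) * (1 + c * z) := by gcongr
      _ ≤ (1 - z / 2) * (1 + 1 / 2 * z) := by gcongr; linarith
      _ ≤ 1 := by nlinarith
  · have h1 := hρ z hz'
    have h2 := hdecay z hz
    have h3 : c * D ≤ 1 - ρ := by
      calc c * D ≤ (1 - ρ) / D * D := by gcongr; exact min_le_right _ _
        _ = 1 - ρ := by field_simp
    have h4 : ‖rk.stability (-(z : ℂ))‖ * z ≤ D := by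
      rw [le_div_iff₀ (by linarith)] at h2
      nlinarith [norm_nonneg (rk.stability (-(z : ℂ)))]
    calc _ = ‖rk.stability (-(z : ℂ))‖ + c * (‖rk.stability (-(z : ℂ))‖ * z) := by ring
      _ ≤ ρ + c * D := by gcongr
      _ ≤ 1 := by linarith

end RKMethod
end RKgCQ

/-! ### Local defects of the scalar test equation and their accumulation. -/

namespace RKgCQ

variable {s : ℕ} {rk : RKMethod s}

/-- Taylor's formula for a chain of derivatives, with a crude remainder. -/
theorem norm_sub_taylor_le {a b S : ℝ} (n : ℕ) (D : ℕ → ℝ → ℂ)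
    (hD : ∀ ℓ < n, ∀ u ∈ Icc a b, HasDerivWithinAt (D ℓ) (D (ℓ + 1) u) (Icc a b) u)
    (hS : ∀ u ∈ Icc a b, ‖D n u‖ ≤ S) :
    ∀ u ∈ Icc a b, ‖D 0 u - ∑ ℓ ∈ Finset.range n,
      (((u - a) ^ ℓ / ℓ.factorial : ℝ) : ℂ) * D ℓ a‖ ≤ S * (b - a) ^ n := by
  induction n generalizing D with
  | zero => simpa using hS
  | succ n ih =>
    intro u hu
    have hab : a ≤ b := hu.1.trans hu.2
    have ha : a ∈ Icc a b := left_mem_Icc.2 hab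
    set F : ℝ → ℂ := fun u => D 0 u - ∑ ℓ ∈ Finset.range (n + 1),
      (((u - a) ^ ℓ / ℓ.factorial : ℝ) : ℂ) * D ℓ a with hF
    have hFa : F a = 0 := by
      simp only [hF, sub_self, Finset.sum_range_succ']
      simp
    -- The derivative of the remainder is the remainder of the shifted chain, one order lower; the
    -- mean value inequality closes the induction.
    have hderiv : ∀ u ∈ Icc a b, HasDerivWithinAt F (D 1 u - ∑ ℓ ∈ Finset.range n,
        (((u - a) ^ ℓ / ℓ.factorial : ℝ) : ℂ) * D (ℓ + 1) a) (Icc a b) u := by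
      intro u hu
      refine (hD 0 (by omega) u hu).sub ?_
      simp only [Finset.sum_range_succ']
      refine HasDerivWithinAt.congr_deriv (HasDerivWithinAt.add
        (HasDerivWithinAt.fun_sum (A' := fun ℓ => (((u - a) ^ ℓ / ℓ.factorial : ℝ) : ℂ)
          * D (ℓ + 1) a) fun ℓ _ => ?_) (by simpa using hasDerivWithinAt_const u _ (D 0 a)))
        (add_zero _)
      refine HasDerivWithinAt.mul_const ?_ _
      have h1 : HasDerivAt (fun u : ℝ => (u - a) ^ (ℓ + 1) / ((ℓ + 1).factorial : ℝ))
          ((u - a) ^ ℓ / ℓ.factorial) u := by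
        have := (((hasDerivAt_id u).sub_const a).pow (ℓ + 1)).div_const ((ℓ + 1).factorial : ℝ)
        refine this.congr_deriv ?_
        have h0 : (ℓ.factorial : ℝ) ≠ 0 := by positivity
        rw [Nat.factorial_succ]
        push_cast
        simp
        field_simp
      exact h1.ofReal_comp.hasDerivWithinAt
    have hbound := ih (fun ℓ => D (ℓ + 1)) (fun ℓ hℓ => hD (ℓ + 1) (by omega)) hS
    have := (convex_Icc a b).norm_image_sub_le_of_norm_hasDerivWithin_le hderiv
      (fun u hu => hbound u hu) ha hu
    rw [hFa, sub_zero] at this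
    refine this.trans ?_
    have hS0 : 0 ≤ S := (norm_nonneg _).trans (hS a ha)
    rw [pow_succ, ← mul_assoc, Real.norm_of_nonneg (sub_nonneg.2 hu.1)]
    have : 0 ≤ b - a := sub_nonneg.2 hab
    gcongr
    exact hu.2

/-- The defect of `y` in one step of the Runge-Kutta method for `y' = -x y + f`. -/
noncomputable def stepDefect (rk : RKMethod s) (a τ x : ℝ) (y f : ℝ → ℂ) : ℂ :=
  y (a + τ) - rk.stability (-((τ * x : ℝ) : ℂ)) * y a
    - τ * ∑ i, rk.weightRow (-((τ * x : ℝ) : ℂ)) i * f (a + rk.c i * τ)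

/-- Discrete variation of constants: the error satisfies e_n = R(-τ_n x) e_(n-1) + d_n, so each
local defect is propagated by the stability factors of the later steps. -/
theorem norm_sub_odeApprox_le (rk : RKMethod s) (t : ℕ → ℝ) (x : ℝ) (y f : ℝ → ℂ)
    (hy : y (t 0) = 0) (n : ℕ) :
    ‖y (t n) - odeApprox rk t f n x‖ ≤ ∑ j ∈ Finset.Icc 1 n,
      (∏ l ∈ Finset.Icc (j + 1) n, ‖rk.stability (-((step t l * x : ℝ) : ℂ))‖)
        * ‖stepDefect rk (t (j - 1)) (step t j) x y f‖ := by
  induction n with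
  | zero => simp [odeApprox, hy]
  | succ n ih =>
    have h1 : y (t (n + 1)) - odeApprox rk t f (n + 1) x
        = rk.stability (-((step t (n + 1) * x : ℝ) : ℂ)) * (y (t n) - odeApprox rk t f n x)
          + stepDefect rk (t n) (step t (n + 1)) x y f := by
      have h2 : odeApprox rk t f (n + 1) x
          = rk.stability (-((step t (n + 1) * x : ℝ) : ℂ)) * odeApprox rk t f n x
            + step t (n + 1) * ∑ i, rk.weightRow (-((step t (n + 1) * x : ℝ) : ℂ)) i
                * f (t n + rk.c i * step t (n + 1)) := by
        rw [odeApprox, Finset.sum_Icc_succ_top (by omega)]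
        simp only [smul_eq_mul]
        congr 1
        · rw [odeApprox, Finset.mul_sum]
          refine Finset.sum_congr rfl fun j hj => ?_
          rw [Finset.prod_Icc_succ_top (by have := (Finset.mem_Icc.1 hj).2; omega)]
          simp only [smul_eq_mul]
          ring
        · simp
      have h3 : t n + step t (n + 1) = t (n + 1) := by simp [step]
      rw [h2, stepDefect, h3]
      ring
    rw [h1, Finset.sum_Icc_succ_top (by omega)]
    refine (norm_add_le _ _).trans (add_le_add ?_ (by simp))
    rw [norm_mul]
    refine (mul_le_mul_of_nonneg_left ih (norm_nonneg _)).trans ?_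
    rw [Finset.mul_sum]
    refine Finset.sum_le_sum fun j hj => ?_
    rw [Finset.prod_Icc_succ_top (by have := (Finset.mem_Icc.1 hj).2; omega)]
    exact le_of_eq (by ring)

/-- Applying the resolvent identity to the vector of stage values of y, whose last entry is y(a+τ)
because c_s = 1, replaces that value by all stage values. The defect becomes the last row of the
resolvent applied to the residuals of y in the stage equations, with no remaining factor x apart
from y'. -/
theorem stepDefect_eq {p q : ℕ} (h : rk.IsAdmissible p q) {a τ x : ℝ} (hz : 0 ≤ τ * x)
    (y f : ℝ → ℂ) :
    stepDefect rk a τ x y f = ∑ i, rk.lastRow (-((τ * x : ℝ) : ℂ)) i *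
      (y (a + rk.c i * τ) - y a - τ * ∑ j, (rk.A i j : ℂ) *
        (-(x : ℂ) * y (a + rk.c j * τ) + f (a + rk.c j * τ))) := by
  have hu := h.isUnit hz
  have h1 := RKMethod.sum_lastRow_mul hu fun i => y (a + rk.c i * τ)
  simp only [h.c_last, one_mul] at h1
  have h2 : ∑ i, rk.weightRow (-((τ * x : ℝ) : ℂ)) i * f (a + rk.c i * τ)
      = ∑ i, rk.lastRow (-((τ * x : ℝ) : ℂ)) i * ∑ j, (rk.A i j : ℂ) * f (a + rk.c j * τ) := by
    simp only [RKMethod.weightRow_eq h.stifflyAccurate hu, Finset.sum_mul, Finset.mul_sum]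
    rw [Finset.sum_comm]
    exact Finset.sum_congr rfl fun i _ => Finset.sum_congr rfl fun j _ => by ring
  rw [stepDefect, h2, RKMethod.stability_eq h.stifflyAccurate hu]
  have h3 : y (a + τ) = ∑ i, rk.lastRow (-((τ * x : ℝ) : ℂ)) i * y (a + rk.c i * τ)
      + ((τ * x : ℝ) : ℂ) * ∑ i, rk.lastRow (-((τ * x : ℝ) : ℂ)) i *
        ∑ j, (rk.A i j : ℂ) * y (a + rk.c j * τ) := by
    rw [h1]; ring
  rw [h3, Finset.mul_sum, Finset.mul_sum, Finset.sum_mul, ← Finset.sum_add_distrib,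
    ← Finset.sum_sub_distrib, ← Finset.sum_sub_distrib]
  refine Finset.sum_congr rfl fun i _ => ?_
  simp only [mul_add, Finset.sum_add_distrib, mul_left_comm _ (-(x : ℂ)), ← Finset.mul_sum]
  push_cast
  ring

theorem add_c_mul_mem {p q : ℕ} (h : rk.IsAdmissible p q) {a τ : ℝ} (hτ : 0 ≤ τ)
    (i : Fin (s + 1)) : a + rk.c i * τ ∈ Icc a (a + τ) := by
  obtain ⟨h0, h1⟩ := h.c_mem i
  exact ⟨by nlinarith, by nlinarith⟩

theorem norm_sum_lastRow_le {C z B : ℝ} (hC : ∀ i, ‖rk.lastRow (-(z : ℂ)) i‖ ≤ C / (1 + z))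
    (v : Fin (s + 1) → ℂ) (hv : ∀ i, ‖v i‖ ≤ B) :
    ‖∑ i, rk.lastRow (-(z : ℂ)) i * v i‖ ≤ (s + 1) * (C / (1 + z) * B) := by
  refine (norm_sum_le _ _).trans ?_
  refine (Finset.sum_le_card_nsmul _ _ (C / (1 + z) * B) fun i _ => ?_).trans (by simp)
  rw [norm_mul]
  exact mul_le_mul (hC i) (hv i) (norm_nonneg _) ((norm_nonneg _).trans (hC i))

theorem exists_norm_row_mul_le (rk : RKMethod s) : ∃ A₀ : ℝ, 0 ≤ A₀ ∧
    ∀ (B : ℝ) (v : Fin (s + 1) → ℂ), (∀ i, ‖v i‖ ≤ B) →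
      ∀ i, ‖∑ j, (rk.A i j : ℂ) * v j‖ ≤ A₀ * B := by
  refine ⟨∑ i, ∑ j, |rk.A i j|, by positivity, fun B v hv i => ?_⟩
  have hB : 0 ≤ B := (norm_nonneg _).trans (hv i)
  have h2 : ∑ j, |rk.A i j| ≤ ∑ i, ∑ j, |rk.A i j| :=
    Finset.single_le_sum (f := fun i => ∑ j, |rk.A i j|) (fun i _ => by positivity)
      (Finset.mem_univ i)
  refine le_trans ?_ (mul_le_mul_of_nonneg_right h2 hB)
  rw [Finset.sum_mul]
  refine (norm_sum_le _ _).trans (Finset.sum_le_sum fun j _ => ?_)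
  rw [norm_mul, Complex.norm_real, Real.norm_eq_abs]
  exact mul_le_mul_of_nonneg_left (hv j) (abs_nonneg _)

/-- The crude bound, without any differentiability of y. It serves steps that contain a singular
point of the source. -/
theorem exists_stepDefect_le_of_norm_le {p q : ℕ} (h : rk.IsAdmissible p q) :
    ∃ C : ℝ, 0 < C ∧ ∀ (a τ x S : ℝ) (y f : ℝ → ℂ), 0 ≤ τ → 0 ≤ x →
      (∀ u ∈ Icc a (a + τ), ‖y u‖ ≤ τ * S) →
      (∀ u ∈ Icc a (a + τ), ‖-(x : ℂ) * y u + f u‖ ≤ S) →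
      ‖stepDefect rk a τ x y f‖ ≤ C * (τ * S / (1 + τ * x)) := by
  obtain ⟨C, hC0, hC⟩ := h.exists_lastRow_bound
  obtain ⟨A₀, hA₀, hA⟩ := exists_norm_row_mul_le rk
  refine ⟨(s + 1) * (C * (2 + A₀)), by positivity, fun a τ x S y f hτ hx h0 h1 => ?_⟩
  have hz : 0 ≤ τ * x := mul_nonneg hτ hx
  rw [stepDefect_eq h hz]
  refine (norm_sum_lastRow_le (hC _ hz) _ (B := (2 + A₀) * (τ * S)) fun i => ?_).trans
    (le_of_eq (by ring))
  have ha : a ∈ Icc a (a + τ) := ⟨le_rfl, by linarith⟩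
  have h2 := hA S _ (fun j => h1 _ (add_c_mul_mem h hτ j)) i
  have h3 := mul_le_mul_of_nonneg_left h2 hτ
  refine (norm_sub_le _ _).trans ?_
  rw [norm_mul, Complex.norm_real, Real.norm_of_nonneg hτ]
  have h4 := norm_sub_le (y (a + rk.c i * τ)) (y a)
  have h5 := h0 _ (add_c_mul_mem h hτ i)
  have h6 := h0 _ ha
  linarith

/-- Taylor expansion at the left endpoint turns the residual of each stage into stage defects of
monomials times derivatives of y, plus remainders. The number r of terms is left free so that later
the remainder can be taken one order lower when τx is large. -/
theorem exists_stepDefect_le {p q : ℕ} (h : rk.IsAdmissible p q) :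
    ∃ C : ℝ, 0 < C ∧ ∀ (r : ℕ) (a τ x S : ℝ) (f : ℝ → ℂ) (D : ℕ → ℝ → ℂ), r ≤ p → 0 ≤ τ → 0 ≤ x →
      (∀ ℓ ≤ r, ∀ u ∈ Icc a (a + τ),
        HasDerivWithinAt (D ℓ) (D (ℓ + 1) u) (Icc a (a + τ)) u) →
      (∀ u ∈ Icc a (a + τ), D 1 u = -(x : ℂ) * D 0 u + f u) →
      (∀ u ∈ Icc a (a + τ), ‖D (r + 1) u‖ ≤ S) →
      ‖stepDefect rk a τ x (D 0) f‖ ≤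
        C * (∑ ℓ ∈ Finset.Icc (q + 1) r,
            τ ^ ℓ * (min 1 (τ * x) ^ (p + 1 - ℓ) / (1 + τ * x)) * ‖D ℓ a‖
          + τ ^ (r + 1) * S / (1 + τ * x)) := by
  obtain ⟨C, hC0, hC⟩ := h.exists_lastRow_bound
  obtain ⟨C', hC'0, hC'⟩ := h.exists_sum_lastRow_stageDefect_bound
  obtain ⟨A₀, hA₀, hA⟩ := exists_norm_row_mul_le rk
  refine ⟨C' + (s + 1) * (C * (1 + A₀)), by positivity,
    fun r a τ x S f D hr hτ hx hD h1 hS => ?_⟩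
  have hz : 0 ≤ τ * x := mul_nonneg hτ hx
  have ha : a ∈ Icc a (a + τ) := ⟨le_rfl, by linarith⟩
  have hS0 : 0 ≤ S := (norm_nonneg _).trans (hS a ha)
  have hm : 0 ≤ min 1 (τ * x) := le_min zero_le_one hz
  -- ρ and σ are the Taylor remainders at the nodes, for y and for y' respectively; the one for y'
  -- is one order lower and is compensated by the factor τ in front of A.
  set ρ : Fin (s + 1) → ℂ := fun i => D 0 (a + rk.c i * τ) - ∑ ℓ ∈ Finset.range (r + 1),
    (((rk.c i * τ) ^ ℓ / ℓ.factorial : ℝ) : ℂ) * D ℓ a with hρ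
  set σ : Fin (s + 1) → ℂ := fun i => D 1 (a + rk.c i * τ) - ∑ ℓ ∈ Finset.range r,
    (((rk.c i * τ) ^ ℓ / ℓ.factorial : ℝ) : ℂ) * D (ℓ + 1) a with hσ
  have hρb : ∀ i, ‖ρ i‖ ≤ S * τ ^ (r + 1) := fun i => by
    have := norm_sub_taylor_le (r + 1) D (fun ℓ hℓ => hD ℓ (by omega)) hS _
      (add_c_mul_mem h hτ i)
    simpa [hρ] using this
  have hσb : ∀ i, ‖σ i‖ ≤ S * τ ^ r := fun i => by
    have := norm_sub_taylor_le r (fun ℓ => D (ℓ + 1)) (fun ℓ hℓ => hD (ℓ + 1) (by omega)) hS _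
      (add_c_mul_mem h hτ i)
    simpa [hσ] using this
  have hΔ : ∀ i, D 0 (a + rk.c i * τ) - D 0 a - τ * ∑ j, (rk.A i j : ℂ) *
        (-(x : ℂ) * D 0 (a + rk.c j * τ) + f (a + rk.c j * τ))
      = ∑ ℓ ∈ Finset.range r, (τ : ℂ) ^ (ℓ + 1) * (rk.stageDefect (ℓ + 1) i : ℂ) * D (ℓ + 1) a
        + (ρ i - τ * ∑ j, (rk.A i j : ℂ) * σ j) := by
    intro i
    have e1 : ∀ j, -(x : ℂ) * D 0 (a + rk.c j * τ) + f (a + rk.c j * τ)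
        = σ j + ∑ ℓ ∈ Finset.range r, (((rk.c j * τ) ^ ℓ / ℓ.factorial : ℝ) : ℂ) * D (ℓ + 1) a :=
      fun j => by rw [← h1 _ (add_c_mul_mem h hτ j)]; simp [hσ]
    have e2 : D 0 (a + rk.c i * τ) = ρ i + (∑ ℓ ∈ Finset.range r,
        (((rk.c i * τ) ^ (ℓ + 1) / (ℓ + 1).factorial : ℝ) : ℂ) * D (ℓ + 1) a + D 0 a) := by
      simp only [hρ, Finset.sum_range_succ']
      simp
    have e3 : ∑ ℓ ∈ Finset.range r,
        (τ : ℂ) ^ (ℓ + 1) * (rk.stageDefect (ℓ + 1) i : ℂ) * D (ℓ + 1) a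
        = ∑ ℓ ∈ Finset.range r,
          (((rk.c i * τ) ^ (ℓ + 1) / (ℓ + 1).factorial : ℝ) : ℂ) * D (ℓ + 1) a
        - τ * ∑ j, (rk.A i j : ℂ) * ∑ ℓ ∈ Finset.range r,
          (((rk.c j * τ) ^ ℓ / ℓ.factorial : ℝ) : ℂ) * D (ℓ + 1) a := by
      have e4 : τ * ∑ j, (rk.A i j : ℂ) * ∑ ℓ ∈ Finset.range r,
          (((rk.c j * τ) ^ ℓ / ℓ.factorial : ℝ) : ℂ) * D (ℓ + 1) a
          = ∑ ℓ ∈ Finset.range r, (τ : ℂ) * (∑ j, (rk.A i j : ℂ) *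
            (((rk.c j * τ) ^ ℓ / ℓ.factorial : ℝ) : ℂ)) * D (ℓ + 1) a := by
        simp only [Finset.mul_sum, Finset.sum_mul]
        rw [Finset.sum_comm]
        exact Finset.sum_congr rfl fun i _ => Finset.sum_congr rfl fun j _ => by ring
      rw [e4, ← Finset.sum_sub_distrib]
      refine Finset.sum_congr rfl fun ℓ _ => ?_
      rw [← sub_mul]
      congr 1
      simp only [RKMethod.stageDefect, Nat.add_sub_cancel]
      push_cast
      rw [mul_sub, Finset.mul_sum, Finset.mul_sum]
      congr 1
      · ring
      · exact Finset.sum_congr rfl fun j _ => by ring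
    simp only [e1, mul_add, Finset.sum_add_distrib]
    rw [e2, e3]
    ring
  have hd : stepDefect rk a τ x (D 0) f
      = ∑ ℓ ∈ Finset.range r, (τ : ℂ) ^ (ℓ + 1) * (∑ i, rk.lastRow (-((τ * x : ℝ) : ℂ)) i *
          (rk.stageDefect (ℓ + 1) i : ℂ)) * D (ℓ + 1) a
        + ∑ i, rk.lastRow (-((τ * x : ℝ) : ℂ)) i * (ρ i - τ * ∑ j, (rk.A i j : ℂ) * σ j) := by
    rw [stepDefect_eq h hz]
    rw [Finset.sum_congr rfl fun i _ => by rw [hΔ i, mul_add], Finset.sum_add_distrib]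
    congr 1
    simp only [Finset.mul_sum, Finset.sum_mul]
    rw [Finset.sum_comm]
    exact Finset.sum_congr rfl fun i _ => Finset.sum_congr rfl fun j _ => by ring
  have hsum : ‖∑ ℓ ∈ Finset.range r, (τ : ℂ) ^ (ℓ + 1) *
      (∑ i, rk.lastRow (-((τ * x : ℝ) : ℂ)) i * (rk.stageDefect (ℓ + 1) i : ℂ)) * D (ℓ + 1) a‖
      ≤ C' * ∑ ℓ ∈ Finset.Icc (q + 1) r,
            τ ^ ℓ * (min 1 (τ * x) ^ (p + 1 - ℓ) / (1 + τ * x)) * ‖D ℓ a‖ := by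
    have e5 : ∑ ℓ ∈ Finset.range r, (τ : ℂ) ^ (ℓ + 1) *
        (∑ i, rk.lastRow (-((τ * x : ℝ) : ℂ)) i * (rk.stageDefect (ℓ + 1) i : ℂ)) * D (ℓ + 1) a
        = ∑ ℓ ∈ Finset.Icc 1 r, (τ : ℂ) ^ ℓ *
        (∑ i, rk.lastRow (-((τ * x : ℝ) : ℂ)) i * (rk.stageDefect ℓ i : ℂ)) * D ℓ a := by
      rw [Finset.range_eq_Ico, Finset.sum_Ico_add' (fun ℓ => (τ : ℂ) ^ ℓ *
        (∑ i, rk.lastRow (-((τ * x : ℝ) : ℂ)) i * (rk.stageDefect ℓ i : ℂ)) * D ℓ a) 0 r 1]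
      rfl
    -- The stage order removes all terms with ℓ ≤ q.
    have e6 : ∑ ℓ ∈ Finset.Icc 1 r, (τ : ℂ) ^ ℓ *
        (∑ i, rk.lastRow (-((τ * x : ℝ) : ℂ)) i * (rk.stageDefect ℓ i : ℂ)) * D ℓ a
        = ∑ ℓ ∈ Finset.Icc (q + 1) r, (τ : ℂ) ^ ℓ *
        (∑ i, rk.lastRow (-((τ * x : ℝ) : ℂ)) i * (rk.stageDefect ℓ i : ℂ)) * D ℓ a := by
      symm
      refine Finset.sum_subset (Finset.Icc_subset_Icc_left (by omega)) fun ℓ hℓ hℓ' => ?_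
      rw [Finset.mem_Icc] at hℓ hℓ'
      simp [h.stageOrder.stageDefect_eq_zero hℓ.1 (by omega)]
    rw [e5, e6, Finset.mul_sum]
    refine (norm_sum_le _ _).trans (Finset.sum_le_sum fun ℓ hℓ => ?_)
    rw [Finset.mem_Icc] at hℓ
    rw [norm_mul, norm_mul, norm_pow, Complex.norm_real, Real.norm_of_nonneg hτ]
    have := hC' _ hz ℓ (by omega) (by omega)
    calc _ ≤ τ ^ ℓ * (C' * (min 1 (τ * x) ^ (p + 1 - ℓ) / (1 + τ * x))) * ‖D ℓ a‖ := by gcongr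
      _ = _ := by ring
  have hrem := norm_sum_lastRow_le (hC _ hz) (fun i => ρ i - τ * ∑ j, (rk.A i j : ℂ) * σ j)
    (B := (1 + A₀) * (τ ^ (r + 1) * S)) fun i => by
      have h2 := mul_le_mul_of_nonneg_left (hA _ _ hσb i) hτ
      refine (norm_sub_le _ _).trans ?_
      rw [norm_mul, Complex.norm_real, Real.norm_of_nonneg hτ]
      have h3 := hρb i
      calc _ ≤ S * τ ^ (r + 1) + τ * (A₀ * (S * τ ^ r)) := add_le_add h3 h2
        _ = _ := by ring
  rw [hd]
  refine (norm_add_le _ _).trans ((add_le_add hsum hrem).trans ?_)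
  have hX : 0 ≤ ∑ ℓ ∈ Finset.Icc (q + 1) r,
            τ ^ ℓ * (min 1 (τ * x) ^ (p + 1 - ℓ) / (1 + τ * x)) * ‖D ℓ a‖ := by positivity
  have hY : 0 ≤ τ ^ (r + 1) * S / (1 + τ * x) := by positivity
  have e7 : (s + 1) * (C / (1 + τ * x) * ((1 + A₀) * (τ ^ (r + 1) * S)))
      = (s + 1) * (C * (1 + A₀)) * (τ ^ (r + 1) * S / (1 + τ * x)) := by ring
  rw [e7]
  have hK : 0 ≤ (s + 1) * (C * (1 + A₀)) := by positivity
  have h1 := mul_nonneg hK hX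
  have h2 := mul_nonneg hC'0.le hY
  linarith

end RKgCQ

/-! ### Exact solutions for truncated monomials, products of stability factors, and a step
potential. -/

namespace RKgCQ

/-- The solution at time `t` of `y' = -x y + f`, `y(0) = 0`. -/
noncomputable def odeSol {X : Type*} [NormedAddCommGroup X] [NormedSpace ℂ X] (x : ℝ) (f : ℝ → X)
    (t : ℝ) : X :=
  ∫ r in (0 : ℝ)..t, Real.exp (-(x * (t - r))) • f r

/-- The iterated integrals of `exp (-x u)`, starting with the function itself. -/
noncomputable def expPrim (x : ℝ) : ℕ → ℝ → ℝ
  | 0 => fun u => Real.exp (-(x * u))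
  | k + 1 => fun u => ∫ v in (0 : ℝ)..u, expPrim x k v

theorem continuous_expPrim (x : ℝ) (k : ℕ) : Continuous (expPrim x k) := by
  induction k with
  | zero => simp only [expPrim]; fun_prop
  | succ k ih => exact intervalIntegral.continuous_primitive (fun a b => ih.intervalIntegrable a b) 0

theorem hasDerivAt_expPrim_zero (x u : ℝ) :
    HasDerivAt (expPrim x 0) (-x * expPrim x 0 u) u := by
  have := ((hasDerivAt_id u).const_mul x).neg.exp
  simp only [expPrim]
  refine this.congr_deriv ?_
  simp
  ring

theorem hasDerivAt_expPrim_succ (x : ℝ) (k : ℕ) (u : ℝ) :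
    HasDerivAt (expPrim x (k + 1)) (expPrim x k u) u :=
  intervalIntegral.integral_hasDerivAt_right ((continuous_expPrim x k).intervalIntegrable _ _)
    ((continuous_expPrim x k).stronglyMeasurableAtFilter _ _) (continuous_expPrim x k).continuousAt

theorem expPrim_succ_zero (x : ℝ) (k : ℕ) : expPrim x (k + 1) 0 = 0 := by simp [expPrim]

/-- This says that the (k+1)-st iterated integral solves y' = -x y + u^k/k!, y(0) = 0. The
derivative of the identity for k + 1 is the identity for k, so only the value at 0 has to be
checked. -/
theorem mul_expPrim_succ_add (x : ℝ) (k : ℕ) (u : ℝ) :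
    x * expPrim x (k + 1) u + expPrim x k u = u ^ k / k.factorial := by
  have key : ∀ (k : ℕ), (∀ u, HasDerivAt (fun u => x * expPrim x (k + 1) u + expPrim x k u
      - u ^ k / k.factorial) 0 u) → x * expPrim x (k + 1) 0 + expPrim x k 0
      - 0 ^ k / k.factorial = 0 →
      ∀ u, x * expPrim x (k + 1) u + expPrim x k u - u ^ k / k.factorial = 0 := by
    intro k hk h0 u
    rw [← h0]
    exact is_const_of_deriv_eq_zero (fun u => (hk u).differentiableAt) (fun u => (hk u).deriv) u 0
  suffices H : ∀ u, x * expPrim x (k + 1) u + expPrim x k u - u ^ k / k.factorial = 0 from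
    sub_eq_zero.1 (H u)
  induction k with
  | zero =>
    refine key 0 (fun u => ?_) (by simp [expPrim])
    have := (((hasDerivAt_expPrim_succ x 0 u).const_mul x).add (hasDerivAt_expPrim_zero x u)).sub_const
      ((1 : ℝ))
    simpa using this
  | succ k ih =>
    refine key (k + 1) (fun u => ?_) (by simp [expPrim_succ_zero])
    have h1 : HasDerivAt (fun u : ℝ => u ^ (k + 1) / ((k + 1).factorial : ℝ))
          (u ^ k / k.factorial) u := by
      refine ((hasDerivAt_pow (k + 1) u).div_const ((k + 1).factorial : ℝ)).congr_deriv ?_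
      have h0 : (k.factorial : ℝ) ≠ 0 := by positivity
      rw [Nat.factorial_succ, Nat.add_sub_cancel]
      push_cast
      field_simp
    refine ((((hasDerivAt_expPrim_succ x (k + 1) u).const_mul x).add
      (hasDerivAt_expPrim_succ x k u)).sub h1).congr_deriv (ih u)

theorem expPrim_nonneg (x : ℝ) (k : ℕ) {u : ℝ} (hu : 0 ≤ u) : 0 ≤ expPrim x k u := by
  induction k generalizing u with
  | zero => exact (Real.exp_pos _).le
  | succ k ih => exact intervalIntegral.integral_nonneg hu fun v hv => ih hv.1

theorem expPrim_le {x : ℝ} (hx : 0 ≤ x) (k : ℕ) {u : ℝ} (hu : 0 ≤ u) :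
    expPrim x k u ≤ u ^ k / k.factorial := by
  have := mul_expPrim_succ_add x k u
  have := mul_nonneg hx (expPrim_nonneg x (k + 1) hu)
  linarith

theorem expPrim_le_pow {x : ℝ} (hx : 0 ≤ x) (k : ℕ) {u : ℝ} (hu : 0 ≤ u) :
    expPrim x k u ≤ u ^ k :=
  (expPrim_le hx k hu).trans
    (div_le_self (by positivity) (by exact_mod_cast Nat.one_le_iff_ne_zero.2 k.factorial_ne_zero))

/-- Both terms of the preceding identity are nonnegative for u ≥ 0, so x times the iterated integral
is at most the monomial. This factor 1/x makes the stage-order part of the error integrable at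
infinity. -/
theorem expPrim_succ_le {x : ℝ} (hx : 0 < x) (k : ℕ) {u : ℝ} (hu : 0 ≤ u) :
    expPrim x (k + 1) u ≤ u ^ k / x := by
  have h1 := mul_expPrim_succ_add x k u
  have h2 := expPrim_nonneg x k hu
  have h3 : u ^ k / k.factorial ≤ u ^ k := 
    div_le_self (by positivity) (by exact_mod_cast Nat.one_le_iff_ne_zero.2 k.factorial_ne_zero)
  rw [le_div_iff₀ hx]
  linarith

/-- The truncated monomial `(t - r)₊^k / k!`. -/
noncomputable def truncMonomial (k : ℕ) (r t : ℝ) : ℝ :=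
  if r < t then (t - r) ^ k / k.factorial else 0

theorem odeSol_truncMonomial (x : ℝ) (k : ℕ) {r t : ℝ} (hr : 0 ≤ r) :
    odeSol x (fun s => (truncMonomial k r s : ℂ)) t
      = ((if r < t then expPrim x (k + 1) (t - r) else 0 : ℝ) : ℂ) := by
  have h0 : odeSol x (fun s => (truncMonomial k r s : ℂ)) t
      = ((∫ s in (0 : ℝ)..t, Real.exp (-(x * (t - s))) * truncMonomial k r s : ℝ) : ℂ) := by
    rw [← intervalIntegral.integral_ofReal, odeSol]
    simp
  rw [h0]
  congr 1
  have hzero : ∀ b ≤ r, ∫ s in (0 : ℝ)..b, Real.exp (-(x * (t - s))) * truncMonomial k r s = 0 := by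
    intro b hb
    refine intervalIntegral.integral_zero_ae (Eventually.of_forall fun s hs => ?_)
    have : ¬ r < s := by
      rw [not_lt]
      rcases le_total 0 b with h | h
      · rw [uIoc_of_le h] at hs; exact hs.2.trans hb
      · rw [uIoc_of_ge h] at hs; exact hs.2.trans hr
    simp [truncMonomial, this]
  split_ifs with hrt
  · have hint : ∀ s ∈ Ioc r t, Real.exp (-(x * (t - s))) * ((s - r) ^ k / k.factorial)
        = Real.exp (-(x * (t - s))) * truncMonomial k r s := fun s hs => by
      simp [truncMonomial, hs.1]
    have hcont : Continuous fun s => Real.exp (-(x * (t - s))) * ((s - r) ^ k / k.factorial) := by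
      fun_prop
    have hi2 : IntervalIntegrable (fun s => Real.exp (-(x * (t - s))) * truncMonomial k r s)
        MeasureTheory.volume r t :=
      (hcont.intervalIntegrable r t).congr (by rw [uIoc_of_le hrt.le]; exact hint)
    have hi1 : IntervalIntegrable (fun s => Real.exp (-(x * (t - s))) * truncMonomial k r s)
        MeasureTheory.volume 0 r := by
      refine (intervalIntegrable_const (c := (0 : ℝ))).congr ?_
      rw [uIoc_of_le hr]
      intro s hs
      simp [truncMonomial, not_lt.2 hs.2]
    rw [← intervalIntegral.integral_add_adjacent_intervals hi1 hi2, hzero r le_rfl, zero_add]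
    have h1 : ∫ s in r..t, Real.exp (-(x * (t - s))) * truncMonomial k r s
        = ∫ s in r..t, Real.exp (-(x * (t - s))) * ((s - r) ^ k / k.factorial) := by
      refine intervalIntegral.integral_congr_ae (Eventually.of_forall fun s hs => ?_)
      rw [uIoc_of_le hrt.le] at hs
      exact (hint s hs).symm
    -- An explicit antiderivative in s, whose derivative is the integrand by the differential
    -- equation of the iterated integral.
    rw [h1, intervalIntegral.integral_eq_sub_of_hasDerivAt
      (f := fun s => Real.exp (-(x * (t - s))) * expPrim x (k + 1) (s - r)) ?_
      (hcont.intervalIntegrable r t)]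
    · simp [expPrim_succ_zero]
    · intro s _
      have h2 : HasDerivAt (fun s => Real.exp (-(x * (t - s)))) (Real.exp (-(x * (t - s))) * x) s := by
        have := (((hasDerivAt_id s).const_sub t).const_mul x).neg.exp
        simpa using this
      have h3 := (hasDerivAt_expPrim_succ x k (s - r)).comp_sub_const s r
      refine (h2.mul h3).congr_deriv ?_
      rw [← mul_expPrim_succ_add x k (s - r)]
      ring
  · exact hzero t (not_lt.1 hrt)

theorem sub_add_step (t : ℕ → ℝ) (j : ℕ) : t (j - 1) + step t j = t j := by simp [step]

section Products

variable {c x : ℝ} {t : ℕ → ℝ} {n : ℕ}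

/-- A product of factors 1 + a_l with a_l ≥ 0 is at least 1 + Σ a_l, and the step sizes telescope.
The ordering of the mesh points is carried along because the induction needs it. -/
theorem prod_le_inv_one_add (hc : 0 ≤ c) (hx : 0 ≤ x)
    (ht : ∀ j, 1 ≤ j → j ≤ n → 0 ≤ step t j) {j : ℕ} (hj : 1 ≤ j) (hjn : j ≤ n + 1) :
    ∏ l ∈ Finset.Icc j n, 1 / (1 + c * (step t l * x)) ≤ 1 / (1 + c * x * (t n - t (j - 1))) ∧
      t (j - 1) ≤ t n := by
  induction n with
  | zero =>
    obtain rfl : j = 1 := by omega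
    simp
  | succ n ih =>
    rcases eq_or_lt_of_le hjn with rfl | hlt
    · simp
    obtain ⟨h1, h2⟩ := ih (fun j h1 h2 => ht j h1 (by omega)) (by omega)
    have h3 := ht (n + 1) (by omega) le_rfl
    have h4 : t (n + 1) = t n + step t (n + 1) := by simp [step]
    refine ⟨?_, by linarith⟩
    rw [Finset.prod_Icc_succ_top (by omega)]
    have h5 : 0 ≤ c * x * (t n - t (j - 1)) :=
      mul_nonneg (mul_nonneg hc hx) (sub_nonneg.2 h2)
    have h6 : 0 ≤ c * (step t (n + 1) * x) := by positivity
    calc _ ≤ 1 / (1 + c * x * (t n - t (j - 1))) * (1 / (1 + c * (step t (n + 1) * x))) := by gcongr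
      _ = 1 / ((1 + c * x * (t n - t (j - 1))) * (1 + c * (step t (n + 1) * x))) := by
        rw [div_mul_div_comm, one_mul]
      _ ≤ _ := by
        refine one_div_le_one_div_of_le ?_ ?_
        · have := mul_nonneg (mul_nonneg hc hx) h3
          rw [h4]
          nlinarith
        · rw [h4]
          nlinarith

/-- The value 1/(cx) is a fixed point of the recursion S ↦ (S + τ)/(1 + cτx), whatever τ ≥ 0, and
the sum starts below it. This is the mesh-independent analogue of integrating an exponential. -/
theorem sum_mul_prod_le (hc : 0 < c) (hx : 0 < x) (ht : ∀ j, 1 ≤ j → j ≤ n → 0 ≤ step t j) :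
    ∑ j ∈ Finset.Icc 1 n, step t j * ∏ l ∈ Finset.Icc j n, 1 / (1 + c * (step t l * x))
      ≤ 1 / (c * x) := by
  induction n with
  | zero => simp; positivity
  | succ n ih =>
    have h1 := ih fun j h1 h2 => ht j h1 (by omega)
    have h3 := ht (n + 1) (by omega) le_rfl
    have h6 : 0 ≤ c * (step t (n + 1) * x) := by positivity
    have h2 : ∑ j ∈ Finset.Icc 1 (n + 1), step t j *
          ∏ l ∈ Finset.Icc j (n + 1), 1 / (1 + c * (step t l * x))
        = (∑ j ∈ Finset.Icc 1 n, step t j * ∏ l ∈ Finset.Icc j n, 1 / (1 + c * (step t l * x))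
          + step t (n + 1)) * (1 / (1 + c * (step t (n + 1) * x))) := by
      rw [Finset.sum_Icc_succ_top (by omega), add_mul, Finset.sum_mul]
      congr 1
      · refine Finset.sum_congr rfl fun j hj => ?_
        rw [Finset.prod_Icc_succ_top (by have := (Finset.mem_Icc.1 hj).2; omega), mul_assoc]
      · simp
    rw [h2]
    calc _ ≤ (1 / (c * x) + step t (n + 1)) * (1 / (1 + c * (step t (n + 1) * x))) := by gcongr
      _ = _ := by field_simp

end Products

/-- A potential whose increments control the contributions of the single steps. -/
noncomputable def stepPotential (x r u : ℝ) : ℝ :=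
  if r < u then 2 - Real.exp (-(x * (u - r) / 2)) else 0

theorem one_le_stepPotential_sub {x r a b : ℝ} (hx : 0 ≤ x) (ha : a ≤ r) (hb : r < b) :
    1 ≤ stepPotential x r b - stepPotential x r a := by
  rw [stepPotential, stepPotential, if_pos hb, if_neg (not_lt.2 ha)]
  have : Real.exp (-(x * (b - r) / 2)) ≤ 1 := by
    rw [Real.exp_le_one_iff]
    have := mul_nonneg hx (sub_nonneg.2 hb.le)
    linarith
  linarith

/-- To the right of r the increment is exp(-x(a-r)/2) (1 - exp(-τx/2)), and the last factor is at
least min(1, τx)/3. The potential uses only half of the exponential decay; the other half is kept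
for the final bound. -/
theorem min_mul_exp_le_stepPotential_sub {x r a τ : ℝ} (hx : 0 ≤ x) (ha : r < a) (hτ : 0 ≤ τ) :
    min 1 (τ * x) * Real.exp (-(x * (a - r) / 2))
      ≤ 3 * (stepPotential x r (a + τ) - stepPotential x r a) := by
  rw [stepPotential, stepPotential, if_pos ha, if_pos (by linarith)]
  have h1 : Real.exp (-(x * (a + τ - r) / 2))
      = Real.exp (-(x * (a - r) / 2)) * Real.exp (-(τ * x / 2)) := by
    rw [← Real.exp_add]; congr 1; ring
  have hz : 0 ≤ τ * x := mul_nonneg hτ hx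
  have h2 : Real.exp (-(τ * x / 2)) ≤ 1 / (1 + τ * x / 2) := by
    rw [Real.exp_neg, ← one_div]
    refine one_div_le_one_div_of_le (by linarith) ?_
    linarith [Real.add_one_le_exp (τ * x / 2)]
  have h3 : min 1 (τ * x) ≤ 3 * (1 - Real.exp (-(τ * x / 2))) := by
    have h4 : min 1 (τ * x) / 3 ≤ 1 - 1 / (1 + τ * x / 2) := by
      rw [div_le_iff₀ (by norm_num), one_sub_div (by linarith), div_mul_eq_mul_div,
        le_div_iff₀ (by linarith)]
      rcases le_total 1 (τ * x) with h | h
      · rw [min_eq_left h]; linarith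
      · rw [min_eq_right h]; nlinarith
    linarith
  rw [h1]
  have := mul_le_mul_of_nonneg_right h3 (Real.exp_pos (-(x * (a - r) / 2))).le
  linarith

/-- The increments telescope and the potential has values in [0, 2]. The sum of the step
contributions is thus bounded independently of x, r and the mesh. -/
theorem sum_stepPotential_le (x r : ℝ) (hx : 0 ≤ x) (t : ℕ → ℝ) (n : ℕ) :
    ∑ j ∈ Finset.Icc 1 n, (stepPotential x r (t j) - stepPotential x r (t (j - 1))) ≤ 2 := by
  have h : ∑ j ∈ Finset.Icc 1 n, (stepPotential x r (t j) - stepPotential x r (t (j - 1)))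
      = stepPotential x r (t n) - stepPotential x r (t 0) := by
    induction n with
    | zero => simp
    | succ n ih => rw [Finset.sum_Icc_succ_top (by omega), ih]; simp
  rw [h]
  have h1 : stepPotential x r (t n) ≤ 2 := by
    rw [stepPotential]; split_ifs <;> linarith [Real.exp_pos (-(x * (t n - r) / 2))]
  have h2 : 0 ≤ stepPotential x r (t 0) := by
    rw [stepPotential]
    split_ifs with h
    · have : Real.exp (-(x * (t 0 - r) / 2)) ≤ 1 := by
        rw [Real.exp_le_one_iff]
        have := mul_nonneg hx (sub_nonneg.2 h.le)
        linarith
      linarith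
    · exact le_rfl
  linarith

end RKgCQ

/-! ### Local defects for truncated monomials. -/

namespace RKgCQ

variable {s : ℕ} {rk : RKMethod s}

/-- The part of the error of the quadrature that is due to the stage order. -/
noncomputable def stageTerm (p q : ℕ) (τ x : ℝ) : ℝ :=
  if q + 2 ≤ p then τ ^ q * min 1 (τ * x) ^ 2 / x else 0

theorem stageTerm_nonneg {p q : ℕ} {τ x : ℝ} (hτ : 0 ≤ τ) (hx : 0 ≤ x) :
    0 ≤ stageTerm p q τ x := by
  unfold stageTerm
  split_ifs <;> positivity

/-- For ℓ ≤ p - 1 at least two powers of min(1, τx) are available, and the surplus powers of τ are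
bounded by the length of the interval. One factor τ is split off so that the sum over the steps can
be taken with `sum_mul_prod_le`. -/
theorem pow_mul_min_pow_le {p q ℓ : ℕ} {T τ τ' x : ℝ} (hτ : 0 ≤ τ) (hττ' : τ ≤ τ') (hT : τ' ≤ T)
    (hx : 0 < x) (hq : q + 1 ≤ ℓ) (hp : ℓ + 1 ≤ p) :
    τ ^ ℓ * min 1 (τ * x) ^ (p + 1 - ℓ) / x ≤ max 1 T ^ p * (τ * stageTerm p q τ' x) := by
  have hm0 : 0 ≤ min 1 (τ * x) := le_min zero_le_one (by positivity)
  have hm1 : min 1 (τ * x) ≤ 1 := min_le_left _ _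
  have h1 : min 1 (τ * x) ^ (p + 1 - ℓ) ≤ min 1 (τ' * x) ^ 2 :=
    (pow_le_pow_of_le_one hm0 hm1 (by omega : 2 ≤ p + 1 - ℓ)).trans (by gcongr)
  obtain ⟨m, rfl⟩ := Nat.exists_eq_add_of_le hq
  have h2 : τ ^ m ≤ max 1 T ^ p := by
    calc τ ^ m ≤ max 1 T ^ m := by gcongr; exact (hττ'.trans hT).trans (le_max_right _ _)
      _ ≤ max 1 T ^ p := pow_le_pow_right₀ (le_max_left _ _) (by omega)
  have h3 : τ ^ q ≤ τ' ^ q := by gcongr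
  have hτ' : 0 ≤ τ' := hτ.trans hττ'
  rw [stageTerm, if_pos (by omega)]
  calc τ ^ (q + 1 + m) * min 1 (τ * x) ^ (p + 1 - (q + 1 + m)) / x
      = τ ^ m * (τ * (τ ^ q * min 1 (τ * x) ^ (p + 1 - (q + 1 + m)) / x)) := by ring
    _ ≤ max 1 T ^ p * (τ * (τ' ^ q * min 1 (τ' * x) ^ 2 / x)) := by gcongr

/-- The defect splits into a part of full order τ^p, weighted by an increment of the potential so
that it can be summed, and a part from the terms q < ℓ < p, where the derivatives of the solution
are O(1/x). -/
theorem exists_stepDefect_truncMonomial_le {k q : ℕ} (h : rk.IsAdmissible (k + 1) q) (T : ℝ) :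
    ∃ C : ℝ, 0 < C ∧ ∀ (a τ τ' x r : ℝ), 0 ≤ r → 0 ≤ a → 0 ≤ τ → τ ≤ τ' → τ' ≤ T → a ≤ T →
      0 < x →
      ‖stepDefect rk a τ x
        (fun u => ((if r < u then expPrim x (k + 1) (u - r) else 0 : ℝ) : ℂ))
        (fun u => (truncMonomial k r u : ℂ))‖
      ≤ C / (1 + τ * x) * (τ' ^ (k + 1) * ((stepPotential x r (a + τ) - stepPotential x r a)
          * Real.exp (-(x * max (a - r) 0 / 2))) + τ * stageTerm (k + 1) q τ' x) := by
  obtain ⟨C₁, hC₁0, hC₁⟩ := exists_stepDefect_le_of_norm_le h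
  obtain ⟨C₂, hC₂0, hC₂⟩ := exists_stepDefect_le h
  set T₁ := max 1 T with hT₁
  have hT₁1 : 1 ≤ T₁ := le_max_left _ _
  refine ⟨C₁ + C₂ * (6 + (k + 1) * (T₁ ^ (k + 1) * T₁ ^ k)), by positivity,
    fun a τ τ' x r hr ha hτ hττ' hτ'T haT hx => ?_⟩
  have hz : 0 ≤ τ * x := by positivity
  have hE := stageTerm_nonneg (p := k + 1) (q := q) (hτ.trans hττ') hx.le
  have hτ'0 : 0 ≤ τ' := hτ.trans hττ'
  have hf : ∀ u, r < u → -(x : ℂ) * ((expPrim x (k + 1) (u - r) : ℝ) : ℂ)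
      + (((u - r) ^ k / k.factorial : ℝ) : ℂ) = (expPrim x k (u - r) : ℝ) := by
    intro u _
    rw [← mul_expPrim_succ_add x k (u - r)]
    push_cast
    ring
  have hK : 0 ≤ C₂ * (6 + (k + 1) * (T₁ ^ (k + 1) * T₁ ^ k)) := by positivity
  -- Steps before r: source and solution vanish, and so does the defect.
  rcases le_or_gt (a + τ) r with h1 | h1
  · have := hC₁ a τ x 0 (fun u => ((if r < u then expPrim x (k + 1) (u - r) else 0 : ℝ) : ℂ))
      (fun u => (truncMonomial k r u : ℂ)) hτ hx.le
      (fun u hu => by simp [not_lt.2 (hu.2.trans h1)])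
      (fun u hu => by simp [truncMonomial, not_lt.2 (hu.2.trans h1)])
    refine this.trans ?_
    rw [stepPotential, stepPotential, if_neg (not_lt.2 h1), if_neg (not_lt.2 (by linarith))]
    simp only [mul_zero, zero_div, sub_self, zero_mul, zero_add]
    positivity
  -- The one step that contains r: the crude bound gives order τ^p, paid for by the unit jump of the
  -- potential at r.
  rcases le_or_gt a r with h2 | h2
  · have h3 := one_le_stepPotential_sub (x := x) hx.le h2 h1
    have := hC₁ a τ x (τ ^ k)
      (fun u => ((if r < u then expPrim x (k + 1) (u - r) else 0 : ℝ) : ℂ))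
      (fun u => (truncMonomial k r u : ℂ)) hτ hx.le
      (fun u hu => by
        split_ifs with hu'
        · rw [Complex.norm_real, Real.norm_of_nonneg (expPrim_nonneg _ _ (by linarith))]
          refine (expPrim_le_pow hx.le _ (by linarith)).trans ?_
          rw [← pow_succ']
          have := hu.2
          exact pow_le_pow_left₀ (by linarith) (by linarith) _
        · simp; positivity)
      (fun u hu => by
        simp only [truncMonomial]
        split_ifs with hu'
        · rw [hf u hu', Complex.norm_real, Real.norm_of_nonneg (expPrim_nonneg _ _ (by linarith))]
          refine (expPrim_le_pow hx.le _ (by linarith)).trans ?_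
          have := hu.2
          exact pow_le_pow_left₀ (by linarith) (by linarith) _
        · simp; positivity)
    refine this.trans ?_
    rw [max_eq_right (by linarith), mul_zero, zero_div, neg_zero, Real.exp_zero, mul_one]
    have h4 : τ * τ ^ k ≤ τ' ^ (k + 1) := by rw [← pow_succ']; gcongr
    calc C₁ * (τ * τ ^ k / (1 + τ * x)) = C₁ / (1 + τ * x) * (τ * τ ^ k) := by ring
      _ ≤ (C₁ + C₂ * (6 + (k + 1) * (T₁ ^ (k + 1) * T₁ ^ k))) / (1 + τ * x) *
        (τ' ^ (k + 1) * (stepPotential x r (a + τ) - stepPotential x r a)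
          + τ * stageTerm (k + 1) q τ' x) := by
        gcongr
        · linarith
        · have : τ' ^ (k + 1) ≤ τ' ^ (k + 1) * (stepPotential x r (a + τ) - stepPotential x r a) :=
            le_mul_of_one_le_right (by positivity) h3
          have := mul_nonneg hτ hE
          linarith
  -- Steps after r: the solution is smooth, its derivatives down to order p = k + 1 are lower
  -- iterated integrals, and the next one is -x exp(-x(u-r)).
  · set D : ℕ → ℝ → ℂ := fun ℓ u => ((if ℓ ≤ k + 1 then expPrim x (k + 1 - ℓ) (u - r)
      else -x * expPrim x 0 (u - r) : ℝ) : ℂ) with hDdef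
    have hru : ∀ u ∈ Icc a (a + τ), r < u := fun u hu => h2.trans_le hu.1
    have hD : ∀ ℓ ≤ k + 1, ∀ u ∈ Icc a (a + τ),
        HasDerivWithinAt (D ℓ) (D (ℓ + 1) u) (Icc a (a + τ)) u := by
      intro ℓ hℓ u hu
      rcases eq_or_lt_of_le hℓ with rfl | hlt
      · have h3 := ((hasDerivAt_expPrim_zero x (u - r)).comp_sub_const u r).ofReal_comp
        simpa [hDdef] using h3.hasDerivWithinAt
      · have h3 := ((hasDerivAt_expPrim_succ x (k - ℓ) (u - r)).comp_sub_const u r).ofReal_comp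
        simp only [hDdef, if_pos hℓ, if_pos (show ℓ + 1 ≤ k + 1 by omega)]
        rw [show k + 1 - ℓ = k - ℓ + 1 by omega, show k + 1 - (ℓ + 1) = k - ℓ by omega]
        exact h3.hasDerivWithinAt
    have hdef : stepDefect rk a τ x
        (fun u => ((if r < u then expPrim x (k + 1) (u - r) else 0 : ℝ) : ℂ))
        (fun u => (truncMonomial k r u : ℂ))
        = stepDefect rk a τ x (D 0) (fun u => (truncMonomial k r u : ℂ)) := by
      simp only [stepDefect, hDdef]
      simp [h2, show r < a + τ by linarith]
    have hD1 : ∀ u ∈ Icc a (a + τ), D 1 u = -(x : ℂ) * D 0 u + (truncMonomial k r u : ℂ) := by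
      intro u hu
      have := hf u (hru u hu)
      simp only [truncMonomial, if_pos (hru u hu)]
      simpa [hDdef] using this.symm
    set e := Real.exp (-(x * (a - r))) with he
    have he0 : 0 < e := Real.exp_pos _
    have hexp : ∀ u ∈ Icc a (a + τ), expPrim x 0 (u - r) ≤ e := by
      intro u hu
      simp only [expPrim, he]
      gcongr
      exact hu.1
    have hee : e = Real.exp (-(x * (a - r) / 2)) * Real.exp (-(x * (a - r) / 2)) := by
      rw [← Real.exp_add, he]; congr 1; ring
    have hpot := min_mul_exp_le_stepPotential_sub (x := x) hx.le h2 hτ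
    set E := Real.exp (-(x * (a - r) / 2)) with hEdef
    set Φ := stepPotential x r (a + τ) - stepPotential x r a with hΦ
    have hE0 : 0 < E := Real.exp_pos _
    have hm0 : 0 ≤ min 1 (τ * x) := le_min zero_le_one hz
    have hmain : min 1 (τ * x) * e ≤ 3 * (Φ * E) := by
      rw [hee]
      have := mul_le_mul_of_nonneg_right hpot hE0.le
      linarith
    have hΦE : 0 ≤ Φ * E := by
      have : 0 ≤ min 1 (τ * x) * e := by positivity
      linarith
    have hsum : ∑ ℓ ∈ Finset.Icc (q + 1) k, τ ^ ℓ *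
        (min 1 (τ * x) ^ (k + 1 + 1 - ℓ) / (1 + τ * x)) * ‖D ℓ a‖
        ≤ (k + 1) * (T₁ ^ (k + 1) * T₁ ^ k) * (τ * stageTerm (k + 1) q τ' x) / (1 + τ * x) := by
      have hterm : ∀ ℓ ∈ Finset.Icc (q + 1) k, τ ^ ℓ *
        (min 1 (τ * x) ^ (k + 1 + 1 - ℓ) / (1 + τ * x)) * ‖D ℓ a‖
          ≤ (T₁ ^ (k + 1) * T₁ ^ k) * (τ * stageTerm (k + 1) q τ' x) / (1 + τ * x) := by
        intro ℓ hℓ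
        rw [Finset.mem_Icc] at hℓ
        have h5 : ‖D ℓ a‖ ≤ T₁ ^ k / x := by
          simp only [hDdef, if_pos (show ℓ ≤ k + 1 by omega)]
          rw [Complex.norm_real, Real.norm_of_nonneg (expPrim_nonneg _ _ (by linarith)),
            show k + 1 - ℓ = k - ℓ + 1 by omega]
          refine (expPrim_succ_le hx _ (by linarith)).trans ?_
          gcongr
          calc (a - r) ^ (k - ℓ) ≤ T₁ ^ (k - ℓ) := by
                have : a - r ≤ T₁ := le_trans (by linarith) (le_max_right _ _)
                exact pow_le_pow_left₀ (by linarith) this _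
            _ ≤ T₁ ^ k := pow_le_pow_right₀ hT₁1 (by omega)
        have h6 := pow_mul_min_pow_le (p := k + 1) (q := q) (ℓ := ℓ) hτ hττ' hτ'T hx hℓ.1 (by omega)
        calc τ ^ ℓ * (min 1 (τ * x) ^ (k + 1 + 1 - ℓ) / (1 + τ * x)) * ‖D ℓ a‖
            ≤ τ ^ ℓ * (min 1 (τ * x) ^ (k + 1 + 1 - ℓ) / (1 + τ * x)) * (T₁ ^ k / x) := by gcongr
          _ = (τ ^ ℓ * min 1 (τ * x) ^ (k + 1 + 1 - ℓ) / x) * T₁ ^ k / (1 + τ * x) := by ring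
          _ ≤ (T₁ ^ (k + 1) * (τ * stageTerm (k + 1) q τ' x)) * T₁ ^ k / (1 + τ * x) := by gcongr
          _ = _ := by ring
      refine (Finset.sum_le_card_nsmul _ _ _ hterm).trans ?_
      rw [nsmul_eq_mul, Nat.card_Icc]
      have : ((k + 1 - (q + 1) : ℕ) : ℝ) ≤ k + 1 := by
        exact_mod_cast (by omega : k + 1 - (q + 1) ≤ k + 1)
      refine (mul_le_mul_of_nonneg_right this (div_nonneg
        (mul_nonneg (by positivity) (mul_nonneg hτ hE)) (by positivity))).trans (le_of_eq ?_)
      ring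
    have hpow : τ ^ (k + 1) ≤ τ' ^ (k + 1) := by gcongr
    have hrest : ‖stepDefect rk a τ x (D 0) (fun u => (truncMonomial k r u : ℂ))‖
        ≤ C₂ * ((k + 1) * (T₁ ^ (k + 1) * T₁ ^ k) * (τ * stageTerm (k + 1) q τ' x) / (1 + τ * x)
          + 2 * (τ ^ (k + 1) * (min 1 (τ * x) * e) / (1 + τ * x))) := by
      -- The Taylor length is p if τx ≤ 1, with remainder τ^(p+1) x e, and p - 1 if τx ≥ 1, with
      -- remainder τ^p e. Both equal τ^p min(1, τx) e.
      rcases le_total (τ * x) 1 with hz1 | hz1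
      · refine (hC₂ (k + 1) a τ x (x * e) (fun u => (truncMonomial k r u : ℂ)) D le_rfl hτ hx.le hD
          hD1 (fun u hu => ?_)).trans ?_
        · simp only [hDdef, if_neg (show ¬ k + 1 + 1 ≤ k + 1 by omega)]
          rw [Complex.norm_real, norm_mul, norm_neg, Real.norm_of_nonneg hx.le,
            Real.norm_of_nonneg (expPrim_nonneg _ _ (by linarith [hru u hu]))]
          exact mul_le_mul_of_nonneg_left (hexp u hu) hx.le
        · refine mul_le_mul_of_nonneg_left ?_ hC₂0.le
          have h7 : ∑ ℓ ∈ Finset.Icc (q + 1) (k + 1), τ ^ ℓ *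
            (min 1 (τ * x) ^ (k + 1 + 1 - ℓ) / (1 + τ * x)) * ‖D ℓ a‖
            ≤ ∑ ℓ ∈ Finset.Icc (q + 1) k, τ ^ ℓ *
            (min 1 (τ * x) ^ (k + 1 + 1 - ℓ) / (1 + τ * x)) * ‖D ℓ a‖
            + τ ^ (k + 1) * (min 1 (τ * x) * e) / (1 + τ * x) := by
            rcases le_or_gt (q + 1) (k + 1) with hq | hq
            · rw [Finset.sum_Icc_succ_top hq]
              gcongr
              have h8 : ‖D (k + 1) a‖ = e := by
                simp only [hDdef, if_pos le_rfl, Nat.sub_self, expPrim]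
                rw [Complex.norm_real, Real.norm_of_nonneg (Real.exp_pos _).le]
              rw [h8, show k + 1 + 1 - (k + 1) = 1 by omega, pow_one]
              exact le_of_eq (by ring)
            · rw [Finset.Icc_eq_empty (by omega), Finset.Icc_eq_empty (by omega)]
              simp only [Finset.sum_empty, zero_add]
              positivity
          have h9 : τ ^ (k + 1 + 1) * (x * e) / (1 + τ * x)
              = τ ^ (k + 1) * (min 1 (τ * x) * e) / (1 + τ * x) := by
            rw [min_eq_right hz1]; ring
          linarith
      · refine (hC₂ k a τ x e (fun u => (truncMonomial k r u : ℂ)) D (by omega) hτ hx.le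
          (fun ℓ hℓ => hD ℓ (by omega)) hD1 (fun u hu => ?_)).trans ?_
        · simp only [hDdef, if_pos (le_refl (k + 1)), Nat.sub_self]
          rw [Complex.norm_real, Real.norm_of_nonneg (expPrim_nonneg _ _ (by linarith [hru u hu]))]
          exact hexp u hu
        · refine mul_le_mul_of_nonneg_left ?_ hC₂0.le
          have h9 : τ ^ (k + 1) * e / (1 + τ * x)
              = τ ^ (k + 1) * (min 1 (τ * x) * e) / (1 + τ * x) := by
            rw [min_eq_left hz1]; ring
          have h10 : 0 ≤ τ ^ (k + 1) * (min 1 (τ * x) * e) / (1 + τ * x) := by positivity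
          linarith
    rw [hdef, max_eq_left (by linarith)]
    refine hrest.trans ?_
    have hX : 0 ≤ τ * stageTerm (k + 1) q τ' x := mul_nonneg hτ hE
    have hY : τ ^ (k + 1) * (min 1 (τ * x) * e) ≤ 3 * (τ' ^ (k + 1) * (Φ * E)) := by
      calc _ ≤ τ' ^ (k + 1) * (3 * (Φ * E)) := by gcongr
        _ = _ := by ring
    set G := (k + 1 : ℝ) * (T₁ ^ (k + 1) * T₁ ^ k) with hG
    have hG0 : 0 ≤ G := by positivity
    calc _ = C₂ / (1 + τ * x) * (G * (τ * stageTerm (k + 1) q τ' x)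
          + 2 * (τ ^ (k + 1) * (min 1 (τ * x) * e))) := by ring
      _ ≤ C₂ / (1 + τ * x) * (G * (τ * stageTerm (k + 1) q τ' x)
          + 2 * (3 * (τ' ^ (k + 1) * (Φ * E)))) := by gcongr
      _ ≤ C₂ / (1 + τ * x) * ((6 + G) * (τ' ^ (k + 1) * (Φ * E) + τ * stageTerm (k + 1) q τ' x)) := by
        gcongr
        have h1 : 0 ≤ τ' ^ (k + 1) * (Φ * E) := by positivity
        have h2 := mul_nonneg hG0 h1
        linarith
      _ = (C₂ * (6 + G)) / (1 + τ * x) * (τ' ^ (k + 1) * (Φ * E)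
          + τ * stageTerm (k + 1) q τ' x) := by ring
      _ ≤ _ := by
        gcongr
        · have h1 : 0 ≤ τ' ^ (k + 1) * (Φ * E) := by positivity
          linarith

end RKgCQ

/-! ### Pointwise global error for truncated monomials. -/

namespace RKgCQ

variable {s : ℕ} {rk : RKMethod s}

/-- The error at `t n` of the Runge-Kutta approximation of `y' = -x y + f`, `y(0) = 0`. -/
noncomputable def odeError {X : Type*} [NormedAddCommGroup X] [NormedSpace ℂ X] (rk : RKMethod s)
    (t : ℕ → ℝ) (n : ℕ) (f : ℝ → X) (x : ℝ) : X :=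
  odeSol x f (t n) - odeApprox rk t f n x

/-- The product of stability factors lacks l = j. The denominator 1 + τ_j x of the local defect
supplies it, since c ≤ 1. -/
theorem prod_stability_div_le {c x : ℝ} {t : ℕ → ℝ} {n : ℕ} (hc0 : 0 ≤ c) (hc1 : c ≤ 1)
    (hR : ∀ z : ℝ, 0 ≤ z → ‖rk.stability (-(z : ℂ))‖ ≤ 1 / (1 + c * z)) (hx : 0 ≤ x)
    (ht : ∀ j, 1 ≤ j → j ≤ n → 0 ≤ step t j) {j : ℕ} (h1 : 1 ≤ j) (hjn : j ≤ n) :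
    (∏ l ∈ Finset.Icc (j + 1) n, ‖rk.stability (-((step t l * x : ℝ) : ℂ))‖) / (1 + step t j * x)
      ≤ ∏ l ∈ Finset.Icc j n, 1 / (1 + c * (step t l * x)) := by
  have hz : ∀ l, 1 ≤ l → l ≤ n → 0 ≤ step t l * x := fun l h1 h2 => mul_nonneg (ht l h1 h2) hx
  have e : Finset.Icc (j + 1) n = Finset.Ioc j n := by ext; simp [Finset.mem_Icc]
  rw [← Finset.mul_prod_Ioc_eq_prod_Icc hjn, e, div_eq_mul_one_div, mul_comm]
  have hzj := hz j h1 hjn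
  refine mul_le_mul ?_ ?_ (Finset.prod_nonneg fun l _ => norm_nonneg _) (by positivity)
  · refine one_div_le_one_div_of_le (by positivity) ?_
    nlinarith
  · refine Finset.prod_le_prod (fun l _ => norm_nonneg _) fun l hl => hR _ ?_
    rw [Finset.mem_Ioc] at hl
    exact hz l (by omega) hl.2

/-- The stability factors decay over [a, b] and the solution decays over [r, a]; since (1+A)(1+B) ≥
1 + A + B, together they give decay over the whole of [r, b]. -/
theorem one_div_mul_exp_le {c x a b r : ℝ} (hc0 : 0 < c) (hc1 : c ≤ 1) (hx : 0 ≤ x) (hab : a ≤ b)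
    (hrb : r ≤ b) :
    1 / (1 + c * x * (b - a)) * Real.exp (-(x * max (a - r) 0 / 2))
      ≤ 1 / (1 + c / 2 * x * (b - r)) := by
  have h0 : 0 ≤ x * max (a - r) 0 / 2 := by positivity
  have h1 : Real.exp (-(x * max (a - r) 0 / 2)) ≤ 1 / (1 + x * max (a - r) 0 / 2) := by
    rw [Real.exp_neg, ← one_div]
    refine one_div_le_one_div_of_le (by linarith) ?_
    linarith [Real.add_one_le_exp (x * max (a - r) 0 / 2)]
  have h2 : 0 ≤ c * x * (b - a) := mul_nonneg (by positivity) (sub_nonneg.2 hab)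
  have h3 : 0 ≤ c / 2 * x * (b - r) := mul_nonneg (by positivity) (sub_nonneg.2 hrb)
  calc _ ≤ 1 / (1 + c * x * (b - a)) * (1 / (1 + x * max (a - r) 0 / 2)) := by gcongr
    _ = 1 / ((1 + c * x * (b - a)) * (1 + x * max (a - r) 0 / 2)) := by
      rw [div_mul_div_comm, one_mul]
    _ ≤ _ := by
      refine one_div_le_one_div_of_le (by positivity) ?_
      have h4 : c / 2 * x * (a - r) ≤ x * max (a - r) 0 / 2 := by
        have h5 : x * (a - r) ≤ x * max (a - r) 0 := by gcongr; exact le_max_left _ _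
        have h6 : c * (x * max (a - r) 0) ≤ x * max (a - r) 0 :=
          mul_le_of_le_one_left (by positivity) hc1
        have h7 : c * (x * (a - r)) ≤ c * (x * max (a - r) 0) := by gcongr
        linarith
      nlinarith [mul_nonneg h2 h0]

/-- In the propagated sum of the defects, the full-order parts add up by the telescoping potential
and the stage parts by `sum_mul_prod_le`, which produces the second factor 1/x. -/
theorem exists_odeError_truncMonomial_le {k q : ℕ} (h : rk.IsAdmissible (k + 1) q) (T : ℝ) :
    ∃ C c : ℝ, 0 < C ∧ 0 < c ∧ ∀ (t : ℕ → ℝ) (n : ℕ) (τ x r : ℝ), t 0 = 0 → t n ≤ T → τ ≤ T →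
      (∀ j, 1 ≤ j → j ≤ n → 0 ≤ step t j ∧ step t j ≤ τ) → 0 < x → 0 ≤ r → r < t n →
      ‖odeError rk t n (fun u => (truncMonomial k r u : ℂ)) x‖
        ≤ C * (τ ^ (k + 1) / (1 + c * x * (t n - r)) + stageTerm (k + 1) q τ x / x) := by
  obtain ⟨C, hC0, hC⟩ := exists_stepDefect_truncMonomial_le h T
  obtain ⟨c, hc0, hc1, hR⟩ := h.exists_stability_bound
  refine ⟨C * (2 + 1 / c), c / 2, by positivity, by positivity,
    fun t n τ x r ht0 htn hτT hst hx hr hrn => ?_⟩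
  have hst0 : ∀ j, 1 ≤ j → j ≤ n → 0 ≤ step t j := fun j h1 h2 => (hst j h1 h2).1
  have hn1 : 1 ≤ n := by
    rcases Nat.eq_zero_or_pos n with rfl | h
    · linarith
    · exact h
  have hτ0 : 0 ≤ τ := (hst 1 le_rfl hn1).1.trans (hst 1 le_rfl hn1).2
  have hmono : ∀ j, 1 ≤ j → j ≤ n → 0 ≤ t (j - 1) ∧ t (j - 1) ≤ t n := by
    intro j h1 h2
    refine ⟨?_, (prod_le_inv_one_add hc0.le hx.le hst0 h1 (by omega)).2⟩
    have := (prod_le_inv_one_add (t := t) (n := j - 1) hc0.le hx.le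
      (fun i h3 h4 => hst0 i h3 (by omega)) (j := 1) le_rfl (by omega)).2
    simpa [ht0] using this
  have hE := stageTerm_nonneg (p := k + 1) (q := q) hτ0 hx.le
  set y : ℝ → ℂ := fun u => ((if r < u then expPrim x (k + 1) (u - r) else 0 : ℝ) : ℂ) with hy
  have hsol : odeSol x (fun u => (truncMonomial k r u : ℂ)) (t n) = y (t n) :=
    odeSol_truncMonomial x k hr
  rw [odeError, hsol]
  refine (norm_sub_odeApprox_le rk t x y _ (by simp [hy, ht0, not_lt.2 hr]) n).trans ?_
  set Φ : ℕ → ℝ := fun j => stepPotential x r (t j) - stepPotential x r (t (j - 1)) with hΦ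
  have hΦ0 : ∀ j, 1 ≤ j → j ≤ n → 0 ≤ Φ j := by
    intro j h1 h2
    have h3 := sub_add_step t j
    rcases le_or_gt (t j) r with h4 | h4
    · have h5 : ¬ r < t (j - 1) := by have := hst0 j h1 h2; linarith
      simp [hΦ, stepPotential, not_lt.2 h4, h5]
    rcases le_or_gt (t (j - 1)) r with h5 | h5
    · have := one_le_stepPotential_sub hx.le h5 h4
      simp only [hΦ]; linarith
    · have := min_mul_exp_le_stepPotential_sub hx.le h5 (hst0 j h1 h2)
      rw [h3] at this
      have h6 : 0 ≤ min 1 (step t j * x) * Real.exp (-(x * (t (j - 1) - r) / 2)) :=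
        mul_nonneg (le_min zero_le_one (mul_nonneg (hst0 j h1 h2) hx.le)) (Real.exp_pos _).le
      simp only [hΦ]; linarith
  set κ := 1 / (1 + c / 2 * x * (t n - r)) with hκ
  have hterm : ∀ j ∈ Finset.Icc 1 n,
      (∏ l ∈ Finset.Icc (j + 1) n, ‖rk.stability (-((step t l * x : ℝ) : ℂ))‖)
        * ‖stepDefect rk (t (j - 1)) (step t j) x y (fun u => (truncMonomial k r u : ℂ))‖
      ≤ C * (τ ^ (k + 1) * κ * Φ j + (step t j *
          ∏ l ∈ Finset.Icc j n, 1 / (1 + c * (step t l * x))) * stageTerm (k + 1) q τ x) := by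
    intro j hj
    rw [Finset.mem_Icc] at hj
    have h1 := hC (t (j - 1)) (step t j) τ x r hr (hmono j hj.1 hj.2).1 (hst0 j hj.1 hj.2)
      (hst j hj.1 hj.2).2 hτT ((hmono j hj.1 hj.2).2.trans htn) hx
    rw [sub_add_step] at h1
    have h2 := prod_stability_div_le hc0.le hc1 hR hx.le hst0 hj.1 hj.2
    have h3 := (prod_le_inv_one_add hc0.le hx.le hst0 hj.1 (by omega : j ≤ n + 1)).1
    have h4 := one_div_mul_exp_le hc0 hc1 hx.le (hmono j hj.1 hj.2).2 hrn.le
    set P := ∏ l ∈ Finset.Icc (j + 1) n, ‖rk.stability (-((step t l * x : ℝ) : ℂ))‖ with hP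
    set Q := ∏ l ∈ Finset.Icc j n, 1 / (1 + c * (step t l * x)) with hQ
    set e := Real.exp (-(x * max (t (j - 1) - r) 0 / 2)) with he
    have hP0 : 0 ≤ P := Finset.prod_nonneg fun l _ => norm_nonneg _
    -- The half of the exponential not used in the potential is combined with the stability product
    -- into a factor that does not depend on j.
    have h5 : Q * e ≤ κ := (mul_le_mul_of_nonneg_right h3 (Real.exp_pos _).le).trans h4
    have hB : 0 ≤ τ ^ (k + 1) * (Φ j * e) + step t j * stageTerm (k + 1) q τ x := by
      have := hΦ0 j hj.1 hj.2
      have := hst0 j hj.1 hj.2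
      positivity
    calc P * _ ≤ P * (C / (1 + step t j * x) * (τ ^ (k + 1) * (Φ j * e)
          + step t j * stageTerm (k + 1) q τ x)) := by gcongr
      _ = C * (P / (1 + step t j * x) * (τ ^ (k + 1) * (Φ j * e)
          + step t j * stageTerm (k + 1) q τ x)) := by ring
      _ ≤ C * (Q * (τ ^ (k + 1) * (Φ j * e)
          + step t j * stageTerm (k + 1) q τ x)) := by gcongr
      _ = C * (τ ^ (k + 1) * (Q * e) * Φ j + (step t j * Q) * stageTerm (k + 1) q τ x) := by ring
      _ ≤ _ := by
        have := hΦ0 j hj.1 hj.2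
        gcongr
  refine (Finset.sum_le_sum hterm).trans ?_
  rw [← Finset.mul_sum, Finset.sum_add_distrib, ← Finset.mul_sum, ← Finset.sum_mul, mul_assoc C (2 + 1 / c)]
  refine mul_le_mul_of_nonneg_left ?_ hC0.le
  have h1 := sum_stepPotential_le x r hx.le t n
  have h2 := sum_mul_prod_le hc0 hx hst0
  have hκ0 : 0 ≤ κ := by
    have : 0 ≤ t n - r := by linarith
    positivity
  have e1 : τ ^ (k + 1) / (1 + c / 2 * x * (t n - r)) = τ ^ (k + 1) * κ := by
    rw [hκ, mul_one_div]
  rw [e1]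
  calc _ ≤ τ ^ (k + 1) * κ * 2 + 1 / (c * x) * stageTerm (k + 1) q τ x := by gcongr
    _ = 2 * (τ ^ (k + 1) * κ) + 1 / c * (stageTerm (k + 1) q τ x / x) := by field_simp
    _ ≤ _ := by
      rw [add_mul, mul_add, mul_add]
      have h3 : 0 ≤ τ ^ (k + 1) * κ := by positivity
      have h4 : 0 ≤ stageTerm (k + 1) q τ x / x := by positivity
      have h5 : 0 ≤ 1 / c := by positivity
      nlinarith [mul_nonneg h5 h3]

end RKgCQ

/-! ### Weighted integration over x. -/

namespace RKgCQ

open MeasureTheory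

variable {s : ℕ} {rk : RKMethod s}

theorem integrableOn_rpow_neg_mul_min {α : ℝ} (hα₀ : 0 < α) (hα₁ : α < 1) :
    IntegrableOn (fun u : ℝ => u ^ (-α) * min 1 u⁻¹) (Ioi 0) := by
  rw [← Ioc_union_Ioi_eq_Ioi (zero_le_one' ℝ)]
  refine IntegrableOn.union ?_ ?_
  · have h := intervalIntegral.intervalIntegrable_rpow' (r := -α) (by linarith) (a := 0) (b := 1)
    rw [intervalIntegrable_iff_integrableOn_Ioc_of_le zero_le_one] at h
    refine h.congr_fun (fun u hu => ?_) measurableSet_Ioc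
    simp only
    rw [min_eq_left ((one_le_inv₀ hu.1).2 hu.2), mul_one]
  · have h := integrableOn_Ioi_rpow_of_lt (a := -α - 1) (by linarith) one_pos
    refine h.congr_fun (fun u hu => ?_) measurableSet_Ioi
    have hu' : 1 < u := hu
    simp only
    rw [min_eq_right (inv_le_one_of_one_le₀ hu'.le), Real.rpow_sub_one (by linarith), div_eq_mul_inv]

/-- Scaling u = bx. The integral converges at 0 because α < 1 and at infinity because α > 0. -/
theorem exists_lintegral_rpow_neg_mul_min_le {α : ℝ} (hα₀ : 0 < α) (hα₁ : α < 1) :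
    ∃ C : ℝ, 0 < C ∧ ∀ b : ℝ, 0 < b →
      ∫⁻ x in Ioi (0 : ℝ), ENNReal.ofReal (x ^ (-α) * min 1 (b * x)⁻¹)
        ≤ ENNReal.ofReal (C * b ^ (α - 1)) := by
  have hI := integrableOn_rpow_neg_mul_min hα₀ hα₁
  have hpos : ∀ x : ℝ, 0 < x → 0 ≤ x ^ (-α) * min 1 x⁻¹ := fun x hx => by positivity
  refine ⟨1 + ∫ u in Ioi (0 : ℝ), u ^ (-α) * min 1 u⁻¹, ?_, fun b hb => ?_⟩
  · have := setIntegral_nonneg (μ := volume) measurableSet_Ioi fun x hx => hpos x hx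
    linarith
  have h1 : IntegrableOn (fun x : ℝ => b ^ α * ((b * x) ^ (-α) * min 1 (b * x)⁻¹)) (Ioi 0) := by
    refine Integrable.const_mul ?_ _
    have := (integrableOn_Ioi_comp_mul_left_iff (fun u : ℝ => u ^ (-α) * min 1 u⁻¹) 0 hb).2
    exact this (by simpa using hI)
  have h2 : ∀ x ∈ Ioi (0 : ℝ), b ^ α * ((b * x) ^ (-α) * min 1 (b * x)⁻¹)
      = x ^ (-α) * min 1 (b * x)⁻¹ := by
    intro x hx
    rw [Real.mul_rpow hb.le (le_of_lt hx), ← mul_assoc, ← mul_assoc, ← Real.rpow_add hb]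
    simp
  rw [setLIntegral_congr_fun measurableSet_Ioi
    (fun x hx => congrArg ENNReal.ofReal (h2 x hx).symm), ← ofReal_integral_eq_lintegral_ofReal h1]
  · refine ENNReal.ofReal_le_ofReal ?_
    rw [integral_const_mul, integral_comp_mul_left_Ioi (fun u : ℝ => u ^ (-α) * min 1 u⁻¹) 0 hb,
      mul_zero, smul_eq_mul, ← mul_assoc, mul_comm]
    have : b ^ α * b⁻¹ = b ^ (α - 1) := by rw [Real.rpow_sub_one hb.ne', div_eq_mul_inv]
    rw [this]
    refine mul_le_mul_of_nonneg_right ?_ (by positivity)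
    linarith
  · refine (ae_restrict_iff' measurableSet_Ioi).2 (Eventually.of_forall fun x hx => ?_)
    have : 0 < x := hx
    simp only [Pi.zero_apply]
    positivity

/-- The weighted `L¹` norm of the error of the Runge-Kutta approximations. -/
noncomputable def errorNorm {X : Type*} [NormedAddCommGroup X] [NormedSpace ℂ X] (α : ℝ)
    (rk : RKMethod s) (t : ℕ → ℝ) (n : ℕ) (f : ℝ → X) : ENNReal :=
  ∫⁻ x in Ioi (0 : ℝ), ENNReal.ofReal (x ^ (-α)) * ‖odeError rk t n f x‖ₑ

theorem errorNorm_le_of_le {X : Type*} [NormedAddCommGroup X] [NormedSpace ℂ X] {α : ℝ}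
    {t : ℕ → ℝ} {n : ℕ} {f : ℝ → X} (B : ℝ → ℝ)
    (h : ∀ x, 0 < x → ‖odeError rk t n f x‖ ≤ B x) :
    errorNorm α rk t n f ≤ ∫⁻ x in Ioi (0 : ℝ), ENNReal.ofReal (x ^ (-α) * B x) := by
  refine setLIntegral_mono' measurableSet_Ioi fun x hx => ?_
  rw [← ofReal_norm, ← ENNReal.ofReal_mul (Real.rpow_nonneg (le_of_lt hx) _)]
  exact ENNReal.ofReal_le_ofReal (mul_le_mul_of_nonneg_left (h x hx)
    (Real.rpow_nonneg (le_of_lt hx) _))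

theorem one_div_one_add_le_min {u : ℝ} (hu : 0 < u) : 1 / (1 + u) ≤ min 1 u⁻¹ := by
  refine le_min ?_ ?_
  · rw [div_le_one (by linarith)]; linarith
  · rw [← one_div]; exact one_div_le_one_div_of_le hu (by linarith)

theorem min_one_sq_div_sq_le {u : ℝ} (hu : 0 < u) : min 1 u ^ 2 / u ^ 2 ≤ min 1 u⁻¹ := by
  have h0 : 0 ≤ min 1 u := le_min zero_le_one hu.le
  refine le_min ?_ ?_
  · rw [div_le_one (by positivity)]
    gcongr
    exact min_le_right _ _
  · rw [div_le_iff₀ (by positivity), pow_two, pow_two, inv_mul_cancel_left₀ hu.ne']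
    calc min 1 u * min 1 u ≤ 1 * u := by
          gcongr
          · exact min_le_left _ _
          · exact min_le_right _ _
      _ = u := one_mul u

/-- The integrand is τ^(q+2) x^(-α) min(1, τx)²/(τx)², and scaling contributes τ^(α-1): this is
where the rate q + 1 + α comes from. If p ≤ q + 1 there is no such term. -/
theorem exists_lintegral_stageTerm_le {α : ℝ} (hα₀ : 0 < α) (hα₁ : α < 1) (p q : ℕ) :
    ∃ C : ℝ, 0 < C ∧ ∀ τ : ℝ, 0 < τ →
      ∫⁻ x in Ioi (0 : ℝ), ENNReal.ofReal (x ^ (-α) * (stageTerm p q τ x / x))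
        ≤ ENNReal.ofReal (C * τ ^ min (p : ℝ) (q + 1 + α)) := by
  obtain ⟨C, hC0, hC⟩ := exists_lintegral_rpow_neg_mul_min_le hα₀ hα₁
  refine ⟨C, hC0, fun τ hτ => ?_⟩
  by_cases hpq : q + 2 ≤ p
  · have h1 : ∀ x ∈ Ioi (0 : ℝ), ENNReal.ofReal (x ^ (-α) * (stageTerm p q τ x / x))
        ≤ ENNReal.ofReal (τ ^ (q + 2)) * ENNReal.ofReal (x ^ (-α) * min 1 (τ * x)⁻¹) := by
      intro x hx
      have hx' : 0 < x := hx
      rw [← ENNReal.ofReal_mul (by positivity)]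
      refine ENNReal.ofReal_le_ofReal ?_
      have h2 := min_one_sq_div_sq_le (u := τ * x) (by positivity)
      rw [stageTerm, if_pos hpq]
      calc x ^ (-α) * (τ ^ q * min 1 (τ * x) ^ 2 / x / x)
          = τ ^ (q + 2) * (x ^ (-α) * (min 1 (τ * x) ^ 2 / (τ * x) ^ 2)) := by
            field_simp
            ring
        _ ≤ _ := by gcongr
    refine (setLIntegral_mono' measurableSet_Ioi h1).trans ?_
    rw [lintegral_const_mul' _ _ ENNReal.ofReal_ne_top]
    refine (mul_le_mul_right (hC τ hτ) _).trans ?_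
    rw [← ENNReal.ofReal_mul (by positivity)]
    refine ENNReal.ofReal_le_ofReal (le_of_eq ?_)
    have h3 : min (p : ℝ) (q + 1 + α) = q + 1 + α := by
      refine min_eq_right ?_
      have : ((q + 2 : ℕ) : ℝ) ≤ p := by exact_mod_cast hpq
      push_cast at this
      linarith
    rw [h3, mul_left_comm, ← Real.rpow_natCast, ← Real.rpow_add hτ]
    congr 2
    push_cast
    ring
  · simp [stageTerm, hpq]

theorem rpow_le_mul_rpow {τ T a b : ℝ} (hτ : 0 < τ) (hT : τ ≤ T) (hab : a ≤ b) :
    τ ^ b ≤ max 1 T ^ (b - a) * τ ^ a := by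
  have : τ ^ b = τ ^ (b - a) * τ ^ a := by rw [← Real.rpow_add hτ]; simp
  rw [this]
  gcongr
  exact hT.trans (le_max_right _ _)

/-- The hypotheses on the mesh points `t 0, …, t n`: they start at `0`, do not exceed `T`, and the
step sizes are positive and bounded by `τ`. -/
structure IsPartialMesh (T τ : ℝ) (n : ℕ) (t : ℕ → ℝ) : Prop where
  zero : t 0 = 0
  le : t n ≤ T
  one_le : 1 ≤ n
  step_pos : ∀ j, 1 ≤ j → j ≤ n → 0 < step t j
  step_le : ∀ j, 1 ≤ j → j ≤ n → step t j ≤ τ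
  max_le : τ ≤ T

theorem IsPartialMesh.pos {T τ : ℝ} {n : ℕ} {t : ℕ → ℝ} (h : IsPartialMesh T τ n t) : 0 < τ :=
  (h.step_pos 1 le_rfl h.one_le).trans_le (h.step_le 1 le_rfl h.one_le)

theorem IsPartialMesh.le_of_le {T τ : ℝ} {n : ℕ} {t : ℕ → ℝ} (h : IsPartialMesh T τ n t) {i j : ℕ}
    (hij : i ≤ j) (hj : j ≤ n) : t i ≤ t j := by
  induction j with
  | zero => rw [Nat.le_zero.1 hij]
  | succ j ih =>
    rcases eq_or_lt_of_le hij with rfl | hlt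
    · exact le_rfl
    · have h1 := ih (by omega) (by omega)
      have h2 := h.step_pos (j + 1) (by omega) hj
      simp only [step, Nat.add_sub_cancel] at h2
      linarith

theorem IsPartialMesh.nonneg {T τ : ℝ} {n : ℕ} {t : ℕ → ℝ} (h : IsPartialMesh T τ n t) {j : ℕ}
    (hj : j ≤ n) : 0 ≤ t j :=
  h.zero ▸ h.le_of_le (Nat.zero_le j) hj

theorem IsPartialMesh.last_pos {T τ : ℝ} {n : ℕ} {t : ℕ → ℝ} (h : IsPartialMesh T τ n t) :
    0 < t n := by
  have h1 := h.le_of_le h.one_le le_rfl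
  have h2 := h.step_pos 1 le_rfl h.one_le
  simp only [step, Nat.sub_self, h.zero] at h2
  linarith

/-- The basic kernel estimate. The singularity (t_n - r)^(α-1) comes from scaling the decay 1/(1 + c
x (t_n - r)), and it is integrable in r. -/
theorem exists_errorNorm_truncMonomial_le {k q : ℕ} (h : rk.IsAdmissible (k + 1) q) {α T : ℝ}
    (hα₀ : 0 < α) (hα₁ : α < 1) (hT : 0 < T) :
    ∃ C : ℝ, 0 < C ∧ ∀ (t : ℕ → ℝ) (n : ℕ) (τ r : ℝ), IsPartialMesh T τ n t → 0 ≤ r → r < t n →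
      errorNorm α rk t n (fun u => (truncMonomial k r u : ℂ))
        ≤ ENNReal.ofReal (C * τ ^ min ((k + 1 : ℕ) : ℝ) (q + 1 + α) * (t n - r) ^ (α - 1)) := by
  obtain ⟨C, c, hC0, hc0, hC⟩ := exists_odeError_truncMonomial_le h T
  obtain ⟨C₁, hC₁0, hC₁⟩ := exists_lintegral_rpow_neg_mul_min_le hα₀ hα₁
  obtain ⟨C₂, hC₂0, hC₂⟩ := exists_lintegral_stageTerm_le hα₀ hα₁ (k + 1) q
  set μ := min ((k + 1 : ℕ) : ℝ) (q + 1 + α) with hμ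
  refine ⟨C * (max 1 T ^ (((k + 1 : ℕ) : ℝ) - μ) * (C₁ * c ^ (α - 1)) + C₂ * T ^ (1 - α)),
    by positivity, fun t n τ r hm hr hrn => ?_⟩
  have hτ := hm.pos
  have hθ : 0 < t n - r := sub_pos.2 hrn
  refine (errorNorm_le_of_le _ fun x hx => hC t n τ x r hm.zero hm.le hm.max_le
    (fun j h1 h2 => ⟨(hm.step_pos j h1 h2).le, hm.step_le j h1 h2⟩) hx hr hrn).trans ?_
  have h1 : ∀ x ∈ Ioi (0 : ℝ), ENNReal.ofReal (x ^ (-α) * (C * (τ ^ (k + 1) /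
      (1 + c * x * (t n - r)) + stageTerm (k + 1) q τ x / x)))
      ≤ ENNReal.ofReal (C * τ ^ (k + 1)) * ENNReal.ofReal (x ^ (-α) * min 1 (c * (t n - r) * x)⁻¹)
        + ENNReal.ofReal C * ENNReal.ofReal (x ^ (-α) * (stageTerm (k + 1) q τ x / x)) := by
    intro x hx
    have hx' : 0 < x := hx
    have hE := stageTerm_nonneg (p := k + 1) (q := q) hτ.le hx'.le
    rw [← ENNReal.ofReal_mul (by positivity), ← ENNReal.ofReal_mul (by positivity),
      ← ENNReal.ofReal_add (by positivity) (by positivity)]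
    refine ENNReal.ofReal_le_ofReal ?_
    have h2 := one_div_one_add_le_min (u := c * (t n - r) * x) (by positivity)
    calc _ = C * τ ^ (k + 1) * (x ^ (-α) * (1 / (1 + c * (t n - r) * x)))
          + C * (x ^ (-α) * (stageTerm (k + 1) q τ x / x)) := by
          rw [show c * x * (t n - r) = c * (t n - r) * x by ring]; ring
      _ ≤ _ := by gcongr
  refine (setLIntegral_mono' measurableSet_Ioi h1).trans ?_
  rw [lintegral_add_left (by fun_prop), lintegral_const_mul' _ _ ENNReal.ofReal_ne_top,
    lintegral_const_mul' _ _ ENNReal.ofReal_ne_top]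
  refine (add_le_add (mul_le_mul_right (hC₁ _ (mul_pos hc0 hθ)) _)
    (mul_le_mul_right (hC₂ τ hτ) _)).trans ?_
  rw [← ENNReal.ofReal_mul (by positivity), ← ENNReal.ofReal_mul (by positivity),
      ← ENNReal.ofReal_add (by positivity) (by positivity)]
  refine ENNReal.ofReal_le_ofReal ?_
  have h3 : τ ^ (k + 1) ≤ max 1 T ^ (((k + 1 : ℕ) : ℝ) - μ) * τ ^ μ := by
    rw [← Real.rpow_natCast]
    exact rpow_le_mul_rpow hτ hm.max_le (min_le_left _ _)
  -- The stage part does not depend on r; since t_n - r ≤ T, the common factor (t_n - r)^(α-1) may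
  -- be inserted at the price of T^(1-α).
  have h4 : 1 ≤ T ^ (1 - α) * (t n - r) ^ (α - 1) := by
    have h5 : (t n - r) ^ (1 - α) ≤ T ^ (1 - α) := by
      gcongr
      linarith [hm.le]
    calc (1 : ℝ) = (t n - r) ^ (1 - α) * (t n - r) ^ (α - 1) := by
          rw [← Real.rpow_add hθ]; simp
      _ ≤ _ := by gcongr
  rw [Real.mul_rpow hc0.le hθ.le]
  calc _ ≤ C * (max 1 T ^ (((k + 1 : ℕ) : ℝ) - μ) * τ ^ μ) * (C₁ * (c ^ (α - 1) * (t n - r) ^ (α - 1)))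
        + C * (C₂ * τ ^ μ) * (T ^ (1 - α) * (t n - r) ^ (α - 1)) := by
        refine add_le_add (by gcongr) (le_mul_of_one_le_right (by positivity) h4)
    _ = _ := by ring

end RKgCQ

/-! ### Beta integrals and superposition of sources. -/

namespace RKgCQ

open MeasureTheory

variable {s : ℕ} {rk : RKMethod s}

/-- Euler's beta integral with shifted arguments. -/
noncomputable def betaConst (a e : ℝ) : ℝ := ∫ σ in (0 : ℝ)..1, (1 - σ) ^ a * σ ^ e

theorem intervalIntegrable_beta {a e : ℝ} (ha : -1 < a) (he : -1 < e) :
    IntervalIntegrable (fun σ : ℝ => (1 - σ) ^ a * σ ^ e) volume 0 1 := by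
  have h := (Complex.betaIntegral_convergent (u := (e : ℂ) + 1) (v := (a : ℂ) + 1)
    (by simp; linarith) (by simp; linarith)).norm
  refine h.congr fun σ hσ => ?_
  rw [uIoc_of_le zero_le_one] at hσ
  have h1 : (1 - σ : ℂ) = ((1 - σ : ℝ) : ℂ) := by push_cast; ring
  simp only [add_sub_cancel_right]
  rw [h1, ← Complex.ofReal_cpow hσ.1.le, ← Complex.ofReal_cpow (by linarith [hσ.2]),
    ← Complex.ofReal_mul, Complex.norm_real, Real.norm_of_nonneg, mul_comm]
  exact mul_nonneg (Real.rpow_nonneg hσ.1.le _) (Real.rpow_nonneg (by linarith [hσ.2]) _)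

theorem betaConst_pos {a e : ℝ} (ha : -1 < a) (he : -1 < e) : 0 < betaConst a e := by
  refine intervalIntegral.intervalIntegral_pos_of_pos_on (intervalIntegrable_beta ha he)
    (fun σ hσ => ?_) one_pos
  have : 0 < 1 - σ := by linarith [hσ.2]
  have : 0 < σ := hσ.1
  positivity

theorem beta_scaled {a e r b : ℝ} (ha : -1 < a) (he : -1 < e) (hrb : r < b) :
    IntervalIntegrable (fun s : ℝ => (b - s) ^ a * (s - r) ^ e) volume r b ∧
      ∫ s in r..b, (b - s) ^ a * (s - r) ^ e = (b - r) ^ (a + e + 1) * betaConst a e := by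
  set c := b - r with hc
  have hc0 : 0 < c := sub_pos.2 hrb
  set G : ℝ → ℝ := fun σ => (1 - σ) ^ a * σ ^ e with hG
  have h1 : ∀ s ∈ Icc r b, c ^ (a + e) * G ((s - r) / c) = (b - s) ^ a * (s - r) ^ e := by
    intro s hs
    have h2 : 1 - (s - r) / c = (b - s) / c := by
      rw [one_sub_div hc0.ne', hc]; congr 1; ring
    simp only [hG]
    rw [h2, Real.div_rpow (by linarith [hs.2]) hc0.le, Real.div_rpow (by linarith [hs.1]) hc0.le,
      Real.rpow_add hc0]
    have := (Real.rpow_pos_of_pos hc0 a).ne'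
    have := (Real.rpow_pos_of_pos hc0 e).ne'
    field_simp
  have h3 : IntervalIntegrable (fun s => G ((s - r) / c)) volume r b := by
    have h4 := ((intervalIntegrable_beta ha he).comp_mul_right (c := c⁻¹)
      ).comp_sub_right r
    simp only [div_inv_eq_mul, one_mul, ← div_eq_mul_inv] at h4
    simpa [hc] using h4
  constructor
  · refine (h3.const_mul (c ^ (a + e))).congr fun s hs => h1 s ?_
    rw [uIoc_of_le hrb.le] at hs
    exact ⟨hs.1.le, hs.2⟩
  · have h5 : ∫ s in r..b, (b - s) ^ a * (s - r) ^ e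
        = ∫ s in r..b, c ^ (a + e) * G ((s - r) / c) := by
      refine intervalIntegral.integral_congr fun s hs => (h1 s ?_).symm
      rwa [uIcc_of_le hrb.le] at hs
    rw [h5, intervalIntegral.integral_const_mul,
      intervalIntegral.integral_comp_sub_right (fun s => G (s / c)) r, sub_self, ← hc,
      intervalIntegral.integral_comp_div _ hc0.ne', zero_div, div_self hc0.ne', smul_eq_mul,
      Real.rpow_add_one hc0.ne']
    simp only [hG, betaConst]
    ring

theorem lintegral_beta {a e r b : ℝ} (ha : -1 < a) (he : -1 < e) (hrb : r < b) :
    ∫⁻ s in Ioc r b, ENNReal.ofReal ((b - s) ^ a * (s - r) ^ e)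
      = ENNReal.ofReal ((b - r) ^ (a + e + 1) * betaConst a e) := by
  obtain ⟨h1, h2⟩ := beta_scaled ha he hrb
  rw [← h2, intervalIntegral.integral_of_le hrb.le, ofReal_integral_eq_lintegral_ofReal]
  · exact (intervalIntegrable_iff_integrableOn_Ioc_of_le hrb.le).1 h1
  · refine (ae_restrict_iff' measurableSet_Ioc).2 (Eventually.of_forall fun s hs => ?_)
    exact mul_nonneg (Real.rpow_nonneg (by linarith [hs.2]) _)
      (Real.rpow_nonneg (by linarith [hs.1]) _)

section Superposition

variable {X : Type*} [NormedAddCommGroup X] [NormedSpace ℂ X]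

theorem odeSol_ofReal (x : ℝ) (φ : ℝ → ℝ) (b : ℝ) :
    odeSol x (fun u => (φ u : ℂ)) b
      = ((∫ u in (0 : ℝ)..b, Real.exp (-(x * (b - u))) * φ u : ℝ) : ℂ) := by
  rw [← intervalIntegral.integral_ofReal, odeSol]
  simp

theorem odeError_smul_const [CompleteSpace X] (t : ℕ → ℝ) (n : ℕ) (φ : ℝ → ℝ) (a : X) (x : ℝ) :
    odeError rk t n (fun u => φ u • a) x = odeError rk t n (fun u => (φ u : ℂ)) x • a := by
  rw [odeError, odeError, sub_smul]
  congr 1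
  · rw [odeSol_ofReal, odeSol, Complex.coe_smul, ← intervalIntegral.integral_smul_const]
    simp only [smul_smul]
  · simp only [odeApprox, Finset.sum_smul, smul_assoc, Complex.coe_smul]

theorem errorNorm_smul_const [CompleteSpace X] (α : ℝ) (t : ℕ → ℝ) (n : ℕ) (φ : ℝ → ℝ) (a : X) :
    errorNorm α rk t n (fun u => φ u • a)
      = errorNorm α rk t n (fun u => (φ u : ℂ)) * ‖a‖ₑ := by
  simp only [errorNorm, odeError_smul_const, enorm_smul, ← mul_assoc]
  rw [lintegral_mul_const']
  exact enorm_ne_top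

theorem node_mem {p q : ℕ} (h : rk.IsAdmissible p q) {T τ : ℝ} {n : ℕ} {t : ℕ → ℝ}
    (hm : IsPartialMesh T τ n t) {j : ℕ} (h1 : 1 ≤ j) (hj : j ≤ n) (i : Fin (s + 1)) :
    t (j - 1) + rk.c i * step t j ∈ Icc 0 (t n) := by
  have h2 := add_c_mul_mem h (a := t (j - 1)) (hm.step_pos j h1 hj).le i
  rw [sub_add_step] at h2
  exact ⟨(hm.nonneg (by omega : j - 1 ≤ n)).trans h2.1, h2.2.trans (hm.le_of_le hj le_rfl)⟩

variable [CompleteSpace X]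

/-- The error is linear in the source: a time integral, exchanged with the integral over r by
Fubini, minus a finite sum of node values. -/
theorem odeError_integral {p q : ℕ} (h : rk.IsAdmissible p q) {T τ : ℝ} {n : ℕ} {t : ℕ → ℝ}
    (hm : IsPartialMesh T τ n t) {φ : ℝ → ℝ → ℝ} (hφ : Measurable (Function.uncurry φ)) {B : ℝ}
    (hB : ∀ u ∈ Icc 0 (t n), ∀ r ∈ Ioc 0 (t n), |φ u r| ≤ B) {g : ℝ → X}
    (hg : IntegrableOn g (Ioc 0 (t n))) {f : ℝ → X}
    (hf : ∀ u ∈ Icc 0 (t n), f u = ∫ r in Ioc 0 (t n), φ u r • g r) (x : ℝ) :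
    odeError rk t n f x
      = ∫ r in Ioc 0 (t n), odeError rk t n (fun u => (φ u r : ℂ)) x • g r := by
  set b := t n with hb
  have hb0 : 0 ≤ b := hm.last_pos.le
  have hint : ∀ u ∈ Icc 0 b, IntegrableOn (fun r => φ u r • g r) (Ioc 0 b) := fun u hu =>
    Integrable.bdd_smul (𝕜 := ℝ) (φ := fun r => φ u r) hg B (hφ.comp measurable_prodMk_left).aestronglyMeasurable
      ((ae_restrict_iff' measurableSet_Ioc).2 (Eventually.of_forall fun r hr => hB u hu r hr))
  have hprod : Integrable (Function.uncurry fun u r => Real.exp (-(x * (b - u))) • φ u r • g r)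
      ((volume.restrict (Ioc 0 b)).prod (volume.restrict (Ioc 0 b))) := by
    have h1 : Integrable (fun z : ℝ × ℝ => g z.2)
        ((volume.restrict (Ioc 0 b)).prod (volume.restrict (Ioc 0 b))) :=
      Integrable.comp_snd hg _
    have h2 := Integrable.bdd_smul (φ := fun z : ℝ × ℝ => Real.exp (-(x * (b - z.1))) * φ z.1 z.2)
      h1 (Real.exp (|x| * b) * B) ?_ ?_
    · refine h2.congr (Eventually.of_forall fun z => ?_)
      simp [Function.uncurry, smul_smul]
    · refine Measurable.aestronglyMeasurable ?_
      exact (by fun_prop : Measurable fun z : ℝ × ℝ => Real.exp (-(x * (b - z.1)))).mul hφ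
    · rw [Measure.prod_restrict]
      refine (ae_restrict_iff' (measurableSet_Ioc.prod measurableSet_Ioc)).2
        (Eventually.of_forall fun z hz => ?_)
      obtain ⟨hz1, hz2⟩ := hz
      rw [norm_mul, Real.norm_of_nonneg (Real.exp_pos _).le, Real.norm_eq_abs]
      refine mul_le_mul (Real.exp_le_exp.2 ?_) (hB _ ⟨hz1.1.le, hz1.2⟩ _ hz2) (abs_nonneg _)
        (Real.exp_pos _).le
      have h3 : 0 ≤ b - z.1 := sub_nonneg.2 hz1.2
      have h4 := neg_abs_le x
      nlinarith [abs_nonneg x, hz1.1]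
  have hsol : odeSol x f b
      = ∫ r in Ioc 0 b, odeSol x (fun u => (φ u r : ℂ)) b • g r := by
    rw [odeSol, intervalIntegral.integral_of_le hb0]
    have e1 : ∫ u in Ioc 0 b, Real.exp (-(x * (b - u))) • f u
        = ∫ u in Ioc 0 b, ∫ r in Ioc 0 b, Real.exp (-(x * (b - u))) • φ u r • g r := by
      refine setIntegral_congr_fun measurableSet_Ioc fun u hu => ?_
      rw [hf u ⟨hu.1.le, hu.2⟩, integral_smul]
    rw [e1, integral_integral_swap hprod]
    refine integral_congr_ae (Eventually.of_forall fun r => ?_)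
    simp only
    rw [odeSol_ofReal, Complex.coe_smul, intervalIntegral.integral_of_le hb0,
      ← integral_smul_const]
    simp only [smul_smul]
  have happ : odeApprox rk t f n x
      = ∫ r in Ioc 0 b, odeApprox rk t (fun u => (φ u r : ℂ)) n x • g r := by
    simp only [odeApprox, Finset.sum_smul, smul_assoc, Complex.coe_smul]
    rw [integral_finsetSum]
    · refine Finset.sum_congr rfl fun j hj => ?_
      rw [Finset.mem_Icc] at hj
      rw [integral_smul, integral_finsetSum]
      · congr 1
        refine Finset.sum_congr rfl fun i _ => ?_
        rw [integral_smul, hf _ (node_mem h hm hj.1 hj.2 i)]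
      · intro i _
        exact (hint _ (node_mem h hm hj.1 hj.2 i)).smul _
    · intro j hj
      rw [Finset.mem_Icc] at hj
      refine Integrable.smul _ (integrable_finsetSum _ fun i _ => ?_)
      exact (hint _ (node_mem h hm hj.1 hj.2 i)).smul _
  rw [odeError, hsol, happ, ← integral_sub]
  · simp only [odeError, sub_smul]
    rfl
  · have := hprod.integral_prod_right
    refine this.congr (Eventually.of_forall fun r => ?_)
    simp only [Function.uncurry]
    rw [odeSol_ofReal, Complex.coe_smul, intervalIntegral.integral_of_le hb0,
      ← integral_smul_const]
    simp only [smul_smul]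
  · simp only [odeApprox, Finset.sum_smul, smul_assoc, Complex.coe_smul]
    refine integrable_finsetSum _ fun j hj => ?_
    rw [Finset.mem_Icc] at hj
    refine Integrable.smul _ (integrable_finsetSum _ fun i _ => ?_)
    exact (hint _ (node_mem h hm hj.1 hj.2 i)).smul _

theorem measurable_odeError {n : ℕ} {t : ℕ → ℝ} (hn : 0 ≤ t n) {φ : ℝ → ℝ → ℝ}
    (hφ : Measurable (Function.uncurry φ)) :
    Measurable fun z : ℝ × ℝ => odeError rk t n (fun u => (φ u z.2 : ℂ)) z.1 := by
  simp only [odeError]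
  refine Measurable.sub ?_ ?_
  · simp only [odeSol_ofReal, intervalIntegral.integral_of_le hn]
    refine Complex.measurable_ofReal.comp (StronglyMeasurable.measurable ?_)
    refine StronglyMeasurable.integral_prod_right (f := fun (z : ℝ × ℝ) u =>
      Real.exp (-(z.1 * (t n - u))) * φ u z.2) (Measurable.stronglyMeasurable ?_)
    refine Measurable.mul (by fun_prop) ?_
    exact hφ.comp (by fun_prop : Measurable fun w : (ℝ × ℝ) × ℝ => (w.2, w.1.2))
  · simp only [odeApprox, smul_eq_mul]
    have hz : ∀ l, Measurable fun z : ℝ × ℝ => -((step t l * z.1 : ℝ) : ℂ) := fun l => by fun_prop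
    refine Finset.measurable_sum _ fun j _ => Measurable.mul (Measurable.mul ?_ measurable_const) ?_
    · exact Finset.measurable_prod _ fun l _ => RKMethod.measurable_stability.comp (hz l)
    · refine Finset.measurable_sum _ fun i _ => Measurable.mul ?_ ?_
      · exact (RKMethod.measurable_weightRow i).comp (hz j)
      · refine Complex.measurable_ofReal.comp ?_
        exact hφ.comp (by fun_prop : Measurable fun z : ℝ × ℝ => (_, z.2))

/-- Minkowski's integral inequality, by Tonelli. Kernel estimates may then be integrated against the
density g; working with extended nonnegative reals avoids integrability conditions in x. -/
theorem errorNorm_integral_le {p q : ℕ} (h : rk.IsAdmissible p q) {α T τ : ℝ} {n : ℕ} {t : ℕ → ℝ}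
    (hm : IsPartialMesh T τ n t) {φ : ℝ → ℝ → ℝ} (hφ : Measurable (Function.uncurry φ)) {B : ℝ}
    (hB : ∀ u ∈ Icc 0 (t n), ∀ r ∈ Ioc 0 (t n), |φ u r| ≤ B) {g : ℝ → X}
    (hg : IntegrableOn g (Ioc 0 (t n))) {f : ℝ → X}
    (hf : ∀ u ∈ Icc 0 (t n), f u = ∫ r in Ioc 0 (t n), φ u r • g r) :
    errorNorm α rk t n f
      ≤ ∫⁻ r in Ioc 0 (t n), errorNorm α rk t n (fun u => (φ u r : ℂ)) * ‖g r‖ₑ := by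
  have hmeas := measurable_odeError (rk := rk) hm.last_pos.le hφ
  calc errorNorm α rk t n f
      ≤ ∫⁻ x in Ioi (0 : ℝ), ∫⁻ r in Ioc 0 (t n), ENNReal.ofReal (x ^ (-α)) *
          ‖odeError rk t n (fun u => (φ u r : ℂ)) x‖ₑ * ‖g r‖ₑ := by
        refine lintegral_mono fun x => ?_
        simp only [odeError_integral h hm hφ hB hg hf x, mul_assoc]
        rw [lintegral_const_mul' _ _ ENNReal.ofReal_ne_top]
        gcongr
        refine (enorm_integral_le_lintegral_enorm _).trans (le_of_eq ?_)
        simp only [enorm_smul]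
    _ = ∫⁻ r in Ioc 0 (t n), ∫⁻ x in Ioi (0 : ℝ), ENNReal.ofReal (x ^ (-α)) *
          ‖odeError rk t n (fun u => (φ u r : ℂ)) x‖ₑ * ‖g r‖ₑ := by
        refine lintegral_lintegral_swap (AEMeasurable.mul
          (f := fun z : ℝ × ℝ => ENNReal.ofReal (z.1 ^ (-α)) *
            ‖odeError rk t n (fun u => (φ u z.2 : ℂ)) z.1‖ₑ) (g := fun z => ‖g z.2‖ₑ) ?_ ?_)
        · refine Measurable.aemeasurable (Measurable.mul ?_ hmeas.enorm)
          fun_prop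
        · exact (AEStronglyMeasurable.comp_snd hg.aestronglyMeasurable).enorm
    _ = _ := by
        refine lintegral_congr fun r => ?_
        rw [lintegral_mul_const' _ _ enorm_ne_top]
        rfl

end Superposition

end RKgCQ

/-! ### Full order on general meshes: truncated powers, powers and fractional integrals. -/

namespace RKgCQ

open MeasureTheory

variable {s : ℕ} {rk : RKMethod s}

section General

variable {X : Type*} [NormedAddCommGroup X] [NormedSpace ℂ X]

/-- Since 0 ≤ c_i ≤ 1, all nodes lie in [0, t_n], so values outside this interval play no role. -/
theorem odeError_congr {p q : ℕ} (h : rk.IsAdmissible p q) {T τ : ℝ} {n : ℕ} {t : ℕ → ℝ}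
    (hm : IsPartialMesh T τ n t) {f f' : ℝ → X} (hf : EqOn f f' (Icc 0 (t n))) (x : ℝ) :
    odeError rk t n f x = odeError rk t n f' x := by
  rw [odeError, odeError]
  congr 1
  · refine intervalIntegral.integral_congr fun u hu => ?_
    rw [uIcc_of_le hm.last_pos.le] at hu
    simp only [hf hu]
  · refine Finset.sum_congr rfl fun j hj => ?_
    rw [Finset.mem_Icc] at hj
    congr 1
    exact Finset.sum_congr rfl fun i _ => by rw [hf (node_mem h hm hj.1 hj.2 i)]

theorem errorNorm_congr {p q : ℕ} (h : rk.IsAdmissible p q) {α T τ : ℝ} {n : ℕ} {t : ℕ → ℝ}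
    (hm : IsPartialMesh T τ n t) {f f' : ℝ → X} (hf : EqOn f f' (Icc 0 (t n))) :
    errorNorm α rk t n f = errorNorm α rk t n f' := by
  simp only [errorNorm, odeError_congr h hm hf]

theorem intervalIntegrable_exp_smul {f : ℝ → X} {b : ℝ} (hf : IntervalIntegrable f volume 0 b)
    (x : ℝ) : IntervalIntegrable (fun r => Real.exp (-(x * (b - r))) • f r) volume 0 b :=
  hf.continuousOn_smul (by fun_prop)

theorem odeError_add {t : ℕ → ℝ} {n : ℕ} {f f' : ℝ → X}
    (hf : IntervalIntegrable f volume 0 (t n)) (hf' : IntervalIntegrable f' volume 0 (t n))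
    (x : ℝ) : odeError rk t n (fun u => f u + f' u) x
      = odeError rk t n f x + odeError rk t n f' x := by
  have h1 : odeSol x (fun u => f u + f' u) (t n) = odeSol x f (t n) + odeSol x f' (t n) := by
    simp only [odeSol, smul_add]
    exact intervalIntegral.integral_add (intervalIntegrable_exp_smul hf x)
      (intervalIntegrable_exp_smul hf' x)
  have h2 : odeApprox rk t (fun u => f u + f' u) n x
      = odeApprox rk t f n x + odeApprox rk t f' n x := by
    simp only [odeApprox, smul_add, Finset.sum_add_distrib]
  rw [odeError, odeError, odeError, h1, h2]
  abel

theorem aestronglyMeasurable_odeApprox (t : ℕ → ℝ) (n : ℕ) (f : ℝ → X) :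
    AEStronglyMeasurable (odeApprox rk t f n) (volume.restrict (Ioi 0)) := by
  have hz : ∀ l, Measurable fun x : ℝ => -((step t l * x : ℝ) : ℂ) := fun l => by fun_prop
  unfold odeApprox
  refine Finset.aestronglyMeasurable_fun_sum _ fun j _ => ?_
  refine AEStronglyMeasurable.smul ?_ ?_
  · refine Measurable.aestronglyMeasurable (Measurable.mul ?_ measurable_const)
    exact Finset.measurable_prod _ fun l _ => RKMethod.measurable_stability.comp (hz l)
  · refine Finset.aestronglyMeasurable_fun_sum _ fun i _ => ?_
    refine AEStronglyMeasurable.smul_const ?_ _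
    exact ((RKMethod.measurable_weightRow i).comp (hz j)).aestronglyMeasurable

theorem aestronglyMeasurable_odeSol {f : ℝ → X} {b : ℝ} (hb : 0 ≤ b)
    (hf : IntervalIntegrable f volume 0 b) :
    AEStronglyMeasurable (fun x => odeSol x f b) (volume.restrict (Ioi 0)) := by
  simp only [odeSol, intervalIntegral.integral_of_le hb]
  refine AEStronglyMeasurable.integral_prod_right'
    (f := fun z : ℝ × ℝ => Real.exp (-(z.1 * (b - z.2))) • f z.2) ?_
  refine AEStronglyMeasurable.smul (𝕜 := ℝ)
    (f := fun z : ℝ × ℝ => Real.exp (-(z.1 * (b - z.2)))) ?_ ?_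
  · exact (by fun_prop : Continuous fun z : ℝ × ℝ =>
      Real.exp (-(z.1 * (b - z.2)))).aestronglyMeasurable
  · exact AEStronglyMeasurable.comp_snd
      ((intervalIntegrable_iff_integrableOn_Ioc_of_le hb).1 hf).aestronglyMeasurable

theorem aestronglyMeasurable_odeError {t : ℕ → ℝ} {n : ℕ} {f : ℝ → X} (hn : 0 ≤ t n)
    (hf : IntervalIntegrable f volume 0 (t n)) :
    AEStronglyMeasurable (odeError rk t n f) (volume.restrict (Ioi 0)) :=
  (aestronglyMeasurable_odeSol hn hf).sub (aestronglyMeasurable_odeApprox t n f)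

theorem errorNorm_add_le (α : ℝ) {t : ℕ → ℝ} {n : ℕ} {f f' : ℝ → X} (hn : 0 ≤ t n)
    (hf : IntervalIntegrable f volume 0 (t n)) (hf' : IntervalIntegrable f' volume 0 (t n)) :
    errorNorm α rk t n (fun u => f u + f' u)
      ≤ errorNorm α rk t n f + errorNorm α rk t n f' := by
  simp only [errorNorm, odeError_add hf hf']
  rw [← lintegral_add_left']
  · refine lintegral_mono fun x => ?_
    rw [← mul_add]
    gcongr
    exact enorm_add_le _ _
  · refine AEMeasurable.mul ?_ (aestronglyMeasurable_odeError hn hf).enorm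
    fun_prop

theorem errorNorm_zero (α : ℝ) (t : ℕ → ℝ) (n : ℕ) :
    errorNorm α rk t n (fun _ => (0 : X)) = 0 := by
  simp [errorNorm, odeError, odeSol, odeApprox]

theorem errorNorm_sum_le (α : ℝ) {t : ℕ → ℝ} {n : ℕ} {ι : Type*} (S : Finset ι) (F : ι → ℝ → X)
    (hn : 0 ≤ t n) (hF : ∀ i ∈ S, IntervalIntegrable (F i) volume 0 (t n)) :
    errorNorm α rk t n (fun u => ∑ i ∈ S, F i u) ≤ ∑ i ∈ S, errorNorm α rk t n (F i) := by
  classical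
  induction S using Finset.induction_on with
  | empty => simp [errorNorm_zero]
  | insert i S hi ih =>
    simp only [Finset.sum_insert hi]
    refine (errorNorm_add_le α hn (hF i (Finset.mem_insert_self i S)) ?_).trans ?_
    · have := IntervalIntegrable.sum S fun j hj => hF j (Finset.mem_insert_of_mem hj)
      rwa [Finset.sum_fn] at this
    · gcongr
      exact ih fun j hj => hF j (Finset.mem_insert_of_mem hj)

end General

/-- The truncated power `(u - r)₊^e`. -/
noncomputable def truncPow (e r u : ℝ) : ℝ := if r < u then (u - r) ^ e else 0

theorem measurable_truncPow (e : ℝ) : Measurable fun z : ℝ × ℝ => truncPow e z.2 z.1 := by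
  unfold truncPow
  exact Measurable.ite (measurableSet_lt measurable_snd measurable_fst) (by fun_prop)
    measurable_const

theorem measurable_truncMonomial (k : ℕ) :
    Measurable fun z : ℝ × ℝ => truncMonomial k z.2 z.1 := by
  unfold truncMonomial
  exact Measurable.ite (measurableSet_lt measurable_snd measurable_fst) (by fun_prop)
    measurable_const

theorem abs_truncMonomial_le (k : ℕ) {r u b : ℝ} (hr : 0 ≤ r) (hu : u ≤ b) :
    |truncMonomial k r u| ≤ |b| ^ k := by
  unfold truncMonomial
  split_ifs with h
  · rw [abs_of_nonneg (div_nonneg (pow_nonneg (by linarith) _) (by positivity))]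
    refine (div_le_self (pow_nonneg (by linarith) _)
      (by exact_mod_cast Nat.one_le_iff_ne_zero.2 k.factorial_ne_zero)).trans ?_
    exact pow_le_pow_left₀ (by linarith) (by linarith [le_abs_self b]) _
  · simp

theorem abs_truncPow_le {e r u b : ℝ} (he : 0 ≤ e) (hr : 0 ≤ r) (hu : u ≤ b) :
    |truncPow e r u| ≤ |b| ^ e := by
  unfold truncPow
  split_ifs with h
  · rw [abs_of_nonneg (Real.rpow_nonneg (by linarith) _)]
    exact Real.rpow_le_rpow (by linarith) (by linarith [le_abs_self b]) he
  · simp; positivity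

theorem setIntegral_ite_Ioo {X : Type*} [NormedAddCommGroup X] [NormedSpace ℝ X]
    {r b : ℝ} (hr : 0 ≤ r) {u : ℝ} (hub : u ≤ b) (F : ℝ → ℝ → X) :
    ∫ v in Ioc 0 b, (if r < v ∧ v < u then F u v else 0) = ∫ v in Ioo r u, F u v := by
  have h : ∀ v, (if r < v ∧ v < u then F u v else 0) = (Ioo r u).indicator (F u) v := by
    intro v
    simp [indicator, mem_Ioo]
  simp only [h]
  rw [setIntegral_indicator measurableSet_Ioo]
  congr 2
  ext v
  simp only [mem_inter_iff, mem_Ioc, mem_Ioo]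
  exact ⟨fun h => h.2, fun h => ⟨⟨by linarith [h.1], by linarith [h.2]⟩, h⟩⟩

theorem setIntegral_truncPow_smul {X : Type*} [NormedAddCommGroup X] [NormedSpace ℝ X] (δ : ℝ)
    (g : ℝ → X) {u b : ℝ} (hu : u ∈ Icc 0 b) :
    ∫ v in Ioc 0 b, truncPow δ v u • g v = ∫ r in (0 : ℝ)..u, (u - r) ^ δ • g r := by
  have h1 : ∀ v, truncPow δ v u • g v = (Iio u).indicator (fun v => (u - v) ^ δ • g v) v := by
    intro v
    by_cases hv : v < u <;> simp [truncPow, indicator, hv]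
  simp only [h1]
  rw [setIntegral_indicator measurableSet_Iio, intervalIntegral.integral_of_le hu.1,
    integral_Ioc_eq_integral_Ioo]
  congr 2
  ext v
  simp only [mem_inter_iff, mem_Ioc, mem_Iio, mem_Ioo]
  exact ⟨fun h => ⟨h.1.1, h.2⟩, fun h => ⟨⟨h.1, by linarith [h.2, hu.2]⟩, h.2⟩⟩

/-- The semigroup property of fractional integration: a truncated power of exponent δ > k is the
(k+1)-fold integral of one of exponent δ - k - 1 > -1, up to a beta constant. -/
theorem truncPow_eq_integral (k : ℕ) {δ : ℝ} (hδ : (k : ℝ) < δ) {r u b : ℝ} (hr : 0 ≤ r)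
    (hub : u ≤ b) :
    truncPow δ r u = ∫ v in Ioc 0 b, truncMonomial k v u *
      (k.factorial / betaConst k (δ - k - 1) * truncPow (δ - k - 1) r v) := by
  have hB := betaConst_pos (a := k) (e := δ - k - 1) (by linarith [k.cast_nonneg (α := ℝ)])
    (by linarith)
  have h1 : ∀ v, truncMonomial k v u *
      (k.factorial / betaConst k (δ - k - 1) * truncPow (δ - k - 1) r v)
      = if r < v ∧ v < u then
        (betaConst k (δ - k - 1))⁻¹ * ((u - v) ^ (k : ℝ) * (v - r) ^ (δ - k - 1)) else 0 := by
    intro v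
    have hk : (k.factorial : ℝ) ≠ 0 := by positivity
    by_cases h1 : r < v <;> by_cases h2 : v < u <;> simp [truncMonomial, truncPow, h1, h2]
    field_simp
  simp only [h1]
  rw [setIntegral_ite_Ioo hr hub (fun u v => (betaConst k (δ - k - 1))⁻¹ *
    ((u - v) ^ (k : ℝ) * (v - r) ^ (δ - k - 1)))]
  unfold truncPow
  split_ifs with hru
  · rw [← integral_Ioc_eq_integral_Ioo, ← intervalIntegral.integral_of_le hru.le,
      intervalIntegral.integral_const_mul, (beta_scaled (by linarith [k.cast_nonneg (α := ℝ)])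
      (by linarith) hru).2, show (k : ℝ) + (δ - k - 1) + 1 = δ by ring]
    field_simp
  · rw [Ioo_eq_empty hru]; simp

/-- Convolving the kernel bound (t_n - v)^(α-1) with the density (v - r)^(δ-k-1) is a beta integral;
it raises the exponent of t_n - r by δ - k. -/
theorem exists_errorNorm_truncPow_le {k q : ℕ} (h : rk.IsAdmissible (k + 1) q) {α δ T : ℝ}
    (hα₀ : 0 < α) (hα₁ : α < 1) (hT : 0 < T) (hδ : (k : ℝ) ≤ δ) :
    ∃ C : ℝ, 0 < C ∧ ∀ (t : ℕ → ℝ) (n : ℕ) (τ r : ℝ), IsPartialMesh T τ n t → 0 ≤ r → r < t n →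
      errorNorm α rk t n (fun u => (truncPow δ r u : ℂ))
        ≤ ENNReal.ofReal (C * τ ^ min ((k + 1 : ℕ) : ℝ) (q + 1 + α)
          * (t n - r) ^ (α + δ - k - 1)) := by
  obtain ⟨C, hC0, hC⟩ := exists_errorNorm_truncMonomial_le h hα₀ hα₁ hT
  -- For δ = k the density degenerates to a point mass, and the source is itself a multiple of a
  -- truncated monomial.
  rcases hδ.eq_or_lt with rfl | hδ
  · refine ⟨C * k.factorial, by positivity, fun t n τ r hm hr hrn => ?_⟩
    have h1 : (fun u => (truncPow k r u : ℂ))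
        = fun u => truncMonomial k r u • (k.factorial : ℂ) := by
      ext u
      have hk : (k.factorial : ℂ) ≠ 0 := by exact_mod_cast k.factorial_ne_zero
      by_cases h1 : r < u <;> simp [truncPow, truncMonomial, h1]
      field_simp
    rw [h1, errorNorm_smul_const]
    refine (mul_le_mul_left (hC t n τ r hm hr hrn) _).trans (le_of_eq ?_)
    rw [← ofReal_norm, ← ENNReal.ofReal_mul (by
      have := hm.pos
      have : 0 < t n - r := sub_pos.2 hrn
      positivity), RCLike.norm_natCast]
    congr 1
    rw [show α + (k : ℝ) - k - 1 = α - 1 by ring]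
    ring
  set e := δ - k - 1 with he
  set κ := k.factorial / betaConst k e with hκ
  have hB := betaConst_pos (a := k) (e := e) (by linarith [k.cast_nonneg (α := ℝ)]) (by linarith)
  have hκ0 : 0 < κ := by positivity
  have hB' := betaConst_pos (a := α - 1) (e := e) (by linarith) (by linarith)
  refine ⟨C * κ * betaConst (α - 1) e, by positivity, fun t n τ r hm hr hrn => ?_⟩
  have hτ := hm.pos
  have hrb : 0 < t n - r := sub_pos.2 hrn
  have hg : IntegrableOn (fun v => ((κ * truncPow e r v : ℝ) : ℂ)) (Ioc 0 (t n)) := by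
    refine Integrable.ofReal (Integrable.const_mul ?_ _)
    have h1 : truncPow e r = (Ioi r).indicator fun v => (v - r) ^ e := by
      ext v; simp [truncPow, indicator]
    rw [h1, integrable_indicator_iff measurableSet_Ioi, IntegrableOn,
      Measure.restrict_restrict measurableSet_Ioi]
    have h2 : Ioi r ∩ Ioc 0 (t n) = Ioc r (t n) := by
      ext v
      simp only [mem_inter_iff, mem_Ioi, mem_Ioc]
      exact ⟨fun h => ⟨h.1, h.2.2⟩, fun h => ⟨h.1, by linarith [h.1], h.2⟩⟩
    rw [h2]
    have h3 := (intervalIntegral.intervalIntegrable_rpow' (r := e) (by linarith) (a := 0)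
      (b := t n - r)).comp_sub_right r
    simp only [zero_add, sub_add_cancel] at h3
    exact (intervalIntegrable_iff_integrableOn_Ioc_of_le hrn.le).1 h3
  refine (errorNorm_integral_le h hm (φ := fun u v => truncMonomial k v u)
    (measurable_truncMonomial k) (B := |t n| ^ k)
    (fun u hu v hv => abs_truncMonomial_le k hv.1.le hu.2) hg (fun u hu => ?_)).trans ?_
  · rw [truncPow_eq_integral k hδ hr hu.2]
    refine integral_complex_ofReal.symm.trans ?_
    simp [hκ, he]
  calc _ ≤ ∫⁻ v in Ioc 0 (t n), (Ioc r (t n)).indicator (fun v =>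
        ENNReal.ofReal (C * τ ^ min ((k + 1 : ℕ) : ℝ) (q + 1 + α) * κ) *
          ENNReal.ofReal ((t n - v) ^ (α - 1) * (v - r) ^ e)) v := by
        refine lintegral_mono_ae ((ae_restrict_iff' measurableSet_Ioc).2 ?_)
        filter_upwards [volume.ae_ne (t n)] with v hvn hv
        by_cases hrv : r < v
        · have hvn' : v < t n := lt_of_le_of_ne hv.2 hvn
          rw [indicator_of_mem (show v ∈ Ioc r (t n) from ⟨hrv, hv.2⟩)]
          refine (mul_le_mul_left (hC t n τ v hm hv.1.le hvn') _).trans (le_of_eq ?_)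
          have h1 : 0 < v - r := sub_pos.2 hrv
          have h2 : 0 < t n - v := sub_pos.2 hvn'
          rw [← ofReal_norm, Complex.norm_real, Real.norm_of_nonneg
            (mul_nonneg hκ0.le (by simp only [truncPow, if_pos hrv]; positivity)),
            ← ENNReal.ofReal_mul (by positivity), ← ENNReal.ofReal_mul (by positivity)]
          congr 1
          simp only [truncPow, if_pos hrv]
          ring
        · simp [truncPow, hrv]
    _ = ∫⁻ v in Ioc r (t n), ENNReal.ofReal (C * τ ^ min ((k + 1 : ℕ) : ℝ) (q + 1 + α) * κ) *
          ENNReal.ofReal ((t n - v) ^ (α - 1) * (v - r) ^ e) := by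
        rw [setLIntegral_indicator measurableSet_Ioc, inter_eq_left.2]
        exact fun v hv => ⟨by linarith [hv.1], hv.2⟩
    _ = _ := by
        rw [lintegral_const_mul' _ _ ENNReal.ofReal_ne_top, lintegral_beta (by linarith)
          (by linarith) hrn, ← ENNReal.ofReal_mul (by positivity)]
        congr 1
        rw [show α - 1 + e + 1 = α + δ - k - 1 by rw [he]; ring]
        ring

variable {X : Type*} [NormedAddCommGroup X] [NormedSpace ℂ X] [CompleteSpace X]

/-- Powers `u^δ` with `δ ≥ p - α` are integrated with full order on general meshes. -/
theorem exists_errorNorm_rpow_le {k q : ℕ} (h : rk.IsAdmissible (k + 1) q) {α δ T : ℝ}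
    (hα₀ : 0 < α) (hα₁ : α < 1) (hT : 0 < T) (hδ : (k : ℝ) + 1 - α ≤ δ) :
    ∃ C : ℝ, 0 < C ∧ ∀ (t : ℕ → ℝ) (n : ℕ) (τ : ℝ), IsPartialMesh T τ n t →
      errorNorm α rk t n (fun u => ((u ^ δ : ℝ) : ℂ))
        ≤ ENNReal.ofReal (C * τ ^ min ((k + 1 : ℕ) : ℝ) (q + 1 + α)) := by
  obtain ⟨C, hC0, hC⟩ := exists_errorNorm_truncPow_le (δ := δ) h hα₀ hα₁ hT (by linarith)
  -- The power is the truncated power with r = 0. The hypothesis on δ says precisely that the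
  -- exponent of t_n is nonnegative, so that t_n may be replaced by T.
  refine ⟨C * T ^ (α + δ - k - 1), by positivity, fun t n τ hm => ?_⟩
  have hτ := hm.pos
  have hn := hm.last_pos
  have hδ0 : 0 < δ := by linarith [k.cast_nonneg (α := ℝ)]
  rw [errorNorm_congr h hm (f' := fun u => (truncPow δ 0 u : ℂ))]
  · refine (hC t n τ 0 hm le_rfl hn).trans (ENNReal.ofReal_le_ofReal ?_)
    rw [sub_zero, mul_right_comm]
    have : t n ^ (α + δ - k - 1) ≤ T ^ (α + δ - k - 1) :=
      Real.rpow_le_rpow hn.le hm.le (by linarith)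
    gcongr
  · intro u hu
    rcases hu.1.eq_or_lt with rfl | h0
    · simp [truncPow, hδ0.ne']
    · simp [truncPow, h0]

/-- Functions with a continuous (or just bounded) fractional derivative are integrated with full
order on general meshes. -/
theorem exists_errorNorm_convolution_le {k q : ℕ} (h : rk.IsAdmissible (k + 1) q) {α δ T : ℝ}
    (hα₀ : 0 < α) (hα₁ : α < 1) (hT : 0 < T) (hδ : (k : ℝ) ≤ δ) :
    ∃ C : ℝ, 0 < C ∧ ∀ (X : Type*) [NormedAddCommGroup X] [NormedSpace ℂ X] [CompleteSpace X]
      (t : ℕ → ℝ) (n : ℕ) (τ S : ℝ) (g : ℝ → X), IsPartialMesh T τ n t →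
      IntegrableOn g (Ioc 0 (t n)) → (∀ r ∈ Icc 0 (t n), ‖g r‖ ≤ S) →
      errorNorm α rk t n (fun u => ∫ r in (0 : ℝ)..u, (u - r) ^ δ • g r)
        ≤ ENNReal.ofReal (C * τ ^ min ((k + 1 : ℕ) : ℝ) (q + 1 + α) * S) := by
  obtain ⟨C, hC0, hC⟩ := exists_errorNorm_truncPow_le (δ := δ) h hα₀ hα₁ hT hδ
  have hδ0 : 0 ≤ δ := by linarith [k.cast_nonneg (α := ℝ)]
  have hB := betaConst_pos (a := α + δ - k - 1) (e := 0) (by linarith) (by norm_num)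
  -- The exponent α + δ - k - 1 exceeds -1, so the kernel bound is integrable over [0, t_n]; a
  -- bounded density costs only this integral.
  refine ⟨C * (T ^ (α + δ - k) * betaConst (α + δ - k - 1) 0), by positivity,
    fun X _ _ _ t n τ S g hm hg hS => ?_⟩
  have hτ := hm.pos
  have hn := hm.last_pos
  have hS0 : 0 ≤ S := (norm_nonneg _).trans (hS 0 ⟨le_rfl, hn.le⟩)
  refine (errorNorm_integral_le h hm (φ := fun u v => truncPow δ v u)
    (measurable_truncPow δ) (B := |t n| ^ δ)
    (fun u hu v hv => abs_truncPow_le hδ0 hv.1.le hu.2) hg (fun u hu => ?_)).trans ?_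
  · exact (setIntegral_truncPow_smul δ g hu).symm
  calc _ ≤ ∫⁻ v in Ioc 0 (t n), ENNReal.ofReal (C * τ ^ min ((k + 1 : ℕ) : ℝ) (q + 1 + α) * S) *
          ENNReal.ofReal ((t n - v) ^ (α + δ - k - 1) * (v - 0) ^ (0 : ℝ)) := by
        refine lintegral_mono_ae ((ae_restrict_iff' measurableSet_Ioc).2 ?_)
        filter_upwards [volume.ae_ne (t n)] with v hvn hv
        have hvn' : v < t n := lt_of_le_of_ne hv.2 hvn
        have h2 : 0 < t n - v := sub_pos.2 hvn'
        have h3 : ‖g v‖ₑ ≤ ENNReal.ofReal S := by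
          rw [← ofReal_norm]
          exact ENNReal.ofReal_le_ofReal (hS v ⟨hv.1.le, hv.2⟩)
        refine (mul_le_mul' (hC t n τ v hm hv.1.le hvn') h3).trans (le_of_eq ?_)
        rw [← ENNReal.ofReal_mul (by positivity), ← ENNReal.ofReal_mul (by positivity)]
        congr 1
        rw [Real.rpow_zero]
        ring
    _ = ENNReal.ofReal (C * τ ^ min ((k + 1 : ℕ) : ℝ) (q + 1 + α) * S *
        (t n ^ (α + δ - k) * betaConst (α + δ - k - 1) 0)) := by
        rw [lintegral_const_mul' _ _ ENNReal.ofReal_ne_top, lintegral_beta (by linarith)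
          (by norm_num) hn, ← ENNReal.ofReal_mul (by positivity)]
        congr 1
        rw [show α + δ - k - 1 + 0 + 1 = α + δ - k by ring, sub_zero]
    _ ≤ _ := by
        refine ENNReal.ofReal_le_ofReal ?_
        have : t n ^ (α + δ - k) ≤ T ^ (α + δ - k) :=
          Real.rpow_le_rpow hn.le hm.le (by linarith)
        calc _ ≤ C * τ ^ min ((k + 1 : ℕ) : ℝ) (q + 1 + α) * S *
            (T ^ (α + δ - k) * betaConst (α + δ - k - 1) 0) := by gcongr
          _ = _ := by ring

end RKgCQ

/-! ### The test equation with a power as source: derivative bounds and the first step. -/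

namespace RKgCQ

open MeasureTheory

variable {s : ℕ} {rk : RKMethod s}

/-- The derivatives of the solution of `y' = -x y + t^δ`, `y(0) = 0`. -/
noncomputable def powChain (x δ : ℝ) : ℕ → ℝ → ℝ
  | 0 => fun t => ∫ u in (0 : ℝ)..t, Real.exp (-(x * (t - u))) * u ^ δ
  | ℓ + 1 => fun t => -x * powChain x δ ℓ t + (∏ i ∈ Finset.range ℓ, (δ - i)) * t ^ (δ - ℓ)

theorem hasDerivAt_powChain {x δ : ℝ} (hδ : 0 ≤ δ) (ℓ : ℕ) {t : ℝ} (ht : 0 < t) :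
    HasDerivAt (powChain x δ ℓ) (powChain x δ (ℓ + 1) t) t := by
  induction ℓ with
  | zero =>
    have hcont : Continuous fun u : ℝ => Real.exp (x * u) * u ^ δ :=
      (by fun_prop : Continuous fun u : ℝ => Real.exp (x * u)).mul (Real.continuous_rpow_const hδ)
    have h1 : HasDerivAt (fun t => ∫ u in (0 : ℝ)..t, Real.exp (x * u) * u ^ δ)
        (Real.exp (x * t) * t ^ δ) t :=
      intervalIntegral.integral_hasDerivAt_right (hcont.intervalIntegrable _ _)
        (hcont.stronglyMeasurableAtFilter _ _) hcont.continuousAt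
    have h2 := (hasDerivAt_expPrim_zero x t).mul h1
    -- The factor exp(-xt) is taken out of the integral, so that the product rule and the
    -- fundamental theorem apply.
    have h3 : ∀ t, powChain x δ 0 t
        = expPrim x 0 t * ∫ u in (0 : ℝ)..t, Real.exp (x * u) * u ^ δ := by
      intro t
      simp only [powChain, expPrim]
      rw [← intervalIntegral.integral_const_mul]
      refine intervalIntegral.integral_congr fun u _ => ?_
      rw [← mul_assoc, ← Real.exp_add]
      congr 2
      ring
    have h4 : powChain x δ 0 = fun t =>
        expPrim x 0 t * ∫ u in (0 : ℝ)..t, Real.exp (x * u) * u ^ δ := funext h3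
    have h5 : powChain x δ 1 t = -x * powChain x δ 0 t + t ^ δ := by
      simp [powChain]
    rw [h5, h4]
    refine h2.congr_deriv ?_
    simp only [expPrim]
    have h6 : Real.exp (-(x * t)) * (Real.exp (x * t) * t ^ δ) = t ^ δ := by
      rw [← mul_assoc, ← Real.exp_add]; simp
    rw [h6]
    ring
  | succ ℓ ih =>
    have h1 := (ih.const_mul (-x)).add
      ((Real.hasDerivAt_rpow_const (p := δ - ℓ) (Or.inl ht.ne')).const_mul
        (∏ i ∈ Finset.range ℓ, (δ - i)))
    refine h1.congr_deriv ?_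
    have h2 : powChain x δ (ℓ + 1 + 1) t = -x * powChain x δ (ℓ + 1) t
      + (∏ i ∈ Finset.range (ℓ + 1), (δ - i)) * t ^ (δ - (ℓ + 1 : ℕ)) := rfl
    rw [h2, Finset.prod_range_succ]
    push_cast
    rw [sub_sub]
    ring

theorem abs_powChain_zero_le {x δ : ℝ} (hx : 0 ≤ x) (hδ : 0 ≤ δ) {t : ℝ} (ht : 0 ≤ t) :
    |powChain x δ 0 t| ≤ t ^ (δ + 1) := by
  have h := intervalIntegral.norm_integral_le_of_norm_le_const (a := 0) (b := t) (C := t ^ δ)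
    (f := fun u => Real.exp (-(x * (t - u))) * u ^ δ) fun u hu => by
      rw [uIoc_of_le ht] at hu
      rw [norm_mul, Real.norm_of_nonneg (Real.exp_pos _).le,
        Real.norm_of_nonneg (Real.rpow_nonneg hu.1.le _)]
      have h1 : Real.exp (-(x * (t - u))) ≤ 1 := by
        rw [Real.exp_le_one_iff]
        have := mul_nonneg hx (sub_nonneg.2 hu.2)
        linarith
      calc _ ≤ 1 * t ^ δ := by
            gcongr
            · exact Real.rpow_nonneg hu.1.le _
            · exact hu.1.le
            · exact hu.2
        _ = t ^ δ := one_mul _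
  rw [sub_zero, abs_of_nonneg ht, Real.norm_eq_abs] at h
  rcases ht.eq_or_lt with rfl | ht
  · rw [mul_zero] at h
    exact h.trans (by positivity)
  · rwa [Real.rpow_add_one ht.ne']

/-- Direct iteration of the differential equation. Each derivative costs a factor x, recorded as 1 +
xt; these factors are removed in the next estimate. -/
theorem exists_abs_powChain_le_crude {δ : ℝ} (hδ : 0 ≤ δ) (ℓ : ℕ) :
    ∃ K : ℝ, 0 < K ∧ ∀ x t : ℝ, 0 ≤ x → 0 < t →
      |powChain x δ ℓ t| ≤ K * t ^ (δ + 1 - ℓ) * (1 + x * t) ^ ℓ := by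
  induction ℓ with
  | zero =>
    refine ⟨1, one_pos, fun x t hx ht => ?_⟩
    simpa using abs_powChain_zero_le hx hδ ht.le
  | succ ℓ ih =>
    obtain ⟨K, hK0, hK⟩ := ih
    set c := ∏ i ∈ Finset.range ℓ, (δ - i) with hc
    refine ⟨K + |c|, by positivity, fun x t hx ht => ?_⟩
    have h1 : t ^ (δ + 1 - ℓ) = t ^ (δ - ℓ) * t := by
      rw [← Real.rpow_add_one ht.ne']; congr 1; ring
    have h2 : t ^ (δ + 1 - ((ℓ + 1 : ℕ) : ℝ)) = t ^ (δ - ℓ) := by congr 1; push_cast; ring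
    have h3 : 1 ≤ (1 + x * t) ^ (ℓ + 1) := one_le_pow₀ (by nlinarith [mul_nonneg hx ht.le])
    have hxt : 0 ≤ x * t := mul_nonneg hx ht.le
    have h4 : powChain x δ (ℓ + 1) t = -x * powChain x δ ℓ t + c * t ^ (δ - ℓ) := rfl
    rw [h4, h2]
    have hp : 0 < t ^ (δ - ℓ) := by positivity
    calc _ ≤ x * |powChain x δ ℓ t| + |c| * t ^ (δ - ℓ) := by
          refine (abs_add_le _ _).trans ?_
          rw [abs_mul, abs_mul, abs_neg, abs_of_nonneg hx, abs_of_pos hp]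
      _ ≤ x * (K * t ^ (δ + 1 - ℓ) * (1 + x * t) ^ ℓ) + |c| * t ^ (δ - ℓ) := by
          gcongr; exact hK x t hx ht
      _ = K * t ^ (δ - ℓ) * ((x * t) * (1 + x * t) ^ ℓ) + |c| * t ^ (δ - ℓ) * 1 := by
          rw [h1]; ring
      _ ≤ K * t ^ (δ - ℓ) * ((1 + x * t) * (1 + x * t) ^ ℓ)
          + |c| * t ^ (δ - ℓ) * (1 + x * t) ^ (ℓ + 1) := by
          gcongr
          linarith
      _ = _ := by ring

theorem rpow_le_two_rpow_mul {e t u : ℝ} (ht : 0 < t) (h1 : t / 2 ≤ u) (h2 : u ≤ t) :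
    u ^ e ≤ 2 ^ |e| * t ^ e := by
  have hu : 0 < u := by linarith
  have h2e : (1 : ℝ) ≤ 2 ^ |e| := Real.one_le_rpow (by norm_num) (abs_nonneg e)
  rcases le_total 0 e with he | he
  · calc u ^ e ≤ t ^ e := Real.rpow_le_rpow hu.le h2 he
      _ ≤ _ := le_mul_of_one_le_left (by positivity) h2e
  · calc u ^ e ≤ (t / 2) ^ e := Real.rpow_le_rpow_of_nonpos (by linarith) h1 he
      _ = _ := by
        rw [Real.div_rpow ht.le (by norm_num), abs_of_nonpos he, Real.rpow_neg (by norm_num)]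
        field_simp

/-- The ℓ-th derivative solves y' = -x y + c t^(δ-ℓ). Solving this equation from t/2 to t damps the
crude bound at t/2 by exp(-xt/2), which absorbs any power of 1 + xt/2; on [t/2, t] all powers of the
time variable are comparable. -/
theorem exists_abs_powChain_le {δ : ℝ} (hδ : 0 ≤ δ) (ℓ : ℕ) :
    ∃ K : ℝ, 0 < K ∧ ∀ x t : ℝ, 0 ≤ x → 0 < t → |powChain x δ ℓ t| ≤ K * t ^ (δ + 1 - ℓ) := by
  obtain ⟨K, hK0, hK⟩ := exists_abs_powChain_le_crude hδ ℓ
  set c := ∏ i ∈ Finset.range ℓ, (δ - i) with hc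
  refine ⟨K * 2 ^ |δ + 1 - ℓ| * (ℓ.factorial * Real.exp 1) + |c| * 2 ^ |δ - ℓ|, by positivity,
    fun x t hx ht => ?_⟩
  have ht2 : 0 < t / 2 := by linarith
  set V : ℝ → ℝ := fun u => Real.exp (x * u) * powChain x δ ℓ u with hV
  have hVd : ∀ u ∈ Icc (t / 2) t, HasDerivWithinAt V (Real.exp (x * u) * (c * u ^ (δ - ℓ)))
      (Icc (t / 2) t) u := by
    intro u hu
    have h1 : HasDerivAt (fun u => Real.exp (x * u)) (Real.exp (x * u) * x) u := by
      have := ((hasDerivAt_id u).const_mul x).exp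
      simpa using this
    have h2 := h1.mul (hasDerivAt_powChain (x := x) hδ ℓ (ht2.trans_le hu.1))
    refine (h2.congr_deriv ?_).hasDerivWithinAt
    simp only [powChain, ← hc]
    ring
  have hVb : ∀ u ∈ Icc (t / 2) t, ‖Real.exp (x * u) * (c * u ^ (δ - ℓ))‖
      ≤ Real.exp (x * t) * (|c| * (2 ^ |δ - ℓ| * t ^ (δ - ℓ))) := by
    intro u hu
    have hu0 : 0 < u := ht2.trans_le hu.1
    rw [norm_mul, norm_mul, Real.norm_of_nonneg (Real.exp_pos _).le, Real.norm_eq_abs,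
      Real.norm_of_nonneg (Real.rpow_nonneg hu0.le _)]
    gcongr
    · exact hu.2
    · exact rpow_le_two_rpow_mul ht hu.1 hu.2
  have hdiff := (convex_Icc (t / 2) t).norm_image_sub_le_of_norm_hasDerivWithin_le hVd hVb
    (left_mem_Icc.2 (by linarith)) (right_mem_Icc.2 (by linarith))
  have h3 : ‖t - t / 2‖ ≤ t := by
    rw [Real.norm_of_nonneg (by linarith)]; linarith
  have h4 : t ^ (δ - ℓ) * t = t ^ (δ + 1 - ℓ) := by
    rw [← Real.rpow_add_one ht.ne']; congr 1; ring
  have hdiff' : |V t - V (t / 2)| ≤ Real.exp (x * t) * (|c| * 2 ^ |δ - ℓ| * t ^ (δ + 1 - ℓ)) := by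
    rw [Real.norm_eq_abs] at hdiff
    refine hdiff.trans ((mul_le_mul_of_nonneg_left h3 (by positivity)).trans (le_of_eq ?_))
    rw [← h4]; ring
  have hV2 : |V (t / 2)| ≤ Real.exp (x * t) *
      (K * 2 ^ |δ + 1 - ℓ| * (ℓ.factorial * Real.exp 1) * t ^ (δ + 1 - ℓ)) := by
    simp only [hV]
    rw [abs_mul, abs_of_pos (Real.exp_pos _)]
    have h5 := hK x (t / 2) hx ht2
    -- One term of the exponential series at w = 1 + xt/2: w^ℓ ≤ ℓ! exp(w).
    have h6 : (1 + x * (t / 2)) ^ ℓ ≤ ℓ.factorial * Real.exp 1 * Real.exp (x * (t / 2)) := by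
      have h7 := Real.pow_div_factorial_le_exp (1 + x * (t / 2)) (by positivity) ℓ
      rw [div_le_iff₀ (by positivity), Real.exp_add] at h7
      linarith
    have h8 := rpow_le_two_rpow_mul (e := δ + 1 - ℓ) ht le_rfl (by linarith)
    have h9 : Real.exp (x * t) = Real.exp (x * (t / 2)) * Real.exp (x * (t / 2)) := by
      rw [← Real.exp_add]; congr 1; ring
    calc _ ≤ Real.exp (x * (t / 2)) * (K * (2 ^ |δ + 1 - ℓ| * t ^ (δ + 1 - ℓ)) *
          (ℓ.factorial * Real.exp 1 * Real.exp (x * (t / 2)))) := by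
          gcongr
          exact h5.trans (by gcongr)
      _ = _ := by rw [h9]; ring
  have h10 : Real.exp (x * t) * |powChain x δ ℓ t| = |V t| := by
    simp only [hV]
    rw [abs_mul, abs_of_pos (Real.exp_pos _)]
  have h11 : |V t| ≤ |V t - V (t / 2)| + |V (t / 2)| := by
    have := abs_add_le (V t - V (t / 2)) (V (t / 2))
    simpa using this
  refine le_of_mul_le_mul_left ?_ (Real.exp_pos (x * t))
  rw [h10]
  refine h11.trans ((add_le_add hdiff' hV2).trans (le_of_eq ?_))
  ring

/-- The differential equation expresses x times the ℓ-th derivative through t^(δ-ℓ) and the next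
derivative, and the latter is already bounded by the same power. -/
theorem exists_abs_powChain_le_div {δ : ℝ} (hδ : 0 ≤ δ) (ℓ : ℕ) :
    ∃ K : ℝ, 0 < K ∧ ∀ x t : ℝ, 0 < x → 0 < t → |powChain x δ ℓ t| ≤ K * (t ^ (δ - ℓ) / x) := by
  obtain ⟨K, hK0, hK⟩ := exists_abs_powChain_le hδ (ℓ + 1)
  set c := ∏ i ∈ Finset.range ℓ, (δ - i) with hc
  refine ⟨K + |c|, by positivity, fun x t hx ht => ?_⟩
  have h1 := hK x t hx.le ht
  have h2 : t ^ (δ + 1 - ((ℓ + 1 : ℕ) : ℝ)) = t ^ (δ - ℓ) := by congr 1; push_cast; ring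
  have h3 : x * powChain x δ ℓ t = c * t ^ (δ - ℓ) - powChain x δ (ℓ + 1) t := by
    simp only [powChain, ← hc]; ring
  rw [h2] at h1
  have hp : 0 < t ^ (δ - ℓ) := by positivity
  rw [← mul_div_assoc, le_div_iff₀ hx, mul_comm, ← abs_of_pos hx, ← abs_mul, abs_of_pos hx, h3]
  have h4 := abs_sub (c * t ^ (δ - ℓ)) (powChain x δ (ℓ + 1) t)
  rw [abs_mul, abs_of_pos hp] at h4
  linarith

theorem exists_abs_powChain_le_uniform {δ : ℝ} (hδ : 0 ≤ δ) (L : ℕ) :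
    ∃ K : ℝ, 0 < K ∧ ∀ ℓ ≤ L, ∀ x t : ℝ, 0 < x → 0 < t →
      |powChain x δ ℓ t| ≤ K * t ^ (δ + 1 - ℓ) ∧ |powChain x δ ℓ t| ≤ K * (t ^ (δ - ℓ) / x) := by
  choose K₁ hK₁0 hK₁ using exists_abs_powChain_le hδ
  choose K₂ hK₂0 hK₂ using exists_abs_powChain_le_div hδ
  have hsum : ∀ ℓ ≤ L, K₁ ℓ + K₂ ℓ ≤ ∑ ℓ ∈ Finset.range (L + 1), (K₁ ℓ + K₂ ℓ) := fun ℓ hℓ =>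
    Finset.single_le_sum (f := fun ℓ => K₁ ℓ + K₂ ℓ)
      (fun i _ => (add_pos (hK₁0 i) (hK₂0 i)).le) (Finset.mem_range.2 (by omega))
  refine ⟨∑ ℓ ∈ Finset.range (L + 1), (K₁ ℓ + K₂ ℓ), ?_, fun ℓ hℓ x t hx ht => ?_⟩
  · exact (add_pos (hK₁0 0) (hK₂0 0)).trans_le (hsum 0 (Nat.zero_le _))
  · have := hsum ℓ hℓ
    have h1 := hK₁0 ℓ
    have h2 := hK₂0 ℓ
    constructor
    · refine (hK₁ ℓ x t hx.le ht).trans ?_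
      gcongr
      linarith
    · refine (hK₂ ℓ x t hx ht).trans ?_
      gcongr
      linarith

/-- The contribution of the first step. -/
theorem exists_stepDefect_rpow_first_le {p q : ℕ} (h : rk.IsAdmissible p q) {δ T : ℝ}
    (hδ : (q : ℝ) + 1 ≤ δ) :
    ∃ C : ℝ, 0 < C ∧ ∀ τ τ' x : ℝ, 0 < τ → τ ≤ τ' → τ' ≤ T → 0 < x →
      ‖stepDefect rk 0 τ x (fun u => (powChain x δ 0 u : ℂ)) (fun u => ((u ^ δ : ℝ) : ℂ))‖
        ≤ C / (1 + τ * x) * (τ' ^ (q + 2) * min 1 (τ' * x)⁻¹) := by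
  have hδ1 : 1 ≤ δ := by linarith [q.cast_nonneg (α := ℝ)]
  have hδ0 : 0 ≤ δ := by linarith
  obtain ⟨C, hC0, hC⟩ := exists_stepDefect_le_of_norm_le h
  obtain ⟨K, hK0, hK⟩ := exists_abs_powChain_le_uniform hδ0 1
  set T₁ := max 1 T ^ (δ - (q + 1 : ℕ)) with hT₁
  have hT₁0 : 0 < T₁ := by positivity
  refine ⟨C * (K * T₁), by positivity, fun τ τ' x hτ hττ' hT hx => ?_⟩
  have hτ' : 0 < τ' := hτ.trans_le hττ'
  -- The derivatives used in Taylor's formula may be singular at 0, so the crude defect bound is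
  -- used. The two bounds on the solution, and likewise on its derivative, combine into a factor
  -- min(τ', 1/x) = τ' min(1, 1/(τ'x)).
  have hmin : ∀ u, 0 < u → u ≤ τ' → ∀ y e : ℝ, 0 ≤ e → |y| ≤ K * u ^ (e + 1) →
      |y| ≤ K * (u ^ e / x) → |y| ≤ K * (u ^ e * (τ' * min 1 (τ' * x)⁻¹)) := by
    intro u hu huτ y e he h1 h2
    have h3 : τ' * min 1 (τ' * x)⁻¹ = min τ' x⁻¹ := by
      rw [mul_min_of_nonneg _ _ hτ'.le, mul_one, mul_inv, mul_inv_cancel_left₀ hτ'.ne']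
    rw [h3, mul_min_of_nonneg _ _ (by positivity), mul_min_of_nonneg _ _ hK0.le]
    refine le_min (h1.trans ?_) (h2.trans (le_of_eq (by rw [div_eq_mul_inv])))
    rw [Real.rpow_add_one hu.ne']
    gcongr
  set m := τ' * min 1 (τ' * x)⁻¹ with hm
  have hm0 : 0 < m := by positivity
  have hy0 : powChain x δ 0 0 = 0 := by simp [powChain]
  have hδ1' : δ - 1 + 1 = δ := by ring
  have h1 := hC 0 τ x (K * (τ ^ (δ - 1) * m)) (fun u => (powChain x δ 0 u : ℂ))
    (fun u => ((u ^ δ : ℝ) : ℂ)) hτ.le hx.le (fun u hu => by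
      rw [Complex.norm_real, Real.norm_eq_abs]
      have e1 : τ * (K * (τ ^ (δ - 1) * m)) = K * (τ ^ δ * m) := by
        rw [← hδ1', Real.rpow_add_one hτ.ne', hδ1']; ring
      rw [e1]
      rw [zero_add] at hu
      rcases hu.1.eq_or_lt with h0 | h0
      · rw [← h0, hy0, abs_zero]; positivity
      · have h2 := hK 0 (by norm_num) x u hx h0
        simp only [Nat.cast_zero, sub_zero] at h2
        refine (hmin u h0 (hu.2.trans hττ') _ δ hδ0 h2.1 h2.2).trans ?_
        gcongr
        exact hu.2) (fun u hu => by
      rw [zero_add] at hu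
      have e2 : -(x : ℂ) * (powChain x δ 0 u : ℂ) + ((u ^ δ : ℝ) : ℂ) = (powChain x δ 1 u : ℝ) := by
        simp [powChain]
      rw [e2, Complex.norm_real, Real.norm_eq_abs]
      rcases hu.1.eq_or_lt with h0 | h0
      · have : powChain x δ 1 0 = 0 := by
          simp [powChain, Real.zero_rpow (by linarith : δ ≠ 0)]
        rw [← h0, this, abs_zero]; positivity
      · have h2 := hK 1 le_rfl x u hx h0
        simp only [Nat.cast_one] at h2
        refine (hmin u h0 (hu.2.trans hττ') _ (δ - 1) (by linarith)
          (by rw [hδ1']; simpa using h2.1) h2.2).trans ?_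
        gcongr
        exact hu.2)
  refine h1.trans ?_
  have h2 : τ * (K * (τ ^ (δ - 1) * m)) ≤ K * T₁ * (τ' ^ (q + 2) * min 1 (τ' * x)⁻¹) := by
    have e1 : τ * (K * (τ ^ (δ - 1) * m)) = K * (τ ^ δ * m) := by
      rw [← hδ1', Real.rpow_add_one hτ.ne', hδ1']; ring
    rw [e1]
    have e2 : τ ^ δ ≤ T₁ * τ' ^ (q + 1) := by
      calc τ ^ δ ≤ τ' ^ δ := Real.rpow_le_rpow hτ.le hττ' hδ0
        _ ≤ T₁ * τ' ^ ((q + 1 : ℕ) : ℝ) :=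
          rpow_le_mul_rpow hτ' hT (by push_cast; linarith)
        _ = _ := by rw [Real.rpow_natCast]
    calc K * (τ ^ δ * m) ≤ K * (T₁ * τ' ^ (q + 1) * m) := by gcongr
      _ = _ := by rw [hm]; ring
  calc C * (τ * (K * (τ ^ (δ - 1) * m)) / (1 + τ * x))
      = C / (1 + τ * x) * (τ * (K * (τ ^ (δ - 1) * m))) := by ring
    _ ≤ C / (1 + τ * x) * (K * T₁ * (τ' ^ (q + 2) * min 1 (τ' * x)⁻¹)) := by gcongr
    _ = _ := by ring

end RKgCQ

/-! ### Full order for powers on quasi-uniform meshes. -/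

namespace RKgCQ

open MeasureTheory

variable {s : ℕ} {rk : RKMethod s}

/-- The product is a^(δ-q-1) (τ/a)^(ℓ-q-1-α) τ^(q+1+α) a^(-α). The first factor is bounded since δ ≥
q + 1, the second since τ ≤ κa. The power a^(-α) is what remains to be paired with (t_n - a)^(α-1)
in a beta integral. -/
theorem pow_mul_rpow_sub_le {p q ℓ : ℕ} {α δ κ T τ τ' a : ℝ} (hα₀ : 0 < α) (hα₁ : α < 1)
    (hδ : (q : ℝ) + 1 ≤ δ) (hτ : 0 < τ) (hττ' : τ ≤ τ') (ha : 0 < a) (haT : a ≤ T) (hκ : 1 ≤ κ)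
    (hτa : τ ≤ κ * a) (hq : q + 2 ≤ ℓ) (hp : ℓ ≤ p) :
    τ ^ ℓ * a ^ (δ - ℓ) ≤ max 1 T ^ (δ - (q + 1)) *
      (κ ^ ((p : ℝ) - q - 1 - α) * (τ' ^ ((q : ℝ) + 1 + α) * a ^ (-α))) := by
  have hq' : (q : ℝ) + 2 ≤ ℓ := by exact_mod_cast hq
  have hp' : (ℓ : ℝ) ≤ p := by exact_mod_cast hp
  have h1 : (τ / a) ^ ((ℓ : ℝ) - q - 1 - α) ≤ κ ^ ((p : ℝ) - q - 1 - α) := by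
    calc _ ≤ κ ^ ((ℓ : ℝ) - q - 1 - α) := by
          refine Real.rpow_le_rpow (by positivity) ((div_le_iff₀ ha).2 hτa) (by linarith)
      _ ≤ _ := Real.rpow_le_rpow_of_exponent_le hκ (by linarith)
  have h2 : a ^ (δ - (q + 1)) ≤ max 1 T ^ (δ - (q + 1)) :=
    Real.rpow_le_rpow ha.le (haT.trans (le_max_right _ _)) (by linarith)
  have h3 : τ ^ ((q : ℝ) + 1 + α) ≤ τ' ^ ((q : ℝ) + 1 + α) :=
    Real.rpow_le_rpow hτ.le hττ' (by positivity)
  have h4 : τ ^ ℓ * a ^ (δ - ℓ) = a ^ (δ - (q + 1)) *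
      ((τ / a) ^ ((ℓ : ℝ) - q - 1 - α) * (τ ^ ((q : ℝ) + 1 + α) * a ^ (-α))) := by
    rw [Real.div_rpow hτ.le ha.le, div_eq_mul_inv, ← Real.rpow_neg ha.le]
    have e1 : τ ^ ℓ = τ ^ ((ℓ : ℝ) - q - 1 - α) * τ ^ ((q : ℝ) + 1 + α) := by
      rw [← Real.rpow_add hτ, ← Real.rpow_natCast]; congr 1; ring
    have e2 : a ^ (δ - ℓ) = a ^ (δ - (q + 1)) * a ^ (-((ℓ : ℝ) - q - 1 - α)) * a ^ (-α) := by
      rw [← Real.rpow_add ha, ← Real.rpow_add ha]; congr 1; ring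
    rw [e1, e2]
    ring
  rw [h4]
  gcongr

/-- The contribution of the steps after the first one. -/
theorem exists_stepDefect_rpow_le {p q : ℕ} (h : rk.IsAdmissible p q) {α δ T : ℝ} (hα₀ : 0 < α)
    (hα₁ : α < 1) (hpq : q + 2 ≤ p) (hδ : (q : ℝ) + 1 ≤ δ) (hδp : δ ≤ p) :
    ∃ C : ℝ, 0 < C ∧ ∀ a τ τ' x κ : ℝ, 0 < a → a ≤ T → 0 < τ → τ ≤ τ' → τ' ≤ T → 0 < x → 1 ≤ κ →
      τ ≤ κ * a →
      ‖stepDefect rk a τ x (fun u => (powChain x δ 0 u : ℂ)) (fun u => ((u ^ δ : ℝ) : ℂ))‖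
        ≤ C / (1 + τ * x) * (τ * stageTerm p q τ' x +
          τ * (κ ^ ((p : ℝ) - q - 1 - α) * (τ' ^ ((q : ℝ) + 1 + α) * a ^ (-α)))) := by
  have hδ0 : 0 ≤ δ := by linarith [q.cast_nonneg (α := ℝ)]
  obtain ⟨C, hC0, hC⟩ := exists_stepDefect_le h
  obtain ⟨K, hK0, hK⟩ := exists_abs_powChain_le_uniform hδ0 (p + 1)
  set T₁ := max 1 T with hT₁
  set T₂ := max 1 T ^ (δ - (q + 1)) with hT₂
  have hT₂0 : 0 < T₂ := by positivity
  set B := K * (T₁ ^ p * T₂ + T₂) with hB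
  refine ⟨C * (p * B + B), by positivity, fun a τ τ' x κ ha haT hτ hττ' hτ'T hx hκ hτa => ?_⟩
  set F := κ ^ ((p : ℝ) - q - 1 - α) * (τ' ^ ((q : ℝ) + 1 + α) * a ^ (-α)) with hF
  have hτ' : 0 < τ' := hτ.trans_le hττ'
  have hF0 : 0 < F := by positivity
  have hE := stageTerm_nonneg (p := p) (q := q) hτ'.le hx.le
  have hz : 0 < τ * x := by positivity
  -- The full Taylor length p is used. Since δ ≤ p, the bound on the derivative of order p + 1 is
  -- largest at the left endpoint.
  have h1 := hC p a τ x (K * a ^ (δ - p)) (fun u => ((u ^ δ : ℝ) : ℂ))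
    (fun ℓ u => (powChain x δ ℓ u : ℂ)) le_rfl hτ.le hx.le
    (fun ℓ _ u hu => ((hasDerivAt_powChain hδ0 ℓ (ha.trans_le hu.1)).ofReal_comp).hasDerivWithinAt)
    (fun u _ => by simp [powChain])
    (fun u hu => by
      rw [Complex.norm_real, Real.norm_eq_abs]
      refine ((hK (p + 1) le_rfl x u hx (ha.trans_le hu.1)).1).trans ?_
      rw [show δ + 1 - ((p + 1 : ℕ) : ℝ) = δ - p by push_cast; ring]
      exact mul_le_mul_of_nonneg_left
        (Real.rpow_le_rpow_of_nonpos ha hu.1 (by linarith)) hK0.le)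
  refine h1.trans ?_
  set R := τ * stageTerm p q τ' x + τ * F with hR
  have hR0 : 0 ≤ R := by positivity
  have hB0 : 0 < B := by positivity
  have hpow : ∀ ℓ, q + 2 ≤ ℓ → ℓ ≤ p → τ ^ ℓ * a ^ (δ - ℓ) ≤ T₂ * F := fun ℓ h2 h3 =>
    pow_mul_rpow_sub_le hα₀ hα₁ hδ hτ hττ' ha haT hκ hτa h2 h3
  have hRF : τ * F ≤ R := le_add_of_nonneg_left (by positivity)
  have hRE : τ * stageTerm p q τ' x ≤ R := le_add_of_nonneg_right (by positivity)
  have hBT : K * T₂ ≤ B := by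
    rw [hB]; gcongr; exact le_add_of_nonneg_left (by positivity)
  have hBT' : K * (T₁ ^ p * T₂) ≤ B := by
    rw [hB]; gcongr; exact le_add_of_nonneg_right (by positivity)
  have hterm : ∀ ℓ ∈ Finset.Icc (q + 1) p, τ ^ ℓ *
      (min 1 (τ * x) ^ (p + 1 - ℓ) / (1 + τ * x)) * ‖(powChain x δ ℓ a : ℂ)‖
      ≤ B * R / (1 + τ * x) := by
    intro ℓ hℓ
    rw [Finset.mem_Icc] at hℓ
    rw [Complex.norm_real, Real.norm_eq_abs]
    have h2 := (hK ℓ (by omega) x a hx ha).2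
    calc _ ≤ τ ^ ℓ * (min 1 (τ * x) ^ (p + 1 - ℓ) / (1 + τ * x)) * (K * (a ^ (δ - ℓ) / x)) := by
          gcongr
      _ ≤ _ := ?_
    -- The term ℓ = q + 1 has at least two powers of min(1, τx) and a bounded power of a, and gives
    -- the stage part. In the terms ℓ ≥ q + 2, one power of min(1, τx) is spent on cancelling 1/x.
    rcases Nat.eq_or_lt_of_le hℓ.1 with heq | hlt
    · have h3 := pow_mul_min_pow_le (p := p) (q := q) (ℓ := ℓ) hτ.le hττ' hτ'T hx hℓ.1 (by omega)
      have h4 : a ^ (δ - ℓ) ≤ T₂ := by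
        rw [← heq, hT₂]
        push_cast
        exact Real.rpow_le_rpow ha.le (haT.trans (le_max_right _ _)) (by linarith)
      calc _ = K * (τ ^ ℓ * min 1 (τ * x) ^ (p + 1 - ℓ) / x) * a ^ (δ - ℓ) / (1 + τ * x) := by ring
        _ ≤ K * (T₁ ^ p * (τ * stageTerm p q τ' x)) * T₂ / (1 + τ * x) := by gcongr
        _ = K * (T₁ ^ p * T₂) * (τ * stageTerm p q τ' x) / (1 + τ * x) := by ring
        _ ≤ _ := by gcongr
    · have h3 : min 1 (τ * x) ^ (p + 1 - ℓ) ≤ τ * x := by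
        calc _ ≤ min 1 (τ * x) ^ 1 :=
              pow_le_pow_of_le_one (by positivity) (min_le_left _ _) (by omega)
          _ ≤ _ := by rw [pow_one]; exact min_le_right _ _
      have h4 := hpow ℓ hlt hℓ.2
      calc _ ≤ τ ^ ℓ * (τ * x / (1 + τ * x)) * (K * (a ^ (δ - ℓ) / x)) := by gcongr
        _ = K * τ * (τ ^ ℓ * a ^ (δ - ℓ)) / (1 + τ * x) := by field_simp
        _ ≤ K * τ * (T₂ * F) / (1 + τ * x) := by gcongr
        _ = K * T₂ * (τ * F) / (1 + τ * x) := by ring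
        _ ≤ _ := by gcongr
  have hsum := Finset.sum_le_card_nsmul _ _ _ hterm
  rw [nsmul_eq_mul, Nat.card_Icc] at hsum
  have hcard : ((p + 1 - (q + 1) : ℕ) : ℝ) ≤ p := by exact_mod_cast (by omega)
  have hrem : τ ^ (p + 1) * (K * a ^ (δ - p)) / (1 + τ * x) ≤ B * R / (1 + τ * x) := by
    calc _ = K * τ * (τ ^ p * a ^ (δ - p)) / (1 + τ * x) := by ring
      _ ≤ K * τ * (T₂ * F) / (1 + τ * x) := by have := hpow p hpq le_rfl; gcongr
      _ = K * T₂ * (τ * F) / (1 + τ * x) := by ring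
      _ ≤ _ := by gcongr
  calc _ ≤ C * (p * (B * R / (1 + τ * x)) + B * R / (1 + τ * x)) := by
        gcongr
        exact hsum.trans (by gcongr)
    _ = _ := by ring

/-- A Riemann sum for the beta integral. -/
theorem sum_rpow_mul_rpow_le {T τ α κ : ℝ} {n : ℕ} {t : ℕ → ℝ} (hm : IsPartialMesh T τ n t)
    (hα₀ : 0 < α) (hα₁ : α < 1) (hκ : 0 ≤ κ)
    (hratio : ∀ j, 2 ≤ j → j ≤ n → step t j ≤ κ * step t (j - 1)) :
    ∑ j ∈ Finset.Icc 2 n, step t j * (t (j - 1) ^ (-α) * (t n - t (j - 1)) ^ (α - 1))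
      ≤ (1 + κ) ^ α * betaConst (α - 1) (-α) := by
  obtain ⟨hint, hval⟩ := beta_scaled (a := α - 1) (e := -α) (by linarith) (by linarith) hm.last_pos
  simp only [sub_zero] at hint hval
  have hval' : ∫ s in (0 : ℝ)..t n, (t n - s) ^ (α - 1) * s ^ (-α) = betaConst (α - 1) (-α) := by
    rw [hval, show α - 1 + -α + 1 = 0 by ring, Real.rpow_zero, one_mul]
  set φ : ℝ → ℝ := fun s => (t n - s) ^ (α - 1) * s ^ (-α) with hφ
  have hφ0 : ∀ s ∈ Icc 0 (t n), 0 ≤ φ s := fun s hs =>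
    mul_nonneg (Real.rpow_nonneg (sub_nonneg.2 hs.2) _) (Real.rpow_nonneg hs.1 _)
  have hsub : ∀ i j, i ≤ j → j ≤ n → IntervalIntegrable φ volume (t i) (t j) := fun i j hij hj =>
    hint.mono_set (by
      rw [uIcc_of_le (hm.le_of_le hij hj), uIcc_of_le hm.last_pos.le]
      exact Icc_subset_Icc (hm.nonneg (hij.trans hj)) (hm.le_of_le hj le_rfl))
  have hstep : ∀ j, 2 ≤ j → j ≤ n →
      step t j * (t (j - 1) ^ (-α) * (t n - t (j - 1)) ^ (α - 1))
        ≤ (1 + κ) ^ α * ∫ s in t (j - 1)..t j, φ s := by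
    intro j h2 hj
    have hle : t (j - 1) ≤ t j := hm.le_of_le (by omega) hj
    have hlt : 0 < step t (j - 1) := hm.step_pos (j - 1) (by omega) (by omega)
    have ha : step t (j - 1) ≤ t (j - 1) := by
      have := hm.nonneg (j := j - 1 - 1) (by omega)
      simp only [step]; linarith
    have ha0 : 0 < t (j - 1) := hlt.trans_le ha
    -- The step before is part of [0, t_(j-1)], so τ_j ≤ κ t_(j-1). Hence t^(-α) varies over a step
    -- at most by the factor (1+κ)^α, while (t_n - t)^(α-1) increases; the left rectangle is below a
    -- multiple of the integral.
    have hb : t j ≤ (1 + κ) * t (j - 1) := by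
      have h3 := hratio j h2 hj
      have h4 : κ * step t (j - 1) ≤ κ * t (j - 1) := by gcongr
      have := sub_add_step t j
      linarith
    have hcst : step t j * (t (j - 1) ^ (-α) * (t n - t (j - 1)) ^ (α - 1))
        = ∫ _ in t (j - 1)..t j, t (j - 1) ^ (-α) * (t n - t (j - 1)) ^ (α - 1) := by
      rw [intervalIntegral.integral_const, smul_eq_mul]; rfl
    rw [hcst, ← intervalIntegral.integral_const_mul]
    refine intervalIntegral.integral_mono_ae_restrict hle intervalIntegrable_const
      ((hsub (j - 1) j (by omega) hj).const_mul _) ?_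
    refine (ae_restrict_iff' measurableSet_Icc).2 ?_
    filter_upwards [volume.ae_ne (t n)] with u hun hu
    have hu0 : 0 < u := ha0.trans_le hu.1
    have hutn : u < t n := lt_of_le_of_ne (hu.2.trans (hm.le_of_le hj le_rfl)) hun
    have h5 : t (j - 1) ^ (-α) ≤ (1 + κ) ^ α * u ^ (-α) := by
      have h6 : ((1 + κ) * t (j - 1)) ^ (-α) ≤ u ^ (-α) :=
        Real.rpow_le_rpow_of_nonpos hu0 (hu.2.trans hb) (by linarith)
      have h7 : t (j - 1) ^ (-α) = (1 + κ) ^ α * ((1 + κ) * t (j - 1)) ^ (-α) := by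
        rw [Real.mul_rpow (by positivity) ha0.le, ← mul_assoc, ← Real.rpow_add (by positivity)]
        simp
      rw [h7]
      gcongr
    have h8 : (t n - t (j - 1)) ^ (α - 1) ≤ (t n - u) ^ (α - 1) :=
      Real.rpow_le_rpow_of_nonpos (by linarith) (by linarith [hu.1]) (by linarith)
    calc _ ≤ (1 + κ) ^ α * u ^ (-α) * (t n - u) ^ (α - 1) := by
          have : 0 ≤ t n - t (j - 1) := by linarith [hu.1]
          gcongr
      _ = _ := by simp only [hφ]; ring
  have hind : ∀ m ≤ n, ∑ j ∈ Finset.Icc 2 m,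
      step t j * (t (j - 1) ^ (-α) * (t n - t (j - 1)) ^ (α - 1))
        ≤ (1 + κ) ^ α * ∫ s in t 0..t m, φ s := by
    intro m hmn
    have hnonneg : 0 ≤ ∫ s in t 0..t m, φ s := by
      refine intervalIntegral.integral_nonneg (hm.le_of_le (Nat.zero_le _) hmn) fun u hu => hφ0 u ?_
      rw [hm.zero] at hu
      exact ⟨hu.1, hu.2.trans (hm.le_of_le hmn le_rfl)⟩
    induction m with
    | zero => simp
    | succ m ih =>
      rcases Nat.eq_zero_or_pos m with rfl | hm0
      · rw [Finset.Icc_eq_empty (by omega), Finset.sum_empty]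
        positivity
      · rw [Finset.sum_Icc_succ_top (by omega), ← intervalIntegral.integral_add_adjacent_intervals
          (hsub 0 m (by omega) (by omega)) (hsub m (m + 1) (by omega) hmn), mul_add]
        refine add_le_add (ih (by omega) ?_) (hstep (m + 1) (by omega) hmn)
        refine intervalIntegral.integral_nonneg (hm.le_of_le (Nat.zero_le _) (by omega))
          fun u hu => hφ0 u ?_
        rw [hm.zero] at hu
        exact ⟨hu.1, hu.2.trans (hm.le_of_le (by omega) le_rfl)⟩
  have := hind n le_rfl
  rwa [hm.zero, hval'] at this

theorem odeSol_rpow (x δ t : ℝ) :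
    odeSol x (fun u => ((u ^ δ : ℝ) : ℂ)) t = (powChain x δ 0 t : ℂ) := by
  rw [odeSol_ofReal]
  rfl

/-- Pointwise error bound for powers on quasi-uniform meshes. -/
theorem exists_odeError_rpow_le {p q : ℕ} (h : rk.IsAdmissible p q) {α δ T : ℝ} (hα₀ : 0 < α)
    (hα₁ : α < 1) (hpq : q + 2 ≤ p) (hδ : (q : ℝ) + 1 ≤ δ) (hδp : δ ≤ p) :
    ∃ C c : ℝ, 0 < C ∧ 0 < c ∧ ∀ (t : ℕ → ℝ) (n : ℕ) (τ x κ : ℝ), IsPartialMesh T τ n t → 1 ≤ κ →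
      (∀ j, 2 ≤ j → j ≤ n → step t j ≤ κ * step t (j - 1)) → 0 < x →
      ‖odeError rk t n (fun u => ((u ^ δ : ℝ) : ℂ)) x‖
        ≤ C * (τ ^ (q + 2) * min 1 (τ * x)⁻¹ + stageTerm p q τ x / x
          + κ ^ ((p : ℝ) - q - 1 - α) * τ ^ ((q : ℝ) + 1 + α) * ∑ j ∈ Finset.Icc 2 n,
            step t j * t (j - 1) ^ (-α) * (1 / (1 + c * (t n - t (j - 1)) * x))) := by
  obtain ⟨C₁, hC₁0, hC₁⟩ := exists_stepDefect_rpow_first_le h (T := T) hδ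
  obtain ⟨C₂, hC₂0, hC₂⟩ := exists_stepDefect_rpow_le h (T := T) hα₀ hα₁ hpq hδ hδp
  obtain ⟨c, hc0, hc1, hR⟩ := h.exists_stability_bound
  refine ⟨C₁ + C₂ * (1 + 1 / c), c, by positivity, hc0,
    fun t n τ x κ hm hκ hratio hx => ?_⟩
  have hτ := hm.pos
  have hst0 : ∀ j, 1 ≤ j → j ≤ n → 0 ≤ step t j := fun j h1 h2 => (hm.step_pos j h1 h2).le
  have hE := stageTerm_nonneg (p := p) (q := q) hτ.le hx.le
  have hδ0 : 0 < δ := by linarith [q.cast_nonneg (α := ℝ)]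
  rw [odeError, odeSol_rpow]
  refine (norm_sub_odeApprox_le rk t x (fun u => (powChain x δ 0 u : ℂ)) _
    (by simp [hm.zero, powChain]) n).trans ?_
  set Q : ℕ → ℝ := fun j => ∏ l ∈ Finset.Icc j n, 1 / (1 + c * (step t l * x)) with hQ
  have hQ0 : ∀ j, 1 ≤ j → 0 ≤ Q j := fun j hj => Finset.prod_nonneg fun l hl => by
    rw [Finset.mem_Icc] at hl
    have := hst0 l (by omega) hl.2
    positivity
  have hPQ : ∀ j, 1 ≤ j → j ≤ n → ∀ D C B : ℝ, 0 ≤ B → 0 ≤ C → D ≤ C / (1 + step t j * x) * B →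
      (∏ l ∈ Finset.Icc (j + 1) n, ‖rk.stability (-((step t l * x : ℝ) : ℂ))‖) * D
        ≤ C * (Q j * B) := by
    intro j h1 h2 D C B hB hC hD
    have h3 := prod_stability_div_le hc0.le hc1 hR hx.le hst0 h1 h2
    have hP0 : 0 ≤ ∏ l ∈ Finset.Icc (j + 1) n, ‖rk.stability (-((step t l * x : ℝ) : ℂ))‖ :=
      Finset.prod_nonneg fun l _ => norm_nonneg _
    calc _ ≤ (∏ l ∈ Finset.Icc (j + 1) n, ‖rk.stability (-((step t l * x : ℝ) : ℂ))‖)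
          * (C / (1 + step t j * x) * B) := by gcongr
      _ = C * ((∏ l ∈ Finset.Icc (j + 1) n, ‖rk.stability (-((step t l * x : ℝ) : ℂ))‖)
          / (1 + step t j * x) * B) := by ring
      _ ≤ _ := by gcongr
  have hfirst : (∏ l ∈ Finset.Icc (1 + 1) n, ‖rk.stability (-((step t l * x : ℝ) : ℂ))‖)
      * ‖stepDefect rk (t (1 - 1)) (step t 1) x (fun u => (powChain x δ 0 u : ℂ))
        (fun u => ((u ^ δ : ℝ) : ℂ))‖ ≤ C₁ * (τ ^ (q + 2) * min 1 (τ * x)⁻¹) := by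
    have h1 := hC₁ (step t 1) τ x (hm.step_pos 1 le_rfl hm.one_le) (hm.step_le 1 le_rfl hm.one_le)
      hm.max_le hx
    rw [Nat.sub_self, hm.zero]
    refine (hPQ 1 le_rfl hm.one_le _ _ _ (by positivity) hC₁0.le h1).trans ?_
    -- The decay of the stability factors is not needed for the first step: its defect already
    -- contains min(1, 1/(τx)).
    have h2 : Q 1 ≤ 1 := by
      refine Finset.prod_le_one (fun l hl => ?_) fun l hl => ?_ <;>
      · rw [Finset.mem_Icc] at hl
        have := hst0 l hl.1 hl.2
        first
        | positivity
        | exact div_le_one_of_le₀ (by have : 0 ≤ c * (step t l * x) := by positivity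
                                      linarith) (by positivity)
    calc _ ≤ C₁ * (1 * (τ ^ (q + 2) * min 1 (τ * x)⁻¹)) := by gcongr
      _ = _ := by rw [one_mul]
  set κ' := κ ^ ((p : ℝ) - q - 1 - α) * τ ^ ((q : ℝ) + 1 + α) with hκ'
  have hκ'0 : 0 ≤ κ' := by positivity
  have hlater : ∀ j ∈ Finset.Icc 2 n,
      (∏ l ∈ Finset.Icc (j + 1) n, ‖rk.stability (-((step t l * x : ℝ) : ℂ))‖)
      * ‖stepDefect rk (t (j - 1)) (step t j) x (fun u => (powChain x δ 0 u : ℂ))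
        (fun u => ((u ^ δ : ℝ) : ℂ))‖
      ≤ C₂ * (step t j * Q j * stageTerm p q τ x
        + κ' * (step t j * t (j - 1) ^ (-α) * (1 / (1 + c * (t n - t (j - 1)) * x)))) := by
    intro j hj
    rw [Finset.mem_Icc] at hj
    have hs := hm.step_pos j (by omega) hj.2
    have hlt : 0 < step t (j - 1) := hm.step_pos (j - 1) (by omega) (by omega)
    have ha : step t (j - 1) ≤ t (j - 1) := by
      have := hm.nonneg (j := j - 1 - 1) (by omega)
      simp only [step]; linarith
    have ha0 : 0 < t (j - 1) := hlt.trans_le ha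
    have h1 := hC₂ (t (j - 1)) (step t j) τ x κ ha0
      ((hm.le_of_le (by omega) le_rfl).trans hm.le) hs (hm.step_le j (by omega) hj.2) hm.max_le hx hκ
      ((hratio j hj.1 hj.2).trans (by gcongr))
    refine (hPQ j (by omega) hj.2 _ _ _ (by positivity) hC₂0.le h1).trans ?_
    have h3 := (prod_le_inv_one_add hc0.le hx.le hst0 (j := j) (by omega) (by omega)).1
    have h4 : Q j ≤ 1 / (1 + c * (t n - t (j - 1)) * x) := by
      refine h3.trans (le_of_eq ?_)
      ring
    refine mul_le_mul_of_nonneg_left ?_ hC₂0.le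
    rw [mul_add]
    refine add_le_add (le_of_eq (by ring)) ?_
    calc _ = κ' * (step t j * t (j - 1) ^ (-α) * Q j) := by rw [hκ']; ring
      _ ≤ _ := by gcongr
  have hsplit : Finset.Icc 1 n = insert 1 (Finset.Icc 2 n) := by
    ext i
    have := hm.one_le
    simp only [Finset.mem_Icc, Finset.mem_insert]
    omega
  rw [hsplit, Finset.sum_insert (by simp)]
  refine (add_le_add hfirst (Finset.sum_le_sum hlater)).trans ?_
  rw [← Finset.mul_sum, Finset.sum_add_distrib, ← Finset.sum_mul, ← Finset.mul_sum]
  have h1 : ∑ j ∈ Finset.Icc 2 n, step t j * Q j ≤ 1 / (c * x) := by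
    refine le_trans ?_ (sum_mul_prod_le hc0 hx hst0)
    rw [hsplit, Finset.sum_insert (by simp)]
    refine le_add_of_nonneg_left (mul_nonneg (hst0 1 le_rfl hm.one_le) (hQ0 1 le_rfl))
  set S := ∑ j ∈ Finset.Icc 2 n, step t j * t (j - 1) ^ (-α) *
    (1 / (1 + c * (t n - t (j - 1)) * x)) with hS
  have hS0 : 0 ≤ S := Finset.sum_nonneg fun j hj => by
    rw [Finset.mem_Icc] at hj
    have := hst0 j (by omega) hj.2
    have := hm.nonneg (j := j - 1) (by omega)
    have : 0 ≤ t n - t (j - 1) := sub_nonneg.2 (hm.le_of_le (by omega) le_rfl)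
    positivity
  set F := τ ^ (q + 2) * min 1 (τ * x)⁻¹ with hF
  have hF0 : 0 ≤ F := by positivity
  calc _ ≤ C₁ * F + C₂ * (1 / (c * x) * stageTerm p q τ x + κ' * S) := by gcongr
    _ = C₁ * F + C₂ * (1 / c * (stageTerm p q τ x / x) + κ' * S) := by
      congr 3
      field_simp
    _ ≤ _ := by
      have h2 : 0 ≤ stageTerm p q τ x / x := by positivity
      have h3 : 0 ≤ κ' * S := by positivity
      have h4 : 0 ≤ 1 / c := by positivity
      have h5 := mul_nonneg h4 h2
      have h6 := mul_nonneg h4 h3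
      have h7 := mul_nonneg h4 hF0
      have e1 : (C₁ + C₂ * (1 + 1 / c)) * (F + stageTerm p q τ x / x + κ' * S)
        = (C₁ * F + C₂ * (1 / c * (stageTerm p q τ x / x) + κ' * S)) +
          (C₁ * (stageTerm p q τ x / x + κ' * S) +
            C₂ * (F + stageTerm p q τ x / x + 1 / c * F + 1 / c * (κ' * S))) := by ring
      rw [e1]
      refine le_add_of_nonneg_right ?_
      positivity

/-- Powers `u^δ` with `q + 1 ≤ δ ≤ p` are integrated with full order on quasi-uniform meshes. -/
theorem exists_errorNorm_rpow_le_of_ratio {p q : ℕ} (h : rk.IsAdmissible p q) {α δ T : ℝ}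
    (hα₀ : 0 < α) (hα₁ : α < 1) (hpq : q + 2 ≤ p) (hδ : (q : ℝ) + 1 ≤ δ) (hδp : δ ≤ p) :
    ∃ C : ℝ, 0 < C ∧ ∀ (t : ℕ → ℝ) (n : ℕ) (τ κ : ℝ), IsPartialMesh T τ n t → 1 ≤ κ →
      (∀ j, 2 ≤ j → j ≤ n → step t j ≤ κ * step t (j - 1)) →
      errorNorm α rk t n (fun u => ((u ^ δ : ℝ) : ℂ))
        ≤ ENNReal.ofReal (C * κ ^ ((p : ℝ) - q - α) * τ ^ min (p : ℝ) (q + 1 + α)) := by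
  obtain ⟨C, c, hC0, hc0, hC⟩ := exists_odeError_rpow_le h (T := T) hα₀ hα₁ hpq hδ hδp
  obtain ⟨C₁, hC₁0, hC₁⟩ := exists_lintegral_rpow_neg_mul_min_le hα₀ hα₁
  obtain ⟨C₂, hC₂0, hC₂⟩ := exists_lintegral_stageTerm_le hα₀ hα₁ p q
  have hβ := betaConst_pos (a := α - 1) (e := -α) (by linarith) (by linarith)
  refine ⟨C * (C₁ + C₂ + C₁ * c ^ (α - 1) * (2 ^ α * betaConst (α - 1) (-α))), by positivity,
    fun t n τ κ hm hκ hratio => ?_⟩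
  have hτ := hm.pos
  have hpq' : (q : ℝ) + 2 ≤ p := by exact_mod_cast hpq
  have hμ : min (p : ℝ) (q + 1 + α) = q + 1 + α := min_eq_right (by linarith)
  have hC₂' := hC₂ τ hτ
  rw [hμ] at hC₂' ⊢
  refine (errorNorm_le_of_le _ fun x hx => hC t n τ x κ hm hκ hratio hx).trans ?_
  set κ' := κ ^ ((p : ℝ) - q - 1 - α) * τ ^ ((q : ℝ) + 1 + α) with hκ'
  have hκ0 : 0 < κ := by linarith
  have hκ'0 : 0 < κ' := by positivity
  have hw : ∀ j ∈ Finset.Icc 2 n, 0 < step t j ∧ 0 ≤ t (j - 1) ∧ 0 < t n - t (j - 1) := by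
    intro j hj
    rw [Finset.mem_Icc] at hj
    have h1 := hm.step_pos j (by omega) hj.2
    refine ⟨h1, hm.nonneg (by omega), ?_⟩
    have h2 := hm.le_of_le hj.2 le_rfl
    simp only [step] at h1
    linarith
  have h1 : ∀ x ∈ Ioi (0 : ℝ), ENNReal.ofReal (x ^ (-α) * (C * (τ ^ (q + 2) * min 1 (τ * x)⁻¹
      + stageTerm p q τ x / x + κ' * ∑ j ∈ Finset.Icc 2 n,
            step t j * t (j - 1) ^ (-α) * (1 / (1 + c * (t n - t (j - 1)) * x)))))
      ≤ ENNReal.ofReal (C * τ ^ (q + 2)) * ENNReal.ofReal (x ^ (-α) * min 1 (τ * x)⁻¹)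
        + (ENNReal.ofReal C * ENNReal.ofReal (x ^ (-α) * (stageTerm p q τ x / x))
        + ∑ j ∈ Finset.Icc 2 n, ENNReal.ofReal (C * κ' * (step t j * t (j - 1) ^ (-α))) *
          ENNReal.ofReal (x ^ (-α) * min 1 (c * (t n - t (j - 1)) * x)⁻¹)) := by
    intro x hx
    have hx' : 0 < x := hx
    have hE := stageTerm_nonneg (p := p) (q := q) hτ.le hx'.le
    have hs : ∑ j ∈ Finset.Icc 2 n, ENNReal.ofReal (C * κ' * (step t j * t (j - 1) ^ (-α))) *
          ENNReal.ofReal (x ^ (-α) * min 1 (c * (t n - t (j - 1)) * x)⁻¹)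
        = ENNReal.ofReal (∑ j ∈ Finset.Icc 2 n, C * κ' * (step t j * t (j - 1) ^ (-α)) *
          (x ^ (-α) * min 1 (c * (t n - t (j - 1)) * x)⁻¹)) := by
      rw [ENNReal.ofReal_sum_of_nonneg]
      · refine Finset.sum_congr rfl fun j hj => ?_
        obtain ⟨h2, h3, h4⟩ := hw j hj
        exact (ENNReal.ofReal_mul (by positivity)).symm
      · intro j hj
        obtain ⟨h2, h3, h4⟩ := hw j hj
        positivity
    have hs0 : 0 ≤ ∑ j ∈ Finset.Icc 2 n, C * κ' * (step t j * t (j - 1) ^ (-α)) *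
          (x ^ (-α) * min 1 (c * (t n - t (j - 1)) * x)⁻¹) := Finset.sum_nonneg fun j hj => by
      obtain ⟨h2, h3, h4⟩ := hw j hj
      positivity
    rw [hs, ← ENNReal.ofReal_mul (by positivity), ← ENNReal.ofReal_mul (by positivity),
      ← ENNReal.ofReal_add (by positivity) hs0, ← ENNReal.ofReal_add (by positivity)
        (add_nonneg (by positivity) hs0)]
    refine ENNReal.ofReal_le_ofReal ?_
    rw [mul_add, mul_add, mul_add, mul_add, add_assoc]
    refine add_le_add (le_of_eq (by ring)) (add_le_add (le_of_eq (by ring)) ?_)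
    rw [Finset.mul_sum, Finset.mul_sum, Finset.mul_sum]
    refine Finset.sum_le_sum fun j hj => ?_
    obtain ⟨h2, h3, h4⟩ := hw j hj
    have h5 := one_div_one_add_le_min (u := c * (t n - t (j - 1)) * x) (by positivity)
    calc _ = C * κ' * (step t j * t (j - 1) ^ (-α)) *
          (x ^ (-α) * (1 / (1 + c * (t n - t (j - 1)) * x))) := by ring
      _ ≤ _ := by gcongr
  refine (setLIntegral_mono' measurableSet_Ioi h1).trans ?_
  have hmeas2 : Measurable fun x : ℝ => stageTerm p q τ x := by
    simp only [stageTerm, if_pos hpq]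
    fun_prop
  rw [lintegral_add_left (by fun_prop), lintegral_add_left (by fun_prop),
    lintegral_finsetSum _ (by fun_prop), lintegral_const_mul' _ _ ENNReal.ofReal_ne_top,
    lintegral_const_mul' _ _ ENNReal.ofReal_ne_top]
  have h2 : ∑ j ∈ Finset.Icc 2 n, ∫⁻ x in Ioi (0 : ℝ),
      ENNReal.ofReal (C * κ' * (step t j * t (j - 1) ^ (-α))) *
          ENNReal.ofReal (x ^ (-α) * min 1 (c * (t n - t (j - 1)) * x)⁻¹)
      ≤ ENNReal.ofReal (C * κ' * (C₁ * c ^ (α - 1)) *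
        ((1 + κ) ^ α * betaConst (α - 1) (-α))) := by
    have h3 : ∀ j ∈ Finset.Icc 2 n, ∫⁻ x in Ioi (0 : ℝ),
        ENNReal.ofReal (C * κ' * (step t j * t (j - 1) ^ (-α))) *
          ENNReal.ofReal (x ^ (-α) * min 1 (c * (t n - t (j - 1)) * x)⁻¹)
        ≤ ENNReal.ofReal (C * κ' * (C₁ * c ^ (α - 1)) *
          (step t j * (t (j - 1) ^ (-α) * (t n - t (j - 1)) ^ (α - 1)))) := by
      intro j hj
      obtain ⟨h2, h3, h4⟩ := hw j hj
      rw [lintegral_const_mul' _ _ ENNReal.ofReal_ne_top]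
      refine (mul_le_mul_right (hC₁ _ (mul_pos hc0 h4)) _).trans (le_of_eq ?_)
      rw [← ENNReal.ofReal_mul (by positivity), Real.mul_rpow hc0.le h4.le]
      congr 1
      ring
    refine (Finset.sum_le_sum h3).trans ?_
    rw [← ENNReal.ofReal_sum_of_nonneg, ← Finset.mul_sum]
    · refine ENNReal.ofReal_le_ofReal ?_
      have := sum_rpow_mul_rpow_le hm hα₀ hα₁ hκ0.le hratio
      gcongr
    · intro j hj
      obtain ⟨h2, h3, h4⟩ := hw j hj
      positivity
  refine (add_le_add (mul_le_mul_right (hC₁ τ hτ) _)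
    (add_le_add (mul_le_mul_right hC₂' _) h2)).trans ?_
  rw [← ENNReal.ofReal_mul (by positivity), ← ENNReal.ofReal_mul (by positivity),
    ← ENNReal.ofReal_add (by positivity) (by positivity),
    ← ENNReal.ofReal_add (by positivity) (by positivity)]
  refine ENNReal.ofReal_le_ofReal ?_
  -- The first step has order q + 2 and the weighted integral loses 1 - α, which leaves the same
  -- rate as the stage part.
  have h3 : τ ^ (q + 2) * τ ^ (α - 1) = τ ^ ((q : ℝ) + 1 + α) := by
    rw [← Real.rpow_natCast, ← Real.rpow_add hτ]
    congr 1
    push_cast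
    ring
  have h4 : (1 + κ) ^ α ≤ 2 ^ α * κ ^ α := by
    rw [← Real.mul_rpow (by norm_num) hκ0.le]
    exact Real.rpow_le_rpow (by positivity) (by linarith) hα₀.le
  set W := τ ^ ((q : ℝ) + 1 + α) with hW
  set V := κ ^ ((p : ℝ) - q - α) with hV
  have h5 : 1 ≤ V := Real.one_le_rpow hκ (by linarith)
  -- The Riemann sum costs (1+κ)^α ≤ 2^α κ^α. The total exponent p - q - 1 of κ is below p - q - α
  -- because α < 1.
  have h6 : κ ^ ((p : ℝ) - q - 1 - α) * κ ^ α ≤ V := by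
    rw [← Real.rpow_add hκ0]
    exact Real.rpow_le_rpow_of_exponent_le hκ (by linarith)
  calc C * τ ^ (q + 2) * (C₁ * τ ^ (α - 1)) + (C * (C₂ * W) + C * κ' * (C₁ * c ^ (α - 1)) *
        ((1 + κ) ^ α * betaConst (α - 1) (-α)))
      = C * C₁ * (τ ^ (q + 2) * τ ^ (α - 1)) + (C * (C₂ * W) + C * κ' * (C₁ * c ^ (α - 1)) *
        ((1 + κ) ^ α * betaConst (α - 1) (-α))) := by ring
    _ ≤ C * C₁ * W + (C * (C₂ * W) + C * κ' * (C₁ * c ^ (α - 1)) *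
        ((2 ^ α * κ ^ α) * betaConst (α - 1) (-α))) := by
        rw [h3]
        gcongr
    _ = C * C₁ * W * 1 + (C * (C₂ * W) * 1 + C * W * (C₁ * c ^ (α - 1)) *
        (2 ^ α * betaConst (α - 1) (-α)) * (κ ^ ((p : ℝ) - q - 1 - α) * κ ^ α)) := by
        rw [hκ']; ring
    _ ≤ C * C₁ * W * V + (C * (C₂ * W) * V + C * W * (C₁ * c ^ (α - 1)) *
        (2 ^ α * betaConst (α - 1) (-α)) * V) := by gcongr
    _ = _ := by ring

end RKgCQ

/-! ### Cauchy's formula on the cut plane, in logarithmic coordinates. -/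

namespace RKgCQ

open MeasureTheory

theorem integrableOn_inv_add_mul_rpow {α σ : ℝ} (hα₀ : 0 < α) (hα₁ : α < 1) (hσ : 0 < σ) :
    IntegrableOn (fun x : ℝ => (x + σ)⁻¹ * x ^ (-α)) (Ioi 0) := by
  refine Integrable.mono' ((integrableOn_rpow_neg_mul_min hα₀ hα₁).const_mul (1 + σ⁻¹))
    (by fun_prop) ((ae_restrict_iff' measurableSet_Ioi).2 (Eventually.of_forall fun x hx => ?_))
  have hx' : 0 < x := hx
  have h1 : (x + σ)⁻¹ ≤ (1 + σ⁻¹) * min 1 x⁻¹ := by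
    rw [mul_min_of_nonneg _ _ (by positivity)]
    refine le_min ?_ ?_
    · have : (x + σ)⁻¹ ≤ σ⁻¹ := inv_anti₀ hσ (by linarith)
      linarith
    · have h2 : (x + σ)⁻¹ ≤ x⁻¹ := inv_anti₀ hx' (by linarith)
      have h3 : 0 ≤ σ⁻¹ * x⁻¹ := by positivity
      linarith
  rw [Real.norm_of_nonneg (by positivity)]
  calc _ ≤ (1 + σ⁻¹) * min 1 x⁻¹ * x ^ (-α) := by gcongr
    _ = _ := by ring

theorem exp_mem_slitPlane_of_abs_im_lt {ξ : ℂ} (h : |ξ.im| < Real.pi) :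
    Complex.exp ξ ∈ Complex.slitPlane := by
  rw [abs_lt] at h
  rw [Complex.mem_slitPlane_iff_arg]
  refine ⟨?_, Complex.exp_ne_zero _⟩
  rw [← Complex.log_im, Complex.log_exp h.1 h.2.le]
  exact h.2.ne

section Cauchy

variable {E : Type*} [NormedAddCommGroup E] [NormedSpace ℂ E]

/-- A function on the plane cut along the negative real axis, with values `K₁` on the upper and `K₂`
on the lower edge, as a function of the logarithm. -/
noncomputable def stripLift (K₁ K₂ : ℂ → E) (ξ : ℂ) : E :=
  if 0 ≤ ξ.im then K₁ (Complex.exp ξ) else K₂ (Complex.exp ξ)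

/-- The closed strip `|Im ξ| ≤ π`. -/
def logStrip : Set ℂ := {ξ | -Real.pi ≤ ξ.im ∧ ξ.im ≤ Real.pi}

/-- `K` is holomorphic in the plane cut along the negative real axis, with continuous extensions
`K₁` and `K₂` to the upper and to the lower edge of the cut and bounded by `M |z|^(-α)`. -/
structure HasEdgeValues (K K₁ K₂ : ℂ → E) (M α : ℝ) : Prop where
  differentiableOn : DifferentiableOn ℂ K Complex.slitPlane
  continuousOn_upper : ContinuousOn K₁ {z | 0 ≤ z.im ∧ z ≠ 0}
  continuousOn_lower : ContinuousOn K₂ {z | z.im ≤ 0 ∧ z ≠ 0}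
  eq_upper : ∀ z ∈ Complex.slitPlane, 0 ≤ z.im → K₁ z = K z
  eq_lower : ∀ z ∈ Complex.slitPlane, z.im ≤ 0 → K₂ z = K z
  norm_upper_le : ∀ z : ℂ, 0 ≤ z.im → z ≠ 0 → ‖K₁ z‖ ≤ M * ‖z‖ ^ (-α)
  norm_lower_le : ∀ z : ℂ, z.im ≤ 0 → z ≠ 0 → ‖K₂ z‖ ≤ M * ‖z‖ ^ (-α)

variable {K K₁ K₂ : ℂ → E} {M α : ℝ}

theorem exp_im_nonneg {ξ : ℂ} (h0 : 0 ≤ ξ.im) (h1 : ξ.im ≤ Real.pi) : 0 ≤ (Complex.exp ξ).im := by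
  rw [Complex.exp_im]
  exact mul_nonneg (Real.exp_pos _).le (Real.sin_nonneg_of_nonneg_of_le_pi h0 h1)

theorem exp_im_nonpos {ξ : ℂ} (h0 : -Real.pi ≤ ξ.im) (h1 : ξ.im ≤ 0) :
    (Complex.exp ξ).im ≤ 0 := by
  rw [Complex.exp_im]
  exact mul_nonpos_of_nonneg_of_nonpos (Real.exp_pos _).le
    (Real.sin_nonpos_of_nonpos_of_neg_pi_le h1 h0)

theorem HasEdgeValues.stripLift_eq (h : HasEdgeValues K K₁ K₂ M α) {ξ : ℂ}
    (hξ : |ξ.im| < Real.pi) : stripLift K₁ K₂ ξ = K (Complex.exp ξ) := by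
  have h1 := exp_mem_slitPlane_of_abs_im_lt hξ
  rw [abs_lt] at hξ
  unfold stripLift
  split_ifs with h0
  · exact h.eq_upper _ h1 (exp_im_nonneg h0 hξ.2.le)
  · exact h.eq_lower _ h1 (exp_im_nonpos hξ.1.le (not_le.1 h0).le)

theorem HasEdgeValues.norm_stripLift_le (h : HasEdgeValues K K₁ K₂ M α) {ξ : ℂ}
    (hξ : ξ ∈ logStrip) : ‖stripLift K₁ K₂ ξ‖ ≤ M * Real.exp ξ.re ^ (-α) := by
  rw [← Complex.norm_exp]
  unfold stripLift
  split_ifs with h0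
  · exact h.norm_upper_le _ (exp_im_nonneg h0 hξ.2) (Complex.exp_ne_zero _)
  · exact h.norm_lower_le _ (exp_im_nonpos hξ.1 (not_le.1 h0).le) (Complex.exp_ne_zero _)

/-- The logarithm opens the cut: its two edges become the lines Im ξ = ±π, so one function carries
both boundary values. The two closed half-strips meet on the real line, where both extensions equal
K. -/
theorem HasEdgeValues.continuousOn_stripLift (h : HasEdgeValues K K₁ K₂ M α) :
    ContinuousOn (stripLift K₁ K₂) logStrip := by
  have hu : logStrip = {ξ : ℂ | 0 ≤ ξ.im ∧ ξ.im ≤ Real.pi} ∪ {ξ | -Real.pi ≤ ξ.im ∧ ξ.im ≤ 0} := by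
    ext ξ
    have := Real.pi_pos
    simp only [logStrip, mem_ofPred_eq, mem_union]
    constructor
    · intro h
      rcases le_total 0 ξ.im with h0 | h0
      · exact Or.inl ⟨h0, h.2⟩
      · exact Or.inr ⟨h.1, h0⟩
    · rintro (h | h)
      · exact ⟨by linarith [h.1], h.2⟩
      · exact ⟨h.1, by linarith [h.2]⟩
  rw [hu]
  refine ContinuousOn.union_of_isClosed ?_ ?_ ?_ ?_
  · have h1 : ContinuousOn (fun ξ => K₁ (Complex.exp ξ)) {ξ : ℂ | 0 ≤ ξ.im ∧ ξ.im ≤ Real.pi} :=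
      h.continuousOn_upper.comp Complex.continuous_exp.continuousOn fun ξ hξ =>
        ⟨exp_im_nonneg hξ.1 hξ.2, Complex.exp_ne_zero _⟩
    exact h1.congr fun ξ hξ => if_pos hξ.1
  · have h1 : ContinuousOn (fun ξ => K₂ (Complex.exp ξ)) {ξ : ℂ | -Real.pi ≤ ξ.im ∧ ξ.im ≤ 0} :=
      h.continuousOn_lower.comp Complex.continuous_exp.continuousOn fun ξ hξ =>
        ⟨exp_im_nonpos hξ.1 hξ.2, Complex.exp_ne_zero _⟩
    refine h1.congr fun ξ hξ => ?_
    rcases hξ.2.lt_or_eq with h0 | h0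
    · exact if_neg (not_le.2 h0)
    · have h2 : |ξ.im| < Real.pi := by rw [h0, abs_zero]; exact Real.pi_pos
      simp only
      rw [h.stripLift_eq h2, h.eq_lower _ (exp_mem_slitPlane_of_abs_im_lt h2)
        (exp_im_nonpos hξ.1 hξ.2)]
  · exact (isClosed_le continuous_const Complex.continuous_im).inter
      (isClosed_le Complex.continuous_im continuous_const)
  · exact (isClosed_le continuous_const Complex.continuous_im).inter
      (isClosed_le Complex.continuous_im continuous_const)

theorem HasEdgeValues.differentiableAt_stripLift (h : HasEdgeValues K K₁ K₂ M α) {ξ : ℂ}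
    (hξ : |ξ.im| < Real.pi) : DifferentiableAt ℂ (stripLift K₁ K₂) ξ := by
  have h1 : DifferentiableAt ℂ (fun ξ => K (Complex.exp ξ)) ξ :=
    (h.differentiableOn.differentiableAt (Complex.isOpen_slitPlane.mem_nhds
      (exp_mem_slitPlane_of_abs_im_lt hξ))).comp ξ Complex.differentiableAt_exp
  refine h1.congr_of_eventuallyEq ?_
  have h2 : IsOpen {ξ : ℂ | |ξ.im| < Real.pi} :=
    isOpen_lt (continuous_abs.comp Complex.continuous_im) continuous_const
  filter_upwards [h2.mem_nhds hξ] with η hη using h.stripLift_eq hη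

/-- The integrand of Cauchy's formula in logarithmic coordinates, after subtraction of the pole. -/
noncomputable def cauchyKernel (K₁ K₂ : ℂ → E) (ξ₀ ξ : ℂ) : E :=
  (Complex.exp ξ / dslope Complex.exp ξ₀ ξ) • dslope (stripLift K₁ K₂) ξ₀ ξ

/-- Two preimages differ by a multiple of 2πi; as ξ₀ lies in the open strip, only the multiple 0
stays in the closed one. -/
theorem exp_ne_of_mem_logStrip {ξ ξ₀ : ℂ} (hξ₀ : |ξ₀.im| < Real.pi) (hξ : ξ ∈ logStrip)
    (hne : ξ ≠ ξ₀) : Complex.exp ξ - Complex.exp ξ₀ ≠ 0 := by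
  intro h0
  obtain ⟨n, hn⟩ := Complex.exp_eq_exp_iff_exists_int.1 (sub_eq_zero.1 h0)
  have h1 : ξ.im = ξ₀.im + n * (2 * Real.pi) := by
    rw [hn]; simp
  rw [abs_lt] at hξ₀
  have hpi := Real.pi_pos
  have h2 : (-1 : ℝ) < n := by
    by_contra h
    have := hξ.1
    nlinarith [not_lt.1 h]
  have h3 : (n : ℝ) < 1 := by
    by_contra h
    have := hξ.2
    nlinarith [not_lt.1 h]
  have h4 : n = 0 := by
    have h5 : (-1 : ℤ) < n := by exact_mod_cast h2
    have h6 : n < 1 := by exact_mod_cast h3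
    omega
  apply hne
  rw [hn, h4]
  simp

theorem dslope_exp_ne_zero {ξ ξ₀ : ℂ} (hξ₀ : |ξ₀.im| < Real.pi) (hξ : ξ ∈ logStrip) :
    dslope Complex.exp ξ₀ ξ ≠ 0 := by
  rcases eq_or_ne ξ ξ₀ with rfl | hne
  · rw [dslope_same, Complex.deriv_exp]
    exact Complex.exp_ne_zero _
  · rw [dslope_of_ne _ hne, slope_def_module]
    exact smul_ne_zero (inv_ne_zero (sub_ne_zero.2 hne)) (exp_ne_of_mem_logStrip hξ₀ hξ hne)

theorem cauchyKernel_of_ne {ξ ξ₀ : ℂ} (hne : ξ ≠ ξ₀) :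
    cauchyKernel K₁ K₂ ξ₀ ξ = (Complex.exp ξ / (Complex.exp ξ - Complex.exp ξ₀)) •
      (stripLift K₁ K₂ ξ - stripLift K₁ K₂ ξ₀) := by
  have h1 : ξ - ξ₀ ≠ 0 := sub_ne_zero.2 hne
  rw [cauchyKernel, dslope_of_ne _ hne, dslope_of_ne _ hne, slope_def_module, slope_def_module,
    smul_smul, smul_eq_mul]
  congr 1
  field_simp

theorem logStrip_mem_nhds {ξ : ℂ} (hξ : |ξ.im| < Real.pi) : logStrip ∈ 𝓝 ξ := by
  have h2 : IsOpen {ξ : ℂ | |ξ.im| < Real.pi} :=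
    isOpen_lt (continuous_abs.comp Complex.continuous_im) continuous_const
  filter_upwards [h2.mem_nhds hξ] with η hη
  have := abs_lt.1 hη
  exact ⟨this.1.le, this.2.le⟩

/-- Subtracting the value at ξ₀ makes the pole of Cauchy's integrand removable. Written as a
quotient of divided differences, the integrand is continuous at ξ₀ as well, which is all that the
rectangle theorem requires at an exceptional point. -/
theorem HasEdgeValues.continuousOn_cauchyKernel (h : HasEdgeValues K K₁ K₂ M α) {ξ₀ : ℂ}
    (hξ₀ : |ξ₀.im| < Real.pi) : ContinuousOn (cauchyKernel K₁ K₂ ξ₀) logStrip := by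
  have hn := logStrip_mem_nhds hξ₀
  refine ContinuousOn.smul (ContinuousOn.div Complex.continuous_exp.continuousOn
    ((continuousOn_dslope hn).2 ⟨Complex.continuous_exp.continuousOn,
      Complex.differentiableAt_exp⟩) fun ξ hξ => dslope_exp_ne_zero hξ₀ hξ) ?_
  exact (continuousOn_dslope hn).2 ⟨h.continuousOn_stripLift, h.differentiableAt_stripLift hξ₀⟩

theorem HasEdgeValues.differentiableAt_cauchyKernel (h : HasEdgeValues K K₁ K₂ M α) {ξ ξ₀ : ℂ}
    (hξ₀ : |ξ₀.im| < Real.pi) (hξ : |ξ.im| < Real.pi) (hne : ξ ≠ ξ₀) :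
    DifferentiableAt ℂ (cauchyKernel K₁ K₂ ξ₀) ξ := by
  refine DifferentiableAt.smul (DifferentiableAt.div Complex.differentiableAt_exp
    ((differentiableAt_dslope_of_ne hne).2 Complex.differentiableAt_exp)
    (dslope_exp_ne_zero hξ₀ (mem_of_mem_nhds (logStrip_mem_nhds hξ))))
    ((differentiableAt_dslope_of_ne hne).2 (h.differentiableAt_stripLift hξ))

theorem exp_add_pi_mul_I (u : ℝ) : Complex.exp (u + (Real.pi : ℝ) * Complex.I) = -(Real.exp u : ℂ) := by
  rw [Complex.exp_add, Complex.exp_pi_mul_I]; simp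

theorem exp_add_neg_pi_mul_I (u : ℝ) :
    Complex.exp (u + ((-Real.pi : ℝ) : ℂ) * Complex.I) = -(Real.exp u : ℂ) := by
  rw [Complex.exp_add, Complex.ofReal_neg, neg_mul, Complex.exp_neg, Complex.exp_pi_mul_I]
  simp

theorem add_ne_zero_of_re_pos {x : ℝ} {z : ℂ} (hx : 0 ≤ x) (hz : 0 < z.re) : (x : ℂ) + z ≠ 0 := by
  intro h
  have := congrArg Complex.re h
  simp at this
  linarith

/-- On both edges exp ξ = -exp u, so the scalar factors agree, the subtracted constant cancels, and
the jump of K remains. The factor exp u is the Jacobian of x = exp u. -/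
theorem cauchyKernel_sub {z : ℂ} (hz : 0 < z.re)
    (u : ℝ) :
    cauchyKernel K₁ K₂ (Complex.log z) (u + ((-Real.pi : ℝ) : ℂ) * Complex.I)
      - cauchyKernel K₁ K₂ (Complex.log z) (u + (Real.pi : ℝ) * Complex.I)
      = Real.exp u • (((Real.exp u : ℝ) : ℂ) + z)⁻¹ •
        (K₂ (-(Real.exp u : ℝ)) - K₁ (-(Real.exp u : ℝ))) := by
  have hpi := Real.pi_pos
  have hz0 : z ≠ 0 := by rintro rfl; simp at hz
  have harg : |(Complex.log z).im| < Real.pi / 2 := by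
    rw [Complex.log_im]; exact Complex.abs_arg_lt_pi_div_two_iff.2 (Or.inl hz)
  rw [abs_lt] at harg
  have h1 : (u : ℂ) + ((-Real.pi : ℝ) : ℂ) * Complex.I ≠ Complex.log z := by
    intro h
    have := congrArg Complex.im h
    simp at this
    linarith [harg.1]
  have h2 : (u : ℂ) + ((Real.pi : ℝ) : ℂ) * Complex.I ≠ Complex.log z := by
    intro h
    have := congrArg Complex.im h
    simp at this
    linarith [harg.2]
  rw [cauchyKernel_of_ne h1, cauchyKernel_of_ne h2, exp_add_pi_mul_I, exp_add_neg_pi_mul_I,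
    Complex.exp_log hz0, ← smul_sub, sub_sub_sub_cancel_right]
  have h3 : stripLift K₁ K₂ (u + ((Real.pi : ℝ) : ℂ) * Complex.I) = K₁ (-(Real.exp u : ℝ)) := by
    rw [stripLift, if_pos (by simpa using hpi.le), exp_add_pi_mul_I]
  have h4 : stripLift K₁ K₂ (u + ((-Real.pi : ℝ) : ℂ) * Complex.I) = K₂ (-(Real.exp u : ℝ)) := by
    rw [stripLift, if_neg (by simpa using hpi), exp_add_neg_pi_mul_I]
  rw [h3, h4, ← Complex.coe_smul (Real.exp u), smul_smul]
  congr 1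
  have h5 := add_ne_zero_of_re_pos (Real.exp_pos u).le hz
  rw [← neg_add', neg_div_neg_eq, div_eq_mul_inv]

/-- The integrand is dominated by x^(-α)/(x + Re z), integrable at 0 since α < 1 and at infinity
since α > 0. -/
theorem HasEdgeValues.integrableOn (h : HasEdgeValues K K₁ K₂ M α) (hα₀ : 0 < α) (hα₁ : α < 1)
    {z : ℂ} (hz : 0 < z.re) :
    IntegrableOn (fun x : ℝ => ((x : ℂ) + z)⁻¹ • (K₂ (-(x : ℝ)) - K₁ (-(x : ℝ)))) (Ioi 0) := by
  have hc₁ : ContinuousOn (fun x : ℝ => K₁ (-(x : ℝ))) (Ioi 0) :=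
    h.continuousOn_upper.comp (by fun_prop) fun x hx => by
      have : 0 < x := hx
      simp [this.ne']
  have hc₂ : ContinuousOn (fun x : ℝ => K₂ (-(x : ℝ))) (Ioi 0) :=
    h.continuousOn_lower.comp (by fun_prop) fun x hx => by
      have : 0 < x := hx
      simp [this.ne']
  have hc₃ : ContinuousOn (fun x : ℝ => ((x : ℂ) + z)⁻¹) (Ioi 0) :=
    ContinuousOn.inv₀ (by fun_prop) fun x hx => add_ne_zero_of_re_pos (le_of_lt hx) hz
  refine Integrable.mono' ((integrableOn_inv_add_mul_rpow hα₀ hα₁ hz).const_mul (2 * M))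
    ((hc₃.smul (hc₂.sub hc₁)).aestronglyMeasurable measurableSet_Ioi)
    ((ae_restrict_iff' measurableSet_Ioi).2 (Eventually.of_forall fun x hx => ?_))
  have hx' : 0 < x := hx
  rw [norm_smul, norm_inv]
  have h1 : x + z.re ≤ ‖(x : ℂ) + z‖ := by
    have := Complex.re_le_norm ((x : ℂ) + z)
    simpa using this
  have h2 := h.norm_upper_le (-(x : ℝ)) (by simp) (by simp [hx'.ne'])
  have h3 := h.norm_lower_le (-(x : ℝ)) (by simp) (by simp [hx'.ne'])
  rw [norm_neg, Complex.norm_real, Real.norm_of_nonneg hx'.le] at h2 h3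
  have h4 : ‖K₂ (-(x : ℝ)) - K₁ (-(x : ℝ))‖ ≤ 2 * M * x ^ (-α) :=
    (norm_sub_le _ _).trans (by linarith)
  calc _ ≤ (x + z.re)⁻¹ * (2 * M * x ^ (-α)) := by
        gcongr
    _ = _ := by ring

/-- Far to the right K tends to 0 because α > 0, and exp ξ/(exp ξ - z) tends to 1; only minus the
subtracted constant survives, over a side of length 2π. -/
theorem HasEdgeValues.tendsto_right [CompleteSpace E] (h : HasEdgeValues K K₁ K₂ M α) (hα₀ : 0 < α) {z : ℂ}
    (hz : 0 < z.re) :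
    Tendsto (fun L : ℝ => ∫ y in (-Real.pi)..Real.pi,
      cauchyKernel K₁ K₂ (Complex.log z) (L + y * Complex.I)) atTop
      (𝓝 (-((2 * Real.pi) • stripLift K₁ K₂ (Complex.log z)))) := by
  have hpi := Real.pi_pos
  have hz0 : z ≠ 0 := by rintro rfl; simp at hz
  have harg : |(Complex.log z).im| < Real.pi := by
    rw [Complex.log_im]
    exact (Complex.abs_arg_lt_pi_div_two_iff.2 (Or.inl hz)).trans (by linarith)
  set k := stripLift K₁ K₂ (Complex.log z) with hk
  have hM : 0 ≤ M := by
    have := (norm_nonneg _).trans (h.norm_upper_le 1 (by simp) one_ne_zero)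
    simpa using this
  have hbound : ∀ᶠ L : ℝ in atTop, ‖(∫ y in (-Real.pi)..Real.pi,
      cauchyKernel K₁ K₂ (Complex.log z) (L + y * Complex.I)) - (-((2 * Real.pi) • k))‖
      ≤ (2 * M * Real.exp L ^ (-α) + 2 * ‖z‖ * ‖k‖ * (Real.exp L)⁻¹) * |Real.pi - (-Real.pi)| := by
    filter_upwards [Real.tendsto_exp_atTop.eventually_ge_atTop (2 * ‖z‖ + 1)] with L hL
    have hstrip : ∀ y ∈ uIcc (-Real.pi) Real.pi, (L : ℂ) + y * Complex.I ∈ logStrip := by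
      intro y hy
      rw [uIcc_of_le (by linarith)] at hy
      simpa [logStrip] using hy
    have hcont : ContinuousOn (fun y : ℝ => cauchyKernel K₁ K₂ (Complex.log z)
        (L + y * Complex.I)) (uIcc (-Real.pi) Real.pi) :=
      (h.continuousOn_cauchyKernel harg).comp (by fun_prop) hstrip
    have h1 : (∫ y in (-Real.pi)..Real.pi,
        cauchyKernel K₁ K₂ (Complex.log z) (L + y * Complex.I)) - (-((2 * Real.pi) • k))
        = ∫ y in (-Real.pi)..Real.pi,
          (cauchyKernel K₁ K₂ (Complex.log z) (L + y * Complex.I) + k) := by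
      rw [intervalIntegral.integral_add hcont.intervalIntegrable intervalIntegrable_const,
        intervalIntegral.integral_const, sub_neg_eq_add]
      congr 2
      ring
    rw [h1]
    refine intervalIntegral.norm_integral_le_of_norm_le_const fun y hy => ?_
    have hy' := hstrip y (uIoc_subset_uIcc hy)
    set w := Complex.exp ((L : ℂ) + y * Complex.I) with hw
    have hnw : ‖w‖ = Real.exp L := by rw [hw, Complex.norm_exp]; simp
    have hz1 := norm_nonneg z
    have hwz : Real.exp L / 2 ≤ ‖w - z‖ := by
      have := norm_sub_norm_le w z
      linarith
    have hwz0 : w - z ≠ 0 := by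
      rw [← norm_pos_iff]; linarith
    have hne : (L : ℂ) + y * Complex.I ≠ Complex.log z := by
      intro h
      apply hwz0
      rw [hw, h, Complex.exp_log hz0, sub_self]
    rw [cauchyKernel_of_ne hne, Complex.exp_log hz0, ← hw, ← hk]
    set H := stripLift K₁ K₂ ((L : ℂ) + y * Complex.I) with hH
    have h2 : (w / (w - z)) • (H - k) + k = (w / (w - z)) • H - (z / (w - z)) • k := by
      have : z / (w - z) = w / (w - z) - 1 := by field_simp; ring
      rw [this, smul_sub, sub_smul, one_smul]
      abel
    rw [h2]
    have hHn : ‖H‖ ≤ M * Real.exp L ^ (-α) := by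
      have := h.norm_stripLift_le hy'
      simpa using this
    have h3 : ‖w / (w - z)‖ ≤ 2 := by
      rw [norm_div, hnw, div_le_iff₀ (norm_pos_iff.2 hwz0)]
      linarith
    have h4 : ‖z / (w - z)‖ ≤ 2 * ‖z‖ * (Real.exp L)⁻¹ := by
      rw [norm_div, div_le_iff₀ (norm_pos_iff.2 hwz0)]
      calc ‖z‖ = 2 * ‖z‖ * (Real.exp L)⁻¹ * (Real.exp L / 2) := by
            have := (Real.exp_pos L).ne'
            field_simp
        _ ≤ _ := by gcongr
    refine (norm_sub_le _ _).trans ?_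
    rw [norm_smul, norm_smul]
    calc _ ≤ 2 * (M * Real.exp L ^ (-α)) + 2 * ‖z‖ * (Real.exp L)⁻¹ * ‖k‖ := by gcongr
      _ = _ := by ring
  rw [tendsto_iff_norm_sub_tendsto_zero]
  refine squeeze_zero' (Eventually.of_forall fun L => norm_nonneg _) hbound ?_
  have h1 := ((tendsto_rpow_neg_atTop hα₀).comp Real.tendsto_exp_atTop).const_mul (2 * M)
  have h2 := (tendsto_inv_atTop_zero.comp Real.tendsto_exp_atTop).const_mul (2 * ‖z‖ * ‖k‖)
  have h3 := (h1.add h2).mul_const |Real.pi - (-Real.pi)|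
  simpa using h3

/-- Far to the left the integrand is O(|w| (|w|^(-α) + 1)) with w = exp ξ → 0, and this tends to 0
because α < 1. -/
theorem HasEdgeValues.tendsto_left (h : HasEdgeValues K K₁ K₂ M α) (hα₁ : α < 1) {z : ℂ}
    (hz : 0 < z.re) :
    Tendsto (fun L : ℝ => ∫ y in (-Real.pi)..Real.pi,
      cauchyKernel K₁ K₂ (Complex.log z) ((-L : ℝ) + y * Complex.I)) atTop (𝓝 0) := by
  have hpi := Real.pi_pos
  have hz0 : z ≠ 0 := by rintro rfl; simp at hz
  have hz1 : 0 < ‖z‖ := norm_pos_iff.2 hz0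
  set k := stripLift K₁ K₂ (Complex.log z) with hk
  have hM : 0 ≤ M := by
    have := (norm_nonneg _).trans (h.norm_upper_le 1 (by simp) one_ne_zero)
    simpa using this
  have hbound : ∀ᶠ L : ℝ in atTop, ‖∫ y in (-Real.pi)..Real.pi,
      cauchyKernel K₁ K₂ (Complex.log z) ((-L : ℝ) + y * Complex.I)‖
      ≤ (2 / ‖z‖ * (M * Real.exp L ^ (-(1 - α)) + ‖k‖ * (Real.exp L)⁻¹))
        * |Real.pi - (-Real.pi)| := by
    filter_upwards [Real.tendsto_exp_atTop.eventually_ge_atTop (2 / ‖z‖)] with L hL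
    refine intervalIntegral.norm_integral_le_of_norm_le_const fun y hy => ?_
    have hy' : (((-L : ℝ) : ℂ) + y * Complex.I) ∈ logStrip := by
      have := uIoc_subset_uIcc hy
      rw [uIcc_of_le (by linarith)] at this
      simpa [logStrip] using this
    set w := Complex.exp (((-L : ℝ) : ℂ) + y * Complex.I) with hw
    have hnw : ‖w‖ = (Real.exp L)⁻¹ := by rw [hw, Complex.norm_exp, ← Real.exp_neg]; simp
    have hinv : (Real.exp L)⁻¹ ≤ ‖z‖ / 2 := by
      have := inv_anti₀ (by positivity) hL
      rwa [inv_div] at this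
    have hwz : ‖z‖ / 2 ≤ ‖w - z‖ := by
      have := norm_sub_norm_le z w
      rw [norm_sub_rev] at this
      linarith
    have hwz0 : w - z ≠ 0 := by
      rw [← norm_pos_iff]; linarith
    have hne : ((-L : ℝ) : ℂ) + y * Complex.I ≠ Complex.log z := by
      intro h
      apply hwz0
      rw [hw, h, Complex.exp_log hz0, sub_self]
    rw [cauchyKernel_of_ne hne, Complex.exp_log hz0, ← hw, ← hk]
    set H := stripLift K₁ K₂ (((-L : ℝ) : ℂ) + y * Complex.I) with hH
    have hHn : ‖H‖ ≤ M * Real.exp L ^ α := by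
      have := h.norm_stripLift_le hy'
      rw [Complex.add_re, Complex.ofReal_re] at this
      simp only [Complex.mul_re, Complex.ofReal_re, Complex.I_re, mul_zero, Complex.ofReal_im,
        Complex.I_im, mul_one, sub_self, add_zero] at this
      rwa [Real.exp_neg, ← Real.rpow_neg_eq_inv_rpow, neg_neg] at this
    have h3 : ‖w / (w - z)‖ ≤ 2 / ‖z‖ * (Real.exp L)⁻¹ := by
      rw [norm_div, hnw, div_le_iff₀ (norm_pos_iff.2 hwz0)]
      calc (Real.exp L)⁻¹ = 2 / ‖z‖ * (Real.exp L)⁻¹ * (‖z‖ / 2) := by field_simp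
        _ ≤ _ := by gcongr
    have h5 : Real.exp L ^ (-(1 - α)) = (Real.exp L)⁻¹ * Real.exp L ^ α := by
      rw [neg_sub, Real.rpow_sub_one (Real.exp_pos L).ne', div_eq_inv_mul]
    rw [norm_smul, h5]
    calc _ ≤ 2 / ‖z‖ * (Real.exp L)⁻¹ * (M * Real.exp L ^ α + ‖k‖) := by
          gcongr
          exact (norm_sub_le _ _).trans (by gcongr)
      _ = _ := by ring
  refine squeeze_zero_norm' hbound ?_
  have h1 := ((tendsto_rpow_neg_atTop (sub_pos.2 hα₁)).comp Real.tendsto_exp_atTop).const_mul M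
  have h2 := (tendsto_inv_atTop_zero.comp Real.tendsto_exp_atTop).const_mul ‖k‖
  have h3 := ((h1.add h2).const_mul (2 / ‖z‖)).mul_const |Real.pi - (-Real.pi)|
  simpa using h3

/-- Cauchy's formula on the boundary of the plane cut along the negative real axis. -/
theorem HasEdgeValues.integral_eq [CompleteSpace E] (h : HasEdgeValues K K₁ K₂ M α) (hα₀ : 0 < α) (hα₁ : α < 1)
    {z : ℂ} (hz : 0 < z.re) :
    ∫ x in Ioi (0 : ℝ), ((x : ℂ) + z)⁻¹ • (K₂ (-(x : ℝ)) - K₁ (-(x : ℝ)))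
      = (2 * (Real.pi : ℂ) * Complex.I) • K z := by
  have hpi := Real.pi_pos
  have hz0 : z ≠ 0 := by rintro rfl; simp at hz
  have harg : |(Complex.log z).im| < Real.pi := by
    rw [Complex.log_im]
    exact (Complex.abs_arg_lt_pi_div_two_iff.2 (Or.inl hz)).trans (by linarith)
  have hk : stripLift K₁ K₂ (Complex.log z) = K z := by
    rw [h.stripLift_eq harg, Complex.exp_log hz0]
  set G : ℝ → E := fun x => ((x : ℂ) + z)⁻¹ • (K₂ (-(x : ℝ)) - K₁ (-(x : ℝ))) with hG
  set F := cauchyKernel K₁ K₂ (Complex.log z) with hF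
  have himage : Real.exp '' univ = Ioi 0 := by rw [image_univ, Real.range_exp]
  have hder : ∀ x ∈ (univ : Set ℝ), HasDerivWithinAt Real.exp (Real.exp x) univ x := fun x _ =>
    (Real.hasDerivAt_exp x).hasDerivWithinAt
  -- The substitution x = exp u converts the integral over the cut into one along a horizontal line.
  have hsubst : ∫ u : ℝ, Real.exp u • G (Real.exp u) = ∫ x in Ioi 0, G x := by
    have := integral_image_eq_integral_abs_deriv_smul MeasurableSet.univ hder
      Real.exp_injective.injOn G
    rw [himage, setIntegral_univ] at this
    rw [this]
    simp only [Real.abs_exp]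
  have hint : Integrable fun u : ℝ => Real.exp u • G (Real.exp u) := by
    have := (integrableOn_image_iff_integrableOn_abs_deriv_smul MeasurableSet.univ hder
      Real.exp_injective.injOn G).1 (by rw [himage]; exact h.integrableOn hα₀ hα₁ hz)
    rw [integrableOn_univ] at this
    simpa only [Real.abs_exp] using this
  have hlim := (intervalIntegral_tendsto_integral hint tendsto_neg_atTop_atBot tendsto_id)
  rw [hsubst] at hlim
  have hR := h.tendsto_right hα₀ hz
  have hL := h.tendsto_left hα₁ hz
  -- Cauchy's theorem on the rectangle [-L, L] × [-π, π], with log z as the only point where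
  -- differentiability is not checked. The two horizontal sides are merged into the jump integral.
  have hrect : ∀ L : ℝ, 0 ≤ L → (∫ u in (-L)..L, Real.exp u • G (Real.exp u))
      + Complex.I • (∫ y in (-Real.pi)..Real.pi, F (L + y * Complex.I))
      - Complex.I • (∫ y in (-Real.pi)..Real.pi, F ((-L : ℝ) + y * Complex.I)) = 0 := by
    intro L hL0
    have h1 := Complex.integral_boundary_rect_eq_zero_of_differentiable_on_off_countable F
      ⟨-L, -Real.pi⟩ ⟨L, Real.pi⟩ {Complex.log z} (countable_singleton _)
      ((h.continuousOn_cauchyKernel harg).mono fun ξ hξ => by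
        have := hξ.2
        rw [mem_preimage, uIcc_of_le (by simp; linarith)] at this
        exact this) (fun ξ hξ => by
        have h2 := hξ.1.2
        rw [mem_preimage] at h2
        rw [min_eq_left (by simp; linarith), max_eq_right (by simp; linarith)] at h2
        exact h.differentiableAt_cauchyKernel harg (abs_lt.2 h2) hξ.2)
    simp only at h1
    have hc : ∀ c : ℝ, -Real.pi ≤ c → c ≤ Real.pi →
        IntervalIntegrable (fun u : ℝ => F (u + (c : ℂ) * Complex.I)) volume (-L) L := by
      intro c hc1 hc2
      refine Continuous.intervalIntegrable ?_ _ _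
      rw [← continuousOn_univ]
      refine (h.continuousOn_cauchyKernel harg).comp (by fun_prop) fun u _ => ?_
      simpa [logStrip] using ⟨hc1, hc2⟩
    rw [← intervalIntegral.integral_sub (hc _ le_rfl (by linarith)) (hc _ (by linarith) le_rfl)] at h1
    simp only [hF, cauchyKernel_sub hz] at h1
    exact h1
  have hzero : Tendsto (fun L : ℝ => (∫ u in (-L)..L, Real.exp u • G (Real.exp u))
      + Complex.I • (∫ y in (-Real.pi)..Real.pi, F (L + y * Complex.I))
      - Complex.I • (∫ y in (-Real.pi)..Real.pi, F ((-L : ℝ) + y * Complex.I))) atTop (𝓝 0) :=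
    tendsto_const_nhds.congr' (by
      filter_upwards [eventually_ge_atTop 0] with L hL0 using (hrect L hL0).symm)
  have huniq := tendsto_nhds_unique hzero
    ((hlim.add (hR.const_smul Complex.I)).sub (hL.const_smul Complex.I))
  rw [smul_zero, sub_zero, hk, smul_neg, ← sub_eq_add_neg, eq_comm, sub_eq_zero] at huniq
  rw [huniq, ← Complex.coe_smul, smul_smul]
  congr 1
  push_cast
  ring

end Cauchy

end RKgCQ

/-! ### Uniqueness of Laplace transforms and the iterated Laplace transform. -/

namespace RKgCQ

open MeasureTheory

section Laplace

variable {E : Type*} [NormedAddCommGroup E] [NormedSpace ℂ E]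

open scoped FourierTransform SchwartzMap in
/-- Integrable functions are determined by their Fourier transform. -/
theorem ae_eq_zero_of_fourier_eq_zero [CompleteSpace E] {h : ℝ → E} (hi : Integrable h)
    (h0 : ∀ w, 𝓕 h w = 0) : ∀ᵐ t, h t = 0 := by
  refine ae_eq_zero_of_integral_contDiff_smul_eq_zero hi.locallyIntegrable fun g hg hgc => ?_
  have hg₁ : HasCompactSupport (Complex.ofRealCLM ∘ g) := hgc.comp_left rfl
  have hg₂ : ContDiff ℝ ∞ (Complex.ofRealCLM ∘ g) := by fun_prop
  -- Every test function is the Fourier transform of a Schwartz function ψ; moving the transform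
  -- onto h shows that h annihilates all test functions.
  set φ : 𝓢(ℝ, ℂ) := hg₁.toSchwartzMap hg₂ with hφ
  set ψ : 𝓢(ℝ, ℂ) := 𝓕⁻ φ with hψ
  have h1 : ∫ ξ, 𝓕 (ψ : ℝ → ℂ) ξ • h ξ = ∫ x, ψ x • 𝓕 h x := by
    have := VectorFourier.integral_fourierIntegral_smul_eq_flip (f := ψ) (g := h) (μ := volume)
      (ν := volume) (L := innerₗ ℝ) Real.continuous_fourierChar continuous_inner ψ.integrable hi
    rw [flip_innerₗ] at this
    exact this
  have h2 : ∀ ξ, 𝓕 (ψ : ℝ → ℂ) ξ = (g ξ : ℂ) := by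
    intro ξ
    rw [← SchwartzMap.fourier_coe, hψ, FourierTransform.fourier_fourierInv_eq]
    rfl
  simp only [h2, h0, smul_zero, integral_zero, Complex.coe_smul] at h1
  exact h1

/-- Functions on the half-line are determined by their Laplace transform. -/
theorem ae_eq_zero_of_laplace_eq_zero [CompleteSpace E] {h : ℝ → E} {σ : ℝ}
    (hL : ∀ z : ℂ, σ < z.re → IntegrableOn (fun t : ℝ => Complex.exp (-z * t) • h t) (Ioi 0) ∧
      ∫ t in Ioi (0 : ℝ), Complex.exp (-z * t) • h t = 0) :
    ∀ᵐ t, t ∈ Ioi (0 : ℝ) → h t = 0 := by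
  have hs : ∀ w : ℝ, σ < (((σ + 1 : ℝ) : ℂ) + 2 * Real.pi * w * Complex.I).re := by
    intro w; simp
  -- On the vertical line Re z = σ + 1 the Laplace transform is the Fourier transform of the damped
  -- function h', at frequency w for z = σ + 1 + 2πiw.
  set h' : ℝ → E := (Ioi 0).indicator fun t => Complex.exp (-((σ + 1 : ℝ) : ℂ) * t) • h t with hh'
  have hi : Integrable h' := by
    rw [hh', integrable_indicator_iff measurableSet_Ioi]
    have := (hL _ (hs 0)).1
    simpa using this
  have hF : ∀ w, FourierTransform.fourier h' w = 0 := by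
    intro w
    rw [Real.fourier_real_eq_integral_exp_smul, ← (hL _ (hs w)).2,
      ← integral_indicator measurableSet_Ioi]
    refine integral_congr_ae (Eventually.of_forall fun t => ?_)
    by_cases ht : t ∈ Ioi (0 : ℝ)
    · simp only [hh', indicator_of_mem ht]
      rw [smul_smul, ← Complex.exp_add]
      congr 2
      push_cast
      ring
    · simp only [hh', indicator_of_notMem ht, smul_zero]
  filter_upwards [ae_eq_zero_of_fourier_eq_zero hi hF] with t ht ht0
  rw [hh', indicator_of_mem ht0] at ht
  exact (smul_eq_zero.1 ht).resolve_left (Complex.exp_ne_zero _)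

/-- The Laplace transform of a Laplace transform is a Stieltjes transform. -/
theorem laplace_laplace [CompleteSpace E] {J : ℝ → E} {B α : ℝ} (hα₀ : 0 < α) (hα₁ : α < 1)
    (hJm : AEStronglyMeasurable J (volume.restrict (Ioi 0)))
    (hJ : ∀ x, 0 < x → ‖J x‖ ≤ B * x ^ (-α)) {z : ℂ} (hz : 0 < z.re) :
    IntegrableOn (fun t : ℝ => Complex.exp (-z * t) • ∫ x in Ioi (0 : ℝ), Real.exp (-(x * t)) • J x)
        (Ioi 0) ∧
      ∫ t in Ioi (0 : ℝ), Complex.exp (-z * t) • ∫ x in Ioi (0 : ℝ), Real.exp (-(x * t)) • J x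
        = ∫ x in Ioi (0 : ℝ), ((x : ℂ) + z)⁻¹ • J x := by
  set f : ℝ → ℝ → E := fun x t => Complex.exp (-((x : ℂ) + z) * t) • J x with hf
  have hre : ∀ x : ℝ, 0 < x → (-((x : ℂ) + z)).re < 0 := fun x hx => by simp; linarith
  have hmeas : AEStronglyMeasurable (Function.uncurry f)
      ((volume.restrict (Ioi 0)).prod (volume.restrict (Ioi 0))) := by
    refine AEStronglyMeasurable.smul (𝕜 := ℂ)
      (f := fun w : ℝ × ℝ => Complex.exp (-((w.1 : ℂ) + z) * w.2)) (g := fun w => J w.1) ?_ ?_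
    · exact (by fun_prop : Continuous fun w : ℝ × ℝ =>
        Complex.exp (-((w.1 : ℂ) + z) * w.2)).aestronglyMeasurable
    · exact hJm.comp_fst
  -- The inner integral of the norms is |J(x)|/(x + Re z), whose integrability in x justifies
  -- Fubini.
  have hnorm : ∀ x : ℝ, 0 < x →
      ∫ t in Ioi (0 : ℝ), ‖Function.uncurry f (x, t)‖ = (x + z.re)⁻¹ * ‖J x‖ := by
    intro x hx
    have h1 : ∀ t : ℝ, ‖Function.uncurry f (x, t)‖ = Real.exp (-(x + z.re) * t) * ‖J x‖ := by
      intro t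
      simp only [Function.uncurry, hf]
      rw [norm_smul, Complex.norm_exp]
      simp
    simp only [h1]
    rw [integral_mul_const, integral_exp_mul_Ioi (by linarith), mul_zero, Real.exp_zero,
      neg_div_neg_eq, one_div]
  have hint : Integrable (Function.uncurry f)
      ((volume.restrict (Ioi 0)).prod (volume.restrict (Ioi 0))) := by
    rw [integrable_prod_iff hmeas]
    constructor
    · refine (ae_restrict_iff' measurableSet_Ioi).2 (Eventually.of_forall fun x hx => ?_)
      exact (integrableOn_exp_mul_complex_Ioi (hre x hx) 0).smul_const (J x)
    · refine Integrable.mono' ((integrableOn_inv_add_mul_rpow hα₀ hα₁ hz).const_mul B)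
        hmeas.norm.integral_prod_right'
        ((ae_restrict_iff' measurableSet_Ioi).2 (Eventually.of_forall fun x hx => ?_))
      have hx' : 0 < x := hx
      rw [hnorm x hx, Real.norm_of_nonneg (by positivity)]
      calc _ ≤ (x + z.re)⁻¹ * (B * x ^ (-α)) := by
            gcongr
            exact hJ x hx
        _ = _ := by ring
  have hinner : ∀ t : ℝ, ∫ x in Ioi (0 : ℝ), f x t
      = Complex.exp (-z * t) • ∫ x in Ioi (0 : ℝ), Real.exp (-(x * t)) • J x := by
    intro t
    rw [← integral_smul]
    refine integral_congr_ae (Eventually.of_forall fun x => ?_)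
    simp only [hf]
    rw [← Complex.coe_smul, smul_smul, Complex.ofReal_exp, ← Complex.exp_add]
    congr 2
    push_cast
    ring
  constructor
  · have := hint.integral_prod_right
    simp only [Function.uncurry] at this
    rw [IntegrableOn]
    simpa only [hinner] using this
  · simp only [← hinner]
    rw [← integral_integral_swap hint]
    refine setIntegral_congr_fun measurableSet_Ioi fun x hx => ?_
    simp only [hf]
    rw [integral_smul_const, integral_exp_mul_complex_Ioi (hre x hx), Complex.ofReal_zero, mul_zero,
      Complex.exp_zero, neg_div_neg_eq, one_div]

end Laplace

/-! ### The jump representation of the kernel and of the quadrature error. -/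

section Jump

variable {X Y : Type*} [NormedAddCommGroup X] [NormedSpace ℂ X]
  [NormedAddCommGroup Y] [NormedSpace ℂ Y] {K : ℂ → X →L[ℂ] Y} {M α : ℝ}

theorem neBot_nhdsWithin_im_pos {w : ℂ} (hw : 0 ≤ w.im) : (𝓝[{z : ℂ | 0 < z.im}] w).NeBot := by
  rw [← mem_closure_iff_nhdsWithin_neBot, Complex.closure_setOfPred_lt_im]
  exact hw

theorem neBot_nhdsWithin_im_neg {w : ℂ} (hw : w.im ≤ 0) : (𝓝[{z : ℂ | z.im < 0}] w).NeBot := by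
  rw [← mem_closure_iff_nhdsWithin_neBot, Complex.closure_setOfPred_im_lt]
  exact hw

/-- Boundary values are limits from an open half-plane. They inherit the bound by passage to the
limit, and off the cut they agree with K by continuity. -/
theorem eq_and_norm_le_of_tendsto {E : Type*} [NormedAddCommGroup E] [NormedSpace ℂ E]
    {K K₁ : ℂ → E} {M α : ℝ} {U : Set ℂ} (hU : U ⊆ Complex.slitPlane)
    (hd : DifferentiableOn ℂ K Complex.slitPlane)
    (hb : ∀ z ∈ Complex.slitPlane, ‖K z‖ ≤ M * ‖z‖ ^ (-α)) {w : ℂ} (hw : w ≠ 0)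
    (hne : (𝓝[U] w).NeBot) (ht : Tendsto K (𝓝[U] w) (𝓝 (K₁ w))) :
    (w ∈ Complex.slitPlane → K₁ w = K w) ∧ ‖K₁ w‖ ≤ M * ‖w‖ ^ (-α) := by
  constructor
  · intro hw'
    exact tendsto_nhds_unique ht ((hd.differentiableAt
      (Complex.isOpen_slitPlane.mem_nhds hw')).continuousAt.tendsto.mono_left nhdsWithin_le_nhds)
  · have h1 : Tendsto (fun z : ℂ => M * ‖z‖ ^ (-α)) (𝓝[U] w) (𝓝 (M * ‖w‖ ^ (-α))) := by
      have : ContinuousAt (fun z : ℂ => M * ‖z‖ ^ (-α)) w :=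
        continuousAt_const.mul (continuous_norm.continuousAt.rpow_const
          (Or.inl (norm_ne_zero_iff.2 hw)))
      exact this.tendsto.mono_left nhdsWithin_le_nhds
    refine le_of_tendsto_of_tendsto ht.norm h1 ?_
    filter_upwards [self_mem_nhdsWithin] with z hz using hb z (hU hz)

theorem IsSectorial.exists_hasEdgeValues (h : IsSectorial K M α) :
    ∃ K₁ K₂ : ℂ → X →L[ℂ] Y, HasEdgeValues K K₁ K₂ M α ∧
      ∀ x : ℝ, 0 < x → upperTrace K x = K₁ (-(x : ℂ)) ∧ lowerTrace K x = K₂ (-(x : ℂ)) := by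
  obtain ⟨K₁, hc₁, he₁⟩ := h.continuous_upper
  obtain ⟨K₂, hc₂, he₂⟩ := h.continuous_lower
  have ht₁ : ∀ w : ℂ, 0 ≤ w.im → w ≠ 0 → Tendsto K (𝓝[{z : ℂ | 0 < z.im}] w) (𝓝 (K₁ w)) := by
    intro w hw hw0
    have h1 : Tendsto K₁ (𝓝[{z : ℂ | 0 < z.im}] w) (𝓝 (K₁ w)) :=
      (hc₁ w ⟨hw, hw0⟩).mono_left (nhdsWithin_mono _ fun z hz => by
        have hz' : 0 < z.im := hz
        exact ⟨hz'.le, fun h0 => by simp [h0] at hz'⟩)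
    refine h1.congr' ?_
    filter_upwards [self_mem_nhdsWithin] with z hz using he₁ hz
  have ht₂ : ∀ w : ℂ, w.im ≤ 0 → w ≠ 0 → Tendsto K (𝓝[{z : ℂ | z.im < 0}] w) (𝓝 (K₂ w)) := by
    intro w hw hw0
    have h1 : Tendsto K₂ (𝓝[{z : ℂ | z.im < 0}] w) (𝓝 (K₂ w)) :=
      (hc₂ w ⟨hw, hw0⟩).mono_left (nhdsWithin_mono _ fun z hz => by
        have hz' : z.im < 0 := hz
        exact ⟨hz'.le, fun h0 => by simp [h0] at hz'⟩)
    refine h1.congr' ?_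
    filter_upwards [self_mem_nhdsWithin] with z hz using he₂ hz
  have hU₁ : {z : ℂ | 0 < z.im} ⊆ Complex.slitPlane := fun z hz => Or.inr (ne_of_gt hz)
  have hU₂ : {z : ℂ | z.im < 0} ⊆ Complex.slitPlane := fun z hz => Or.inr (ne_of_lt hz)
  have h1 := fun (w : ℂ) (hw : 0 ≤ w.im) (hw0 : w ≠ 0) => eq_and_norm_le_of_tendsto hU₁
    h.holomorphic h.bound hw0 (neBot_nhdsWithin_im_pos hw) (ht₁ w hw hw0)
  have h2 := fun (w : ℂ) (hw : w.im ≤ 0) (hw0 : w ≠ 0) => eq_and_norm_le_of_tendsto hU₂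
    h.holomorphic h.bound hw0 (neBot_nhdsWithin_im_neg hw) (ht₂ w hw hw0)
  refine ⟨K₁, K₂, ⟨h.holomorphic, hc₁, hc₂,
    fun z hz hz' => (h1 z hz' (Complex.slitPlane_ne_zero hz)).1 hz,
    fun z hz hz' => (h2 z hz' (Complex.slitPlane_ne_zero hz)).1 hz,
    fun z hz hz' => (h1 z hz hz').2, fun z hz hz' => (h2 z hz hz').2⟩, fun x hx => ⟨?_, ?_⟩⟩
  · have := neBot_nhdsWithin_im_pos (w := -(x : ℂ)) (by simp)
    exact (ht₁ (-(x : ℂ)) (by simp) (by simp [hx.ne'])).limUnder_eq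
  · have := neBot_nhdsWithin_im_neg (w := -(x : ℂ)) (by simp)
    exact (ht₂ (-(x : ℂ)) (by simp) (by simp [hx.ne'])).limUnder_eq

/-- The three facts about the jump on which everything else rests: measurability, the bound (M/π)
x^(-α), and the Stieltjes representation of K from Cauchy's formula. -/
theorem IsSectorial.jump_spec [CompleteSpace Y] (h : IsSectorial K M α) (hα₀ : 0 < α)
    (hα₁ : α < 1) :
    AEStronglyMeasurable (jump K) (volume.restrict (Ioi 0)) ∧
      (∀ x, 0 < x → ‖jump K x‖ ≤ M / Real.pi * x ^ (-α)) ∧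
      ∀ z : ℂ, 0 < z.re → ∫ x in Ioi (0 : ℝ), ((x : ℂ) + z)⁻¹ • jump K x = K z := by
  obtain ⟨K₁, K₂, hK, htr⟩ := h.exists_hasEdgeValues
  have hpi : (2 * (Real.pi : ℂ) * Complex.I) ≠ 0 := Complex.two_pi_I_ne_zero
  have hj : ∀ x ∈ Ioi (0 : ℝ), jump K x
      = (2 * (Real.pi : ℂ) * Complex.I)⁻¹ • (K₂ (-(x : ℂ)) - K₁ (-(x : ℂ))) := by
    intro x hx
    rw [jump, (htr x hx).1, (htr x hx).2]
  refine ⟨?_, fun x hx => ?_, fun z hz => ?_⟩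
  · have hc₁ : ContinuousOn (fun x : ℝ => K₁ (-(x : ℂ))) (Ioi 0) :=
      hK.continuousOn_upper.comp (by fun_prop) fun x hx => by
        have : 0 < x := hx
        simp [this.ne']
    have hc₂ : ContinuousOn (fun x : ℝ => K₂ (-(x : ℂ))) (Ioi 0) :=
      hK.continuousOn_lower.comp (by fun_prop) fun x hx => by
        have : 0 < x := hx
        simp [this.ne']
    exact (((hc₂.sub hc₁).const_smul (2 * (Real.pi : ℂ) * Complex.I)⁻¹).congr
      hj).aestronglyMeasurable measurableSet_Ioi
  · have h2 := hK.norm_upper_le (-(x : ℂ)) (by simp) (by simp [hx.ne'])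
    have h3 := hK.norm_lower_le (-(x : ℂ)) (by simp) (by simp [hx.ne'])
    rw [norm_neg, Complex.norm_real, Real.norm_of_nonneg hx.le] at h2 h3
    have h4 := norm_sub_le (K₂ (-(x : ℂ))) (K₁ (-(x : ℂ)))
    have h5 : ‖(2 * (Real.pi : ℂ) * Complex.I)⁻¹‖ = (2 * Real.pi)⁻¹ := by
      simp [abs_of_pos Real.pi_pos]
    have hpi' := Real.pi_pos
    rw [hj x hx, norm_smul, h5]
    calc _ ≤ (2 * Real.pi)⁻¹ * (M * x ^ (-α) + M * x ^ (-α)) := by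
          gcongr
          exact h4.trans (add_le_add h3 h2)
      _ = _ := by field_simp; ring
  · have h1 : ∀ x ∈ Ioi (0 : ℝ), ((x : ℂ) + z)⁻¹ • jump K x
        = (2 * (Real.pi : ℂ) * Complex.I)⁻¹ •
          ((x : ℂ) + z)⁻¹ • (K₂ (-(x : ℂ)) - K₁ (-(x : ℂ))) := by
      intro x hx
      rw [hj x hx, smul_comm]
    rw [setIntegral_congr_fun measurableSet_Ioi h1, integral_smul, hK.integral_eq hα₀ hα₁ hz,
      inv_smul_smul₀ hpi]

/-- The kernel is the Laplace transform of the jump of its own Laplace transform. -/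
theorem IsLaplaceTransform.ae_eq [CompleteSpace Y] {k : ℝ → X →L[ℂ] Y}
    (hk : IsLaplaceTransform k K) (h : IsSectorial K M α) (hα₀ : 0 < α) (hα₁ : α < 1) :
    ∀ᵐ t, t ∈ Ioi (0 : ℝ) → k t = ∫ x in Ioi (0 : ℝ), Real.exp (-(x * t)) • jump K x := by
  obtain ⟨σ, hσ, hk⟩ := hk
  obtain ⟨hJm, hJ, hJz⟩ := h.jump_spec hα₀ hα₁
  have := ae_eq_zero_of_laplace_eq_zero (σ := σ)
    (h := fun t => k t - ∫ x in Ioi (0 : ℝ), Real.exp (-(x * t)) • jump K x) fun z hz => by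
      have hz0 : 0 < z.re := hσ.trans_lt hz
      obtain ⟨h1, h2⟩ := hk z hz
      obtain ⟨h3, h4⟩ := laplace_laplace hα₀ hα₁ hJm hJ hz0
      simp only [smul_sub]
      refine ⟨h1.sub h3, ?_⟩
      rw [integral_sub h1 h3, h2, h4, hJz z hz0, sub_self]
  filter_upwards [this] with t ht ht0 using sub_eq_zero.1 (ht ht0)

theorem integral_exp_le {x b : ℝ} (hx : 0 < x) (hb : 0 ≤ b) :
    ∫ r in (0 : ℝ)..b, Real.exp (-(x * (b - r))) ≤ max 1 b * min 1 x⁻¹ := by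
  have h1 : ∫ r in (0 : ℝ)..b, Real.exp (-(x * (b - r))) = expPrim x 1 b := by
    rw [intervalIntegral.integral_comp_sub_left (fun v => Real.exp (-(x * v)))]
    simp [expPrim]
  have h2 := expPrim_succ_le hx 0 hb
  have h3 := expPrim_le_pow hx.le 1 hb
  rw [pow_zero, one_div] at h2
  rw [zero_add] at h2
  rw [pow_one] at h3
  rw [h1, mul_min_of_nonneg _ _ (by positivity)]
  refine le_min ?_ (h2.trans (le_mul_of_one_le_left (by positivity) (le_max_left _ _)))
  rw [mul_one]
  exact h3.trans (le_max_right _ _)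

/-- For t > 0 the exponential is dominated by 1/(1 + xt), which reduces the claim to the weight
already treated. At t = 0 this fails, so the endpoint is excluded later as a null set. -/
theorem integrableOn_exp_smul_of_norm_le {E : Type*} [NormedAddCommGroup E] [NormedSpace ℂ E]
    {J : ℝ → E} {B : ℝ} (hα₀ : 0 < α) (hα₁ : α < 1)
    (hJm : AEStronglyMeasurable J (volume.restrict (Ioi 0)))
    (hJ : ∀ x, 0 < x → ‖J x‖ ≤ B * x ^ (-α)) {t : ℝ} (ht : 0 < t) :
    IntegrableOn (fun x => Real.exp (-(x * t)) • J x) (Ioi 0) := by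
  refine Integrable.mono' ((integrableOn_inv_add_mul_rpow hα₀ hα₁ (inv_pos.2 ht)).const_mul
    (t⁻¹ * B)) (AEStronglyMeasurable.smul (𝕜 := ℝ) (f := fun x : ℝ => Real.exp (-(x * t)))
      (by fun_prop : Continuous fun x : ℝ => Real.exp (-(x * t))).aestronglyMeasurable hJm)
    ((ae_restrict_iff' measurableSet_Ioi).2 (Eventually.of_forall fun x hx => ?_))
  have hx' : 0 < x := hx
  have h1 : Real.exp (-(x * t)) ≤ t⁻¹ * (x + t⁻¹)⁻¹ := by
    rw [Real.exp_neg, ← mul_inv]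
    refine inv_anti₀ (by positivity) ?_
    have : t * (x + t⁻¹) = x * t + 1 := by field_simp
    rw [this]
    exact Real.add_one_le_exp _
  rw [norm_smul, Real.norm_of_nonneg (Real.exp_pos _).le]
  calc _ ≤ t⁻¹ * (x + t⁻¹)⁻¹ * (B * x ^ (-α)) := by
        gcongr
        exact hJ x hx
    _ = _ := by ring

/-- Fubini. The time integral of exp(-x(b-r)) is O(min(1, 1/x)), and against x^(-α) this is
integrable. -/
theorem integral_jump_odeSol [CompleteSpace X] [CompleteSpace Y] {J : ℝ → X →L[ℂ] Y} {B S b : ℝ}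
    (hα₀ : 0 < α) (hα₁ : α < 1) (hJm : AEStronglyMeasurable J (volume.restrict (Ioi 0)))
    (hJ : ∀ x, 0 < x → ‖J x‖ ≤ B * x ^ (-α)) (hb : 0 ≤ b) {f : ℝ → X}
    (hfm : AEStronglyMeasurable f (volume.restrict (Ioc 0 b)))
    (hf : ∀ r ∈ Ioc 0 b, ‖f r‖ ≤ S) :
    IntegrableOn (fun x => J x (odeSol x f b)) (Ioi 0) ∧
      ∫ x in Ioi (0 : ℝ), J x (odeSol x f b)
        = ∫ r in (0 : ℝ)..b, (∫ x in Ioi (0 : ℝ), Real.exp (-(x * (b - r))) • J x) (f r) := by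
  set F : ℝ → ℝ → Y := fun x r => Real.exp (-(x * (b - r))) • J x (f r) with hF
  have hfi : IntegrableOn f (Ioc 0 b) :=
    Integrable.of_bound hfm S
      ((ae_restrict_iff' measurableSet_Ioc).2 (Eventually.of_forall hf))
  have hmeas : AEStronglyMeasurable (Function.uncurry F)
      ((volume.restrict (Ioi 0)).prod (volume.restrict (Ioc 0 b))) := by
    refine AEStronglyMeasurable.smul (𝕜 := ℝ)
      (f := fun w : ℝ × ℝ => Real.exp (-(w.1 * (b - w.2)))) (g := fun w => J w.1 (f w.2)) ?_ ?_
    · exact (by fun_prop : Continuous fun w : ℝ × ℝ =>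
        Real.exp (-(w.1 * (b - w.2)))).aestronglyMeasurable
    · exact isBoundedBilinearMap_apply.continuous.comp_aestronglyMeasurable
        (hJm.comp_fst.prodMk hfm.comp_snd)
  have hsol : ∀ x, ∫ r in Ioc 0 b, F x r = J x (odeSol x f b) := by
    intro x
    rw [odeSol, intervalIntegral.integral_of_le hb, ← ContinuousLinearMap.integral_comp_comm]
    · simp only [hF, ContinuousLinearMap.map_smul_of_tower]
    · exact (intervalIntegrable_iff_integrableOn_Ioc_of_le hb).1 (intervalIntegrable_exp_smul
        ((intervalIntegrable_iff_integrableOn_Ioc_of_le hb).2 hfi) x)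
  have hint : Integrable (Function.uncurry F)
      ((volume.restrict (Ioi 0)).prod (volume.restrict (Ioc 0 b))) := by
    rw [integrable_prod_iff hmeas]
    constructor
    · refine Eventually.of_forall fun x => ?_
      have h1 : IntegrableOn (fun r => J x (f r)) (Ioc 0 b) := (J x).integrable_comp hfi
      exact (intervalIntegrable_iff_integrableOn_Ioc_of_le hb).1 (intervalIntegrable_exp_smul
        ((intervalIntegrable_iff_integrableOn_Ioc_of_le hb).2 h1) x)
    · refine Integrable.mono' ((integrableOn_rpow_neg_mul_min hα₀ hα₁).const_mul
        (B * |S| * max 1 b)) hmeas.norm.integral_prod_right'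
        ((ae_restrict_iff' measurableSet_Ioi).2 (Eventually.of_forall fun x hx => ?_))
      have hx' : 0 < x := hx
      have h0 : 0 ≤ B * x ^ (-α) := (norm_nonneg _).trans (hJ x hx)
      rw [Real.norm_of_nonneg (integral_nonneg fun r => norm_nonneg _)]
      have h1 : ∫ r in Ioc 0 b, ‖Function.uncurry F (x, r)‖
          ≤ ∫ r in Ioc 0 b, Real.exp (-(x * (b - r))) * (B * x ^ (-α) * |S|) := by
        refine integral_mono_of_nonneg (Eventually.of_forall fun r => norm_nonneg _) ?_
          ((ae_restrict_iff' measurableSet_Ioc).2 (Eventually.of_forall fun r hr => ?_))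
        · exact (by fun_prop : Continuous fun r : ℝ => Real.exp (-(x * (b - r))) *
            (B * x ^ (-α) * |S|)).integrableOn_Ioc
        · simp only [Function.uncurry, hF]
          rw [norm_smul, Real.norm_of_nonneg (Real.exp_pos _).le]
          gcongr
          refine ((J x).le_opNorm _).trans ?_
          gcongr
          · exact hJ x hx
          · exact (hf r hr).trans (le_abs_self S)
      refine h1.trans ?_
      rw [integral_mul_const, ← intervalIntegral.integral_of_le hb]
      calc _ ≤ max 1 b * min 1 x⁻¹ * (B * x ^ (-α) * |S|) := by
            gcongr
            exact integral_exp_le hx' hb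
        _ = _ := by ring
  constructor
  · have := hint.integral_prod_left
    simp only [Function.uncurry] at this
    rw [IntegrableOn]
    simpa only [hsol] using this
  · simp only [← hsol]
    rw [integral_integral_swap hint, intervalIntegral.integral_of_le hb]
    refine integral_congr_ae ((ae_restrict_iff' measurableSet_Ioc).2 ?_)
    filter_upwards [volume.ae_ne b] with r hrb hr
    have hr' : 0 < b - r := sub_pos.2 (lt_of_le_of_ne hr.2 hrb)
    rw [ContinuousLinearMap.integral_apply
      (integrableOn_exp_smul_of_norm_le hα₀ hα₁ hJm hJ hr')]
    rfl

/-- The error of the quadrature is controlled by the errors for the scalar test problems. -/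
theorem norm_convolution_sub_gCQ_le [CompleteSpace X] [CompleteSpace Y] {s : ℕ} {rk : RKMethod s}
    {k : ℝ → X →L[ℂ] Y} (hk : IsLaplaceTransform k K) (h : IsSectorial K M α) (hM : 0 < M)
    (hα₀ : 0 < α) (hα₁ : α < 1) {t : ℕ → ℝ} {n : ℕ} (hn : 0 ≤ t n) {f : ℝ → X} {S D : ℝ}
    (hfm : AEStronglyMeasurable f (volume.restrict (Ioc 0 (t n))))
    (hf : ∀ r ∈ Ioc 0 (t n), ‖f r‖ ≤ S) (hD : 0 ≤ D)
    (herr : errorNorm α rk t n f ≤ ENNReal.ofReal D) :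
    ‖convolution k f (t n) - gCQ rk K t f n‖ ≤ M / Real.pi * D := by
  obtain ⟨hJm, hJ, -⟩ := h.jump_spec hα₀ hα₁
  have hpi := Real.pi_pos
  obtain ⟨hsol, hval⟩ := integral_jump_odeSol hα₀ hα₁ hJm hJ hn hfm hf
  have hfi : IntervalIntegrable f volume 0 (t n) :=
    (intervalIntegrable_iff_integrableOn_Ioc_of_le hn).2
      (Integrable.of_bound hfm S
        ((ae_restrict_iff' measurableSet_Ioc).2 (Eventually.of_forall hf)))
  have hconv : convolution k f (t n) = ∫ x in Ioi (0 : ℝ), jump K x (odeSol x f (t n)) := by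
    rw [hval, convolution]
    refine intervalIntegral.integral_congr_ae ?_
    -- The formula for the kernel holds only almost everywhere; the reflection r ↦ t_n - r preserves
    -- null sets.
    have h1 := (Measure.measurePreserving_sub_left volume (t n)).quasiMeasurePreserving.ae
      (hk.ae_eq h hα₀ hα₁)
    filter_upwards [h1, volume.ae_ne (t n)] with r hr hrn hr'
    rw [uIoc_of_le hn] at hr'
    rw [hr (sub_pos.2 (lt_of_le_of_ne hr'.2 hrn))]
  have hle : ∫⁻ x in Ioi (0 : ℝ), ‖jump K x (odeError rk t n f x)‖ₑ
      ≤ ENNReal.ofReal (M / Real.pi * D) := by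
    calc _ ≤ ∫⁻ x in Ioi (0 : ℝ), ENNReal.ofReal (M / Real.pi) *
          (ENNReal.ofReal (x ^ (-α)) * ‖odeError rk t n f x‖ₑ) := by
          refine setLIntegral_mono' measurableSet_Ioi fun x hx => ?_
          have hx' : 0 < x := hx
          rw [← mul_assoc, ← ENNReal.ofReal_mul (by positivity), ← ofReal_norm, ← ofReal_norm,
            ← ENNReal.ofReal_mul (by positivity)]
          refine ENNReal.ofReal_le_ofReal (((jump K x).le_opNorm _).trans ?_)
          gcongr
          exact hJ x hx'
      _ = ENNReal.ofReal (M / Real.pi) * errorNorm α rk t n f := by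
          rw [lintegral_const_mul' _ _ ENNReal.ofReal_ne_top]
          rfl
      _ ≤ _ := by
          rw [ENNReal.ofReal_mul (by positivity)]
          gcongr
  have herrm : AEStronglyMeasurable (fun x => jump K x (odeError rk t n f x))
      (volume.restrict (Ioi 0)) :=
    isBoundedBilinearMap_apply.continuous.comp_aestronglyMeasurable
      (hJm.prodMk (aestronglyMeasurable_odeError hn hfi))
  have herri : IntegrableOn (fun x => jump K x (odeError rk t n f x)) (Ioi 0) :=
    ⟨herrm, hle.trans_lt ENNReal.ofReal_lt_top⟩
  have hdiff : convolution k f (t n) - gCQ rk K t f n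
      = ∫ x in Ioi (0 : ℝ), jump K x (odeError rk t n f x) := by
    -- The numerical solution is written as exact solution minus error, both of which are integrable
    -- against the jump; this gives its integrability too.
    have h1 : ∀ x, jump K x (odeApprox rk t f n x)
        = jump K x (odeSol x f (t n)) - jump K x (odeError rk t n f x) := by
      intro x
      rw [← map_sub, odeError, sub_sub_cancel]
    rw [gCQ, hconv]
    simp only [h1]
    rw [integral_sub hsol herri, sub_sub_cancel]
  rw [hdiff, ← ENNReal.ofReal_le_ofReal_iff (by positivity), ofReal_norm]
  exact (enorm_integral_le_lintegral_enorm _).trans hle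

end Jump

end RKgCQ

/-! ### Meshes, fractional expansions and the final assembly. -/

namespace RKgCQ

open MeasureTheory

universe u v

section Meshes

variable {T : ℝ} {N : ℕ} {t : ℕ → ℝ}

theorem IsMesh.step_pos (h : IsMesh T N t) {j : ℕ} (hj : 1 ≤ j) (hjN : j ≤ N) : 0 < step t j := by
  obtain ⟨i, rfl⟩ := Nat.exists_eq_add_of_le' hj
  simpa [step] using h.lt_succ i hjN

theorem IsMesh.monotone_le (h : IsMesh T N t) {i j : ℕ} (hij : i ≤ j) (hj : j ≤ N) : t i ≤ t j := by
  induction j, hij using Nat.le_induction with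
  | base => exact le_rfl
  | succ j hij ih => exact (ih (by omega)).trans (h.lt_succ j hj).le

theorem step_le_maxStep (t : ℕ → ℝ) {j : ℕ} (hj : 1 ≤ j) (hjN : j ≤ N) :
    step t j ≤ maxStep N t := by
  obtain ⟨i, rfl⟩ := Nat.exists_eq_add_of_le' hj
  exact le_ciSup (f := fun j : Fin N => step t (j + 1)) (finite_range _).bddAbove ⟨i, hjN⟩

theorem IsMesh.isPartialMesh (h : IsMesh T N t) {n : ℕ} (hn : 1 ≤ n) (hnN : n ≤ N) :
    IsPartialMesh T (maxStep N t) n t where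
  zero := h.zero
  le := h.last ▸ h.monotone_le hnN le_rfl
  one_le := hn
  step_pos _ hj hjn := h.step_pos hj (hjn.trans hnN)
  step_le _ hj hjn := step_le_maxStep t hj (hjn.trans hnN)
  max_le := by
    have : Nonempty (Fin N) := ⟨⟨0, by omega⟩⟩
    refine ciSup_le fun j => ?_
    have h1 := h.monotone_le (i := j + 1) (j := N) j.2 le_rfl
    have h2 := h.monotone_le (i := 0) (j := j) (Nat.zero_le _) j.2.le
    rw [h.last] at h1
    rw [h.zero] at h2
    simp only [step, Nat.add_sub_cancel]
    linarith

theorem one_le_quasiUniformity (N : ℕ) (t : ℕ → ℝ) : 1 ≤ quasiUniformity N t :=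
  le_max_left _ _

/-- A ratio is at most the sum of itself and its inverse, hence at most twice their mean. -/
theorem IsMesh.step_le_mul_step (h : IsMesh T N t) {j : ℕ} (hj : 2 ≤ j) (hjN : j ≤ N) :
    step t j ≤ 2 * quasiUniformity N t * step t (j - 1) := by
  obtain ⟨i, rfl⟩ := Nat.exists_eq_add_of_le' hj
  have h1 := h.step_pos (j := i + 1) (by omega) (by omega)
  have h2 := h.step_pos (j := i + 2) (by omega) hjN
  have h3 : (step t (i + 2) / step t (i + 1) + step t (i + 1) / step t (i + 2)) / 2
      ≤ quasiUniformity N t :=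
    (le_ciSup (f := fun i : Fin (N - 1) =>
      (step t (i + 2) / step t (i + 1) + step t (i + 1) / step t (i + 2)) / 2)
      (finite_range _).bddAbove ⟨i, by omega⟩).trans (le_max_right _ _)
  have h4 : 0 < step t (i + 1) / step t (i + 2) := div_pos h1 h2
  rw [show i + 2 - 1 = i + 1 by omega, ← div_le_iff₀ h1]
  linarith

end Meshes

section SupNorm

variable {X : Type*} [NormedAddCommGroup X]

theorem norm_le_supNorm {g : ℝ → X} {b r : ℝ} (hg : ContinuousOn g (Icc 0 b))
    (hr : r ∈ Icc 0 b) : ‖g r‖ ≤ supNorm g b := by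
  refine le_ciSup (f := fun r : Icc (0 : ℝ) b => ‖g r‖) ?_ ⟨r, hr⟩
  have h1 := isCompact_Icc.bddAbove_image hg.norm
  rwa [image_eq_range] at h1

theorem supNorm_nonneg (g : ℝ → X) (b : ℝ) : 0 ≤ supNorm g b :=
  Real.iSup_nonneg fun _ => norm_nonneg _

end SupNorm

section Expansion

variable {X : Type*} [NormedAddCommGroup X] [NormedSpace ℂ X]

theorem aestronglyMeasurable_integral_rpow_smul (δ : ℝ) {g : ℝ → X} {b : ℝ}
    (hg : IntegrableOn g (Ioc 0 b)) :
    AEStronglyMeasurable (fun u => ∫ r in (0 : ℝ)..u, (u - r) ^ δ • g r)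
      (volume.restrict (Ioc 0 b)) := by
  have h1 : AEStronglyMeasurable (fun u => ∫ v in Ioc 0 b, truncPow δ v u • g v)
      (volume.restrict (Ioc 0 b)) := by
    refine AEStronglyMeasurable.integral_prod_right' (f := fun z : ℝ × ℝ =>
      truncPow δ z.2 z.1 • g z.2) ?_
    exact (measurable_truncPow δ).aestronglyMeasurable.smul hg.aestronglyMeasurable.comp_snd
  refine h1.congr ((ae_restrict_iff' measurableSet_Ioc).2 (Eventually.of_forall fun u hu => ?_))
  exact setIntegral_truncPow_smul δ g ⟨hu.1.le, hu.2⟩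

theorem norm_integral_rpow_smul_le {δ : ℝ} (hδ : 0 ≤ δ) {g : ℝ → X} {b S u : ℝ}
    (hS : ∀ r ∈ Icc 0 b, ‖g r‖ ≤ S) (hu : u ∈ Icc 0 b) :
    ‖∫ r in (0 : ℝ)..u, (u - r) ^ δ • g r‖ ≤ b ^ δ * S * b := by
  have hb : 0 ≤ b := hu.1.trans hu.2
  have hS0 : 0 ≤ S := (norm_nonneg _).trans (hS 0 ⟨le_rfl, hb⟩)
  refine (intervalIntegral.norm_integral_le_of_norm_le_const (C := b ^ δ * S)
    fun r hr => ?_).trans ?_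
  · rw [uIoc_of_le hu.1] at hr
    have h1 : 0 ≤ u - r := sub_nonneg.2 hr.2
    have h2 : u - r ≤ b := by linarith [hr.1, hu.2]
    rw [norm_smul, Real.norm_of_nonneg (by positivity)]
    exact mul_le_mul (Real.rpow_le_rpow h1 h2 hδ) (hS r ⟨hr.1.le, hr.2.trans hu.2⟩)
      (norm_nonneg _) (by positivity)
  · rw [sub_zero, abs_of_nonneg hu.1]
    exact mul_le_mul_of_nonneg_left hu.2 (by positivity)

variable {s : ℕ} {rk : RKMethod s}

/-- The error of the quadrature for a power function, on general meshes if the exponent is at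
least `p - α`, and on quasi-uniform meshes if it is at least `q + 1`. -/
theorem exists_errorNorm_rpow_smul_le {p q : ℕ} (h : rk.IsAdmissible p q) {α T : ℝ}
    (hα₀ : 0 < α) (hα₁ : α < 1) (hT : 0 < T) (e : ℝ) :
    ∃ C : ℝ, 0 < C ∧ ∀ (X : Type*) [NormedAddCommGroup X] [NormedSpace ℂ X] [CompleteSpace X]
      (t : ℕ → ℝ) (n : ℕ) (τ κ : ℝ) (a : X), IsPartialMesh T τ n t → 1 ≤ κ →
      (a ≠ 0 → (p : ℝ) - α ≤ e ∨
        ((q : ℝ) + 1 ≤ e ∧ ∀ j, 2 ≤ j → j ≤ n → step t j ≤ κ * step t (j - 1))) →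
      errorNorm α rk t n (fun u => u ^ e • a)
        ≤ ENNReal.ofReal (C * κ ^ max 0 ((p : ℝ) - q - α) * τ ^ min (p : ℝ) (q + 1 + α) * ‖a‖) := by
  by_cases h1 : (p : ℝ) - α ≤ e
  · obtain ⟨k, rfl⟩ := Nat.exists_eq_add_of_le' h.one_le_order
    obtain ⟨C, hC0, hC⟩ := exists_errorNorm_rpow_le h hα₀ hα₁ hT (δ := e) (by push_cast at h1; exact h1)
    refine ⟨C, hC0, fun X _ _ _ t n τ κ a hm hκ _ => ?_⟩
    have hτ := hm.pos
    rw [errorNorm_smul_const]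
    refine (mul_le_mul' (hC t n τ hm) le_rfl).trans ?_
    rw [← ofReal_norm, ← ENNReal.ofReal_mul (by positivity)]
    refine ENNReal.ofReal_le_ofReal ?_
    have h2 : 1 ≤ κ ^ max 0 (((k + 1 : ℕ) : ℝ) - q - α) :=
      Real.one_le_rpow hκ (le_max_left _ _)
    refine mul_le_mul_of_nonneg_right ?_ (norm_nonneg _)
    refine mul_le_mul_of_nonneg_right ?_ (by positivity)
    exact le_mul_of_one_le_right hC0.le h2
  push Not at h1
  by_cases h2 : (q : ℝ) + 1 ≤ e
  -- From q + 1 ≤ e < p - α it follows that q + 1 < p, so the estimate for quasi-uniform meshes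
  -- applies.
  · have hpq : q + 2 ≤ p := by
      have : ((q + 1 : ℕ) : ℝ) < p := by push_cast; linarith
      have := Nat.cast_lt.1 this
      omega
    obtain ⟨C, hC0, hC⟩ := exists_errorNorm_rpow_le_of_ratio h (T := T) hα₀ hα₁ hpq h2 (by linarith)
    refine ⟨C, hC0, fun X _ _ _ t n τ κ a hm hκ hcond => ?_⟩
    have hτ := hm.pos
    by_cases ha : a = 0
    · simp [ha, errorNorm_zero]
    rw [errorNorm_smul_const]
    have h3 : ∀ j, 2 ≤ j → j ≤ n → step t j ≤ κ * step t (j - 1) := by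
      rcases hcond ha with h3 | h3
      · exact absurd h3 (not_le.2 h1)
      · exact h3.2
    refine (mul_le_mul' (hC t n τ κ hm hκ h3) le_rfl).trans ?_
    rw [← ofReal_norm, ← ENNReal.ofReal_mul (by positivity), max_eq_right (by linarith)]
  -- No nonzero coefficient is admitted for such an exponent, so any constant will do.
  · refine ⟨1, one_pos, fun X _ _ _ t n τ κ a hm hκ hcond => ?_⟩
    have ha : a = 0 := by
      by_contra ha
      rcases hcond ha with h3 | h3
      · exact not_le.2 h1 h3
      · exact h2 h3.1
    simp [ha, errorNorm_zero]

/-- The common source of all three estimates of the theorem. Each power is treated on its own, under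
a condition imposed only where its coefficient does not vanish; with κ = 1 and exponents at least p
- α nothing is asked of the mesh. -/
theorem exists_norm_convolution_sub_gCQ_le {p q : ℕ} (h : rk.IsAdmissible p q) {α δ T : ℝ}
    (hα₀ : 0 < α) (hα₁ : α < 1) (hT : 0 < T) (β : ℝ) (L : ℕ) (hδ : (p : ℝ) - 1 ≤ δ) :
    ∃ C : ℝ, 0 < C ∧ ∀ (X : Type u) (Y : Type v) [NormedAddCommGroup X] [NormedSpace ℂ X] [CompleteSpace X]
      [NormedAddCommGroup Y] [NormedSpace ℂ Y] [CompleteSpace Y]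
      (K : ℂ → X →L[ℂ] Y) (k : ℝ → X →L[ℂ] Y) (M : ℝ), 0 < M →
      IsSectorial K M α → IsLaplaceTransform k K →
      ∀ (t : ℕ → ℝ) (n : ℕ) (τ κ : ℝ), IsPartialMesh T τ n t → 1 ≤ κ →
      ∀ (f : ℝ → X) (a : ℕ → X) (g : ℝ → X), ContinuousOn g (Icc 0 (t n)) →
      (∀ u ∈ Icc 0 (t n), f u
        = ∑ ℓ ∈ Finset.range L, (u ^ (ℓ + β) / Real.Gamma (ℓ + β + 1)) • a ℓ
          + (1 / Real.Gamma (δ + 1)) • ∫ r in (0 : ℝ)..u, (u - r) ^ δ • g r) →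
      (∀ ℓ < L, a ℓ ≠ 0 → (p : ℝ) - α ≤ ℓ + β ∨
        ((q : ℝ) + 1 ≤ ℓ + β ∧ ∀ j, 2 ≤ j → j ≤ n → step t j ≤ κ * step t (j - 1))) →
      ‖convolution k f (t n) - gCQ rk K t f n‖
        ≤ C * M * κ ^ max 0 ((p : ℝ) - q - α) * τ ^ min (p : ℝ) (q + 1 + α)
          * (∑ ℓ ∈ Finset.range L, ‖a ℓ‖ + supNorm g (t n)) := by
  have hp1 := h.one_le_order
  have hpR : (1 : ℝ) ≤ p := by exact_mod_cast hp1
  have hδ0 : 0 ≤ δ := by linarith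
  choose C hC0 hC using fun ℓ : ℕ => exists_errorNorm_rpow_smul_le h hα₀ hα₁ hT ((ℓ : ℝ) + β)
  obtain ⟨C', hC'0, hC'⟩ : ∃ C : ℝ, 0 < C ∧ ∀ (X : Type u) [NormedAddCommGroup X]
      [NormedSpace ℂ X] [CompleteSpace X]
      (t : ℕ → ℝ) (n : ℕ) (τ S : ℝ) (g : ℝ → X), IsPartialMesh T τ n t →
      IntegrableOn g (Ioc 0 (t n)) → (∀ r ∈ Icc 0 (t n), ‖g r‖ ≤ S) →
      errorNorm α rk t n (fun u => ∫ r in (0 : ℝ)..u, (u - r) ^ δ • g r)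
        ≤ ENNReal.ofReal (C * τ ^ min (p : ℝ) (q + 1 + α) * S) := by
    obtain ⟨k, rfl⟩ := Nat.exists_eq_add_of_le' hp1
    exact exists_errorNorm_convolution_le h hα₀ hα₁ hT (by push_cast at hδ; linarith)
  set γ : ℕ → ℝ := fun ℓ => (Real.Gamma (ℓ + β + 1))⁻¹ with hγ
  set γ' : ℝ := (Real.Gamma (δ + 1))⁻¹ with hγ'
  set B : ℝ := ∑ ℓ ∈ Finset.range L, C ℓ * |γ ℓ| + C' * |γ'| + 1 with hB
  have hsum0 : 0 ≤ ∑ ℓ ∈ Finset.range L, C ℓ * |γ ℓ| :=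
    Finset.sum_nonneg fun ℓ _ => mul_nonneg (hC0 ℓ).le (abs_nonneg _)
  have hB0 : 0 < B := by positivity
  refine ⟨B / Real.pi, div_pos hB0 Real.pi_pos, fun X Y _ _ _ _ _ _ K k M hM hK hk t n τ κ hm hκ
    f a g hg hf hcond => ?_⟩
  have hτ := hm.pos
  have hn := hm.last_pos
  have hS0 := supNorm_nonneg g (t n)
  set S := supNorm g (t n) with hS
  have hκ0 : 0 < κ := one_pos.trans_le hκ
  set κ' := κ ^ max 0 ((p : ℝ) - q - α) with hκ'
  have hκ'1 : 1 ≤ κ' := Real.one_le_rpow hκ (le_max_left _ _)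
  set μ := τ ^ min (p : ℝ) (q + 1 + α) with hμ
  have hμ0 : 0 < μ := by positivity
  set F : ℕ → ℝ → X := fun ℓ u => u ^ ((ℓ : ℝ) + β) • γ ℓ • a ℓ with hF
  set g' : ℝ → X := fun r => γ' • g r with hg'
  set H : ℝ → X := fun u => ∫ r in (0 : ℝ)..u, (u - r) ^ δ • g' r with hH
  have hfF : EqOn f (fun u => ∑ ℓ ∈ Finset.range L, F ℓ u + H u) (Icc 0 (t n)) := by
    intro u hu
    simp only [hf u hu, hF, hH, hg', hγ, hγ', div_eq_mul_inv, mul_smul, one_mul]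
    congr 1
    rw [← intervalIntegral.integral_smul]
    exact intervalIntegral.integral_congr fun r _ => smul_comm _ _ _
  have hFc : ∀ ℓ ∈ Finset.range L, ContinuousOn (F ℓ) (Icc 0 (t n)) := by
    -- A nonzero coefficient forces a nonnegative exponent, so powers singular at 0 never occur.
    intro ℓ hℓ
    by_cases ha : a ℓ = 0
    · simp only [hF, ha, smul_zero]
      exact continuousOn_const
    · have he : 0 ≤ (ℓ : ℝ) + β := by
        rcases hcond ℓ (Finset.mem_range.1 hℓ) ha with h1 | h1
        · linarith
        · linarith [h1.1, q.cast_nonneg (α := ℝ)]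
      exact (continuousOn_id.rpow_const fun _ _ => Or.inr he).smul continuousOn_const
  have hFi : ∀ ℓ ∈ Finset.range L, IntervalIntegrable (F ℓ) volume 0 (t n) := fun ℓ hℓ =>
    ContinuousOn.intervalIntegrable (by rw [uIcc_of_le hn.le]; exact hFc ℓ hℓ)
  have hg'c : ContinuousOn g' (Icc 0 (t n)) := hg.const_smul γ'
  have hg'i : IntegrableOn g' (Ioc 0 (t n)) := hg'c.integrableOn_Icc.mono_set Ioc_subset_Icc_self
  have hg'S : ∀ r ∈ Icc 0 (t n), ‖g' r‖ ≤ |γ'| * S := fun r hr => by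
    rw [norm_smul, Real.norm_eq_abs]
    exact mul_le_mul_of_nonneg_left (norm_le_supNorm hg hr) (abs_nonneg _)
  have hHm := aestronglyMeasurable_integral_rpow_smul δ hg'i
  have hHb : ∀ u ∈ Icc 0 (t n), ‖H u‖ ≤ t n ^ δ * (|γ'| * S) * t n := fun u hu =>
    norm_integral_rpow_smul_le hδ0 hg'S hu
  have hHi : IntervalIntegrable H volume 0 (t n) :=
    (intervalIntegrable_iff_integrableOn_Ioc_of_le hn.le).2 (Integrable.of_bound hHm _
      ((ae_restrict_iff' measurableSet_Ioc).2 (Eventually.of_forall fun u hu =>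
        hHb u (Ioc_subset_Icc_self hu))))
  have hsc : ContinuousOn (fun u => ∑ ℓ ∈ Finset.range L, F ℓ u) (Icc 0 (t n)) :=
    continuousOn_finsetSum _ hFc
  have hsi : IntervalIntegrable (fun u => ∑ ℓ ∈ Finset.range L, F ℓ u) volume 0 (t n) :=
    ContinuousOn.intervalIntegrable (by rwa [uIcc_of_le hn.le])
  obtain ⟨S₁, hS₁⟩ := isCompact_Icc.exists_bound_of_continuousOn hsc
  have hfm : AEStronglyMeasurable f (volume.restrict (Ioc 0 (t n))) := by
    refine ((hsc.mono Ioc_subset_Icc_self).aestronglyMeasurable measurableSet_Ioc).add hHm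
      |>.congr ((ae_restrict_iff' measurableSet_Ioc).2 (Eventually.of_forall fun u hu => ?_))
    exact (hfF (Ioc_subset_Icc_self hu)).symm
  have hfb : ∀ u ∈ Ioc 0 (t n), ‖f u‖ ≤ S₁ + t n ^ δ * (|γ'| * S) * t n := fun u hu => by
    rw [hfF (Ioc_subset_Icc_self hu)]
    exact (norm_add_le _ _).trans
      (add_le_add (hS₁ u (Ioc_subset_Icc_self hu)) (hHb u (Ioc_subset_Icc_self hu)))
  have hsa : 0 ≤ ∑ ℓ ∈ Finset.range L, ‖a ℓ‖ := Finset.sum_nonneg fun _ _ => norm_nonneg _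
  have herr : errorNorm α rk t n f
      ≤ ENNReal.ofReal (B * κ' * μ * (∑ ℓ ∈ Finset.range L, ‖a ℓ‖ + S)) := by
    rw [errorNorm_congr h hm hfF]
    refine (errorNorm_add_le α hn.le hsi hHi).trans ?_
    refine (add_le_add ((errorNorm_sum_le α _ F hn.le hFi).trans (Finset.sum_le_sum fun ℓ hℓ =>
      hC ℓ X t n τ κ (γ ℓ • a ℓ) hm hκ fun h1 =>
        hcond ℓ (Finset.mem_range.1 hℓ) fun h2 => h1 (by rw [h2, smul_zero])))
      (hC' X t n τ _ g' hm hg'i hg'S)).trans ?_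
    rw [← ENNReal.ofReal_sum_of_nonneg fun ℓ _ => by have := hC0 ℓ; positivity,
      ← ENNReal.ofReal_add (Finset.sum_nonneg fun ℓ _ => by have := hC0 ℓ; positivity)
        (by positivity)]
    refine ENNReal.ofReal_le_ofReal ?_
    have h1 : ∀ ℓ ∈ Finset.range L, C ℓ * κ' * μ * ‖γ ℓ • a ℓ‖
        ≤ (∑ ℓ ∈ Finset.range L, C ℓ * |γ ℓ|) * (κ' * μ * ‖a ℓ‖) := fun ℓ hℓ => by
      have h2 : C ℓ * |γ ℓ| ≤ ∑ ℓ ∈ Finset.range L, C ℓ * |γ ℓ| :=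
        Finset.single_le_sum (f := fun ℓ => C ℓ * |γ ℓ|)
          (fun ℓ _ => mul_nonneg (hC0 ℓ).le (abs_nonneg _)) hℓ
      rw [norm_smul, Real.norm_eq_abs]
      calc _ = C ℓ * |γ ℓ| * (κ' * μ * ‖a ℓ‖) := by ring
        _ ≤ _ := mul_le_mul_of_nonneg_right h2 (by positivity)
    have h3 : C' * μ * (|γ'| * S) ≤ C' * |γ'| * (κ' * μ * S) := by
      calc _ = C' * |γ'| * (1 * (μ * S)) := by ring
        _ ≤ C' * |γ'| * (κ' * (μ * S)) := by gcongr
        _ = _ := by ring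
    refine (add_le_add (Finset.sum_le_sum h1) h3).trans ?_
    rw [← Finset.mul_sum, ← Finset.mul_sum]
    set A := ∑ ℓ ∈ Finset.range L, ‖a ℓ‖
    have h4 : ∑ ℓ ∈ Finset.range L, C ℓ * |γ ℓ| ≤ B := by
      have : 0 ≤ C' * |γ'| := by positivity
      linarith
    have h5 : C' * |γ'| ≤ B := by linarith
    calc _ ≤ B * (κ' * μ * A) + B * (κ' * μ * S) := by gcongr
      _ = _ := by ring
  refine (norm_convolution_sub_gCQ_le hk hK hM hα₀ hα₁ hn.le hfm hfb (by positivity)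
    herr).trans (le_of_eq ?_)
  ring

end Expansion

section Taylor

variable {X : Type*} [NormedAddCommGroup X] [NormedSpace ℝ X]

theorem iteratedDerivWithin_subset {s s' : Set ℝ} {f : ℝ → X} {x : ℝ} {n : ℕ} (hss : s ⊆ s')
    (hs : UniqueDiffOn ℝ s) (hs' : UniqueDiffOn ℝ s') (hf : ContDiffOn ℝ n f s') (hx : x ∈ s) :
    iteratedDerivWithin n f s x = iteratedDerivWithin n f s' x := by
  rw [iteratedDerivWithin, iteratedDerivWithin,
    iteratedFDerivWithin_subset hss hs hs' hf hx]

/-- Taylor's formula for functions that vanish at `0` together with their derivatives. -/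
theorem eq_integral_rpow_smul_iteratedDerivWithin [CompleteSpace X] {k : ℕ} {f : ℝ → X} {T : ℝ} (hT : 0 < T)
    (hf : ContDiffOn ℝ (k + 1 : ℕ) f (Icc 0 T))
    (h0 : ∀ ℓ < k + 1, iteratedDerivWithin ℓ f (Icc 0 T) 0 = 0) {u : ℝ} (hu : u ∈ Icc 0 T) :
    f u = (1 / Real.Gamma ((k : ℝ) + 1)) • ∫ r in (0 : ℝ)..u,
      (u - r) ^ (k : ℝ) • iteratedDerivWithin (k + 1) f (Icc 0 T) r := by
  rcases hu.1.eq_or_lt with rfl | hu0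
  · simpa using h0 0 (by omega)
  have hss : Icc 0 u ⊆ Icc 0 T := Icc_subset_Icc_right hu.2
  have hd : ∀ ℓ ≤ k + 1, ∀ x ∈ Icc 0 u,
      iteratedDerivWithin ℓ f (Icc 0 u) x = iteratedDerivWithin ℓ f (Icc 0 T) x := fun ℓ hℓ x hx =>
    iteratedDerivWithin_subset hss (uniqueDiffOn_Icc hu0) (uniqueDiffOn_Icc hT)
      (hf.of_le (by exact_mod_cast hℓ)) hx
  have h1 := taylor_integral_remainder (n := k) (x₀ := 0) (x := u)
    (by rw [uIcc_of_le hu.1]; exact hf.mono hss)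
  rw [uIcc_of_le hu.1, taylor_within_apply, Finset.sum_eq_zero, sub_zero] at h1
  · rw [h1, ← intervalIntegral.integral_smul]
    refine intervalIntegral.integral_congr fun r hr => ?_
    rw [uIcc_of_le hu.1] at hr
    simp only [hd _ le_rfl r hr, Real.Gamma_nat_eq_factorial, Real.rpow_natCast, smul_smul]
    congr 1
    ring
  · intro ℓ hℓ
    have hℓ' := Finset.mem_range.1 hℓ
    rw [hd ℓ hℓ'.le 0 ⟨le_rfl, hu.1⟩, h0 ℓ hℓ', smul_zero]

end Taylor

end RKgCQ

namespace RKgCQ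

theorem sum_norm_eq_tailSum {X : Type*} [NormedAddCommGroup X] {j : ℤ} (m : ℤ) {a : ℕ → X}
    (ha : ∀ ℓ : ℕ, (ℓ : ℤ) ≤ j → a ℓ = 0) :
    ∑ ℓ ∈ Finset.range (m + 1).toNat, ‖a ℓ‖ = tailSum j m a := by
  refine (Finset.sum_filter_of_ne fun ℓ _ hℓ => ?_).symm
  by_contra hj
  exact hℓ (by rw [ha ℓ (not_lt.1 hj), norm_zero])

end RKgCQ

theorem mainTheorem1 {s : ℕ} (rk : RKgCQ.RKMethod s) (p q : ℕ) (hrk : rk.IsAdmissible p q)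
    (α β T : ℝ) (hα₀ : 0 < α) (hα₁ : α < 1) (hβ : -1 < β) (hT : 0 < T) :
    ∃ C : ℝ, 0 < C ∧
      ∀ (X Y : Type*) [NormedAddCommGroup X] [NormedSpace ℂ X] [CompleteSpace X]
        [NormedAddCommGroup Y] [NormedSpace ℂ Y] [CompleteSpace Y]
        (K : ℂ → X →L[ℂ] Y) (k : ℝ → X →L[ℂ] Y) (M : ℝ), 0 < M →
        RKgCQ.IsSectorial K M α → RKgCQ.IsLaplaceTransform k K →
        ∀ (N : ℕ) (t : ℕ → ℝ), RKgCQ.IsMesh T N t →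
        ∀ n : ℕ, 1 ≤ n → n ≤ N →
          -- general integrands
          (∀ (f : ℝ → X) (a : ℕ → X) (g : ℝ → X),
            RKgCQ.HasFractionalExpansion T β ⌈(p : ℝ) - β - 1⌉ f a g →
            -- general meshes
            ((∀ ℓ : ℕ, (ℓ : ℤ) ≤ ⌈(p : ℝ) - α - β - 1⌉ → a ℓ = 0) →
              ‖RKgCQ.convolution k f (t n) - RKgCQ.gCQ rk K t f n‖ ≤
                C * M * max 1 |Real.log (RKgCQ.minStep N t)|
                  * RKgCQ.maxStep N t ^ min (p : ℝ) (q + 1 + α)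
                  * (RKgCQ.tailSum ⌈(p : ℝ) - α - β - 1⌉ ⌈(p : ℝ) - β - 1⌉ a
                      + RKgCQ.supNorm g (t n))) ∧
            -- quasi-uniform meshes
            ((∀ ℓ : ℕ, (ℓ : ℤ) ≤ min ⌈(p : ℝ) - α - β - 1⌉ ⌈(q : ℝ) - β⌉ → a ℓ = 0) →
              ‖RKgCQ.convolution k f (t n) - RKgCQ.gCQ rk K t f n‖ ≤
                C * M * RKgCQ.quasiUniformity N t ^ max 0 ((p : ℝ) - q - α)
                  * max 1 |Real.log (RKgCQ.minStep N t)|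
                  * RKgCQ.maxStep N t ^ min (p : ℝ) (q + 1 + α)
                  * (RKgCQ.tailSum (min ⌈(p : ℝ) - α - β - 1⌉ ⌈(q : ℝ) - β⌉)
                        ⌈(p : ℝ) - β - 1⌉ a
                      + RKgCQ.supNorm g (t n)))) ∧
          -- the particular case of smooth integrands on general meshes
          (∀ f : ℝ → X, ContDiffOn ℝ p f (Set.Icc 0 T) →
            (∀ ℓ < p, iteratedDerivWithin ℓ f (Set.Icc 0 T) 0 = 0) →
            ‖RKgCQ.convolution k f (t n) - RKgCQ.gCQ rk K t f n‖ ≤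
              C * M * max 1 |Real.log (RKgCQ.minStep N t)|
                * RKgCQ.maxStep N t ^ min (p : ℝ) (q + 1 + α)
                * RKgCQ.supNorm (iteratedDerivWithin p f (Set.Icc 0 T)) (t n)) := by
  -- The choice of m as a ceiling makes the exponent m + β of the remainder kernel at least p - 1,
  -- as the estimate on general meshes requires.
  have hm : (p : ℝ) - 1 ≤ (⌈(p : ℝ) - β - 1⌉ : ℝ) + β := by
    linarith [Int.le_ceil ((p : ℝ) - β - 1)]
  obtain ⟨C₁, hC₁0, hC₁⟩ := RKgCQ.exists_norm_convolution_sub_gCQ_le hrk hα₀ hα₁ hT β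
    (⌈(p : ℝ) - β - 1⌉ + 1).toNat hm
  obtain ⟨C₂, hC₂0, hC₂⟩ := RKgCQ.exists_norm_convolution_sub_gCQ_le hrk hα₀ hα₁ hT β
    0 (le_refl ((p : ℝ) - 1))
  set e := max 0 ((p : ℝ) - q - α) with he
  have he0 : (0 : ℝ) ≤ e := le_max_left _ _
  have h2e : (1 : ℝ) ≤ 2 ^ e := Real.one_le_rpow one_le_two he0
  refine ⟨C₁ * 2 ^ e + C₂, by positivity, fun X Y _ _ _ _ _ _ K k M hM hK hk N t ht n hn hnN => ?_⟩
  have hmesh := ht.isPartialMesh hn hnN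
  have hτ := hmesh.pos
  have hss : Icc 0 (t n) ⊆ Icc 0 T := Icc_subset_Icc_right hmesh.le
  set μ := RKgCQ.maxStep N t ^ min (p : ℝ) (q + 1 + α) with hμ
  have hμ0 : 0 ≤ μ := Real.rpow_nonneg hτ.le _
  set Λ := max 1 |Real.log (RKgCQ.minStep N t)| with hΛ
  have hΛ1 : 1 ≤ Λ := le_max_left _ _
  -- The logarithmic factor is only used as a number that is at least 1.
  have hB : ∀ {c B : ℝ}, 0 ≤ c → c ≤ C₁ * 2 ^ e + C₂ → 0 ≤ B →
      c * M * μ * B ≤ (C₁ * 2 ^ e + C₂) * M * Λ * μ * B := fun {c B} hc0 hc hB0 => by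
    have h1 : c * M ≤ (C₁ * 2 ^ e + C₂) * M * Λ :=
      (mul_le_mul_of_nonneg_right hc hM.le).trans (le_mul_of_one_le_right (by positivity) hΛ1)
    gcongr
  have hC₁2 : C₁ ≤ C₁ * 2 ^ e := le_mul_of_one_le_right hC₁0.le h2e
  have htail : ∀ (j : ℤ) (a : ℕ → X) (g : ℝ → X),
      0 ≤ RKgCQ.tailSum j ⌈(p : ℝ) - β - 1⌉ a + RKgCQ.supNorm g (t n) := fun j a g =>
    add_nonneg (Finset.sum_nonneg fun _ _ => norm_nonneg _) (RKgCQ.supNorm_nonneg _ _)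
  -- Beyond ν the exponents are at least p - α, the threshold for general meshes; in the same way,
  -- beyond ⌈q - β⌉ they are at least q + 1.
  have hlarge : ∀ {ℓ : ℕ}, ⌈(p : ℝ) - α - β - 1⌉ < (ℓ : ℤ) → (p : ℝ) - α ≤ ℓ + β := fun {ℓ} hℓ => by
    have h1 : ((⌈(p : ℝ) - α - β - 1⌉ + 1 : ℤ) : ℝ) ≤ (ℓ : ℤ) := Int.cast_le.2 hℓ
    push_cast at h1
    linarith [Int.le_ceil ((p : ℝ) - α - β - 1)]
  refine ⟨fun f a g hf => ⟨fun ha => ?_, fun ha => ?_⟩, fun f hf h0 => ?_⟩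
  · have h1 := hC₁ X Y K k M hM hK hk t n _ 1 hmesh le_rfl f a g (hf.deriv_continuous.mono hss)
      (fun u hu => hf.expansion u (hss hu)) fun ℓ _ hℓ =>
        Or.inl (hlarge (not_le.1 fun h => hℓ (ha ℓ h)))
    rw [Real.one_rpow, mul_one, RKgCQ.sum_norm_eq_tailSum _ ha] at h1
    exact h1.trans (hB hC₁0.le (by linarith) (htail _ _ _))
  · have hc1 := RKgCQ.one_le_quasiUniformity N t
    set cΔ := RKgCQ.quasiUniformity N t with hcΔ
    -- Neighbouring steps have ratio at most 2 c_Δ; the power of 2 is moved into the constant.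
    have h1 := hC₁ X Y K k M hM hK hk t n _ (2 * cΔ) hmesh (by linarith) f a g
      (hf.deriv_continuous.mono hss) (fun u hu => hf.expansion u (hss hu)) fun ℓ _ hℓ => by
        rcases min_lt_iff.1 (not_le.1 fun h => hℓ (ha ℓ h)) with h2 | h2
        · exact Or.inl (hlarge h2)
        · refine Or.inr ⟨?_, fun j hj hjn => ht.step_le_mul_step hj (hjn.trans hnN)⟩
          have h3 : ((⌈(q : ℝ) - β⌉ + 1 : ℤ) : ℝ) ≤ (ℓ : ℤ) := Int.cast_le.2 h2
          push_cast at h3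
          linarith [Int.le_ceil ((q : ℝ) - β)]
    rw [RKgCQ.sum_norm_eq_tailSum _ ha, Real.mul_rpow zero_le_two (by linarith)] at h1
    have hce : 0 ≤ cΔ ^ e := Real.rpow_nonneg (by linarith) _
    refine h1.trans ((le_of_eq ?_).trans ((hB (c := C₁ * 2 ^ e) (by positivity) (by linarith)
      (mul_nonneg hce (htail (min ⌈(p : ℝ) - α - β - 1⌉ ⌈(q : ℝ) - β⌉) a g))).trans (le_of_eq ?_)))
    · ring
    · ring
  -- Smooth data need no powers at all: Taylor's formula with vanishing initial values is an
  -- expansion with an empty sum and remainder exponent p - 1.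
  · obtain ⟨k', rfl⟩ := Nat.exists_eq_add_of_le' hrk.one_le_order
    have h1 := hC₂ X Y K k M hM hK hk t n _ 1 hmesh le_rfl f 0
      (iteratedDerivWithin (k' + 1) f (Icc 0 T))
      ((hf.continuousOn_iteratedDerivWithin le_rfl (uniqueDiffOn_Icc hT)).mono hss)
      (fun u hu => by
        rw [Finset.sum_range_zero, zero_add,
          RKgCQ.eq_integral_rpow_smul_iteratedDerivWithin hT hf h0 (hss hu)]
        push_cast
        rw [add_sub_cancel_right])
      (fun ℓ hℓ => absurd hℓ (Nat.not_lt_zero ℓ))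
    rw [Real.one_rpow, mul_one, Finset.sum_range_zero, zero_add] at h1
    have : 0 ≤ C₁ * 2 ^ e := by positivity
    exact h1.trans (hB hC₂0.le (by linarith) (RKgCQ.supNorm_nonneg _ _))
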